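/- Let $M$ be a smooth (finite-dimensional, Hausdorff, second countable) manifold and let $D\subset TM\oplus T^*M$ be a Dirac structure, i.e. a smooth subbundle of rank $\dim M$ that is isotropic for the pairing $\langle(v,\alpha),(w,\beta)\rangle=\alpha(w)+\beta(v)$ and whose sections are closed under the Courant bracket $$[(X,\alpha),(Y,\beta)]=\bigl([X,Y],\,L_X\beta-L_Y\alpha-\tfrac12 d(\beta(X)-\alpha(Y))\bigr).$$ Let $\rho:D\to TM$, $(v,\alpha)\mapsto v$, be the anchor, and let $\omega_D\in\Gamma(\Lambda^2D^*)$ be the natural two-form $$\omega_D((v,\alpha),(w,\beta))=\tfrac12(\alpha(w)-\beta(v))=\alpha(w).$$ For $\theta\in\Gamma(D^*)$ put $(d_D\theta)(\sigma,\tau)=\rho(\sigma)(\theta(\tau))-\rho(\tau)(\theta(\sigma))-\theta([\sigma,\tau])$ for $\sigma,\tau\in\Gamma(D)$, and call $\theta$ horizontal if $\theta_m$ and $(d_D\theta)_m$ vanish as soon as one argument lies in $\ker\rho_m$, for every $m\in M$. Let $H\in C^\infty(M)$, let $I=[a,b]$ with $a<b$, and let $\gamma:I\to M$ be a smooth path.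 A Dirac path is a smooth map $\zeta:I\to D$ whose base path $c$ satisfies $\rho(\zeta(t))=\dot c(t)$ for all $t\in I$; it is a Dirac path over $\gamma$ if $c=\gamma$. Assume that the horizontal class $[\omega_D]$ vanishes, and let $\theta\in\Gamma(D^*)$ be horizontal with $d_D\theta=\omega_D$. Consider the functional on Dirac paths $$S(\zeta)=\int_I\bigl(\theta_{c(t)}(\zeta(t))+H(c(t))\bigr)\,dt ,\qquad c=\text{base path of }\zeta .$$ A Dirac path $\zeta$ is critical for $S$ among Dirac paths with the same end points if $\frac{d}{ds}\big|_{s=0}S(\zeta_s)=0$ for every smooth family $(\zeta_s)_{|s|<\varepsilon}$ of Dirac paths with $\zeta_0=\zeta$ whose base paths all have the same end points in $M$ as that of $\zeta$. Then the following statements are equivalent: (i) $\gamma$ is a Hamiltonian curve: $(\dot\gamma(t),dH_{\gamma(t)})\in D$ for all $t\in I$; (ii) there is at least one Dirac path over $\gamma$, and every Dirac path over $\gamma$ is critical for $S$ among Dirac paths with the same end points; (iii) there exists a Dirac path over $\gamma$ that is critical for $S$ among Dirac paths with the same end points. -/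

import Mathlib

open Set Bundle Manifold VectorField
open scoped ContDiff Topology

noncomputable section

namespace DiracGeometry

section Defs

variable (E : Type*) [NormedAddCommGroup E] [NormedSpace ℝ E]
  {M : Type*} [TopologicalSpace M] [ChartedSpace E M] [IsManifold 𝓘(ℝ, E) ∞ M]

/-- The cotangent space `T*_x M`. -/
abbrev CotangentSpace (x : M) : Type _ :=
  TangentSpace 𝓘(ℝ, E) x →L[ℝ] Trivial M ℝ x

/-- The generalized tangent space `T_x M ⊕ T*_x M`. As a family over `M` it is a smooth vector
bundle with typical fiber `E × (E →L[ℝ] ℝ)`. -/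
abbrev GenTangentSpace (x : M) : Type _ :=
  TangentSpace 𝓘(ℝ, E) x × CotangentSpace E x

variable (M) in
/-- The total space of the generalized tangent bundle `TM ⊕ T*M`. -/
abbrev GenTangentBundle : Type _ :=
  TotalSpace (E × (E →L[ℝ] ℝ)) (fun x : M ↦ GenTangentSpace E x)

/-- The model with corners of the total space of `TM ⊕ T*M`. -/
abbrev genModel : ModelWithCorners ℝ (E × (E × (E →L[ℝ] ℝ)))
    (ModelProd E (E × (E →L[ℝ] ℝ))) :=
  (𝓘(ℝ, E)).prod 𝓘(ℝ, E × (E →L[ℝ] ℝ))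

variable {E}

/-- Smoothness on the set `U` of a (set-theoretic) section of `TM ⊕ T*M`. -/
def SmoothSectionOn (σ : ∀ x : M, GenTangentSpace E x) (U : Set M) : Prop :=
  ContMDiffOn 𝓘(ℝ, E) (genModel E) ∞
    (fun x ↦ (TotalSpace.mk x (σ x) : GenTangentBundle E M)) U

/-- The symmetric pairing `⟨(v, α), (w, β)⟩ = α(w) + β(v)` on `T_x M ⊕ T*_x M`. -/
def pairing {x : M} (a b : GenTangentSpace E x) : ℝ := a.2 b.1 + b.2 a.1

/-- The Lie derivative `L_X β` of a one-form `β` along a vector field `X`, at the point `x`,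
computed in the preferred chart at `x` by `(L_X β)(w) = (Dβ · X)(w) + β(DX · w)` and pulled back
to `T_x M` (as for `VectorField.mlieBracket`). -/
def lieDerivOneForm (X : ∀ x : M, TangentSpace 𝓘(ℝ, E) x) (β : ∀ x : M, CotangentSpace E x)
    (x : M) : CotangentSpace E x :=
  let φ := extChartAt 𝓘(ℝ, E) x
  let X' : E → E := mpullback 𝓘(ℝ, E) 𝓘(ℝ, E) φ.symm X
  let β' : E → E →L[ℝ] ℝ := fun p ↦ (β (φ.symm p)).comp (mfderiv 𝓘(ℝ, E) 𝓘(ℝ, E) φ.symm p)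
  (fderiv ℝ β' (φ x) (X' (φ x)) + (β' (φ x)).comp (fderiv ℝ X' (φ x))).comp
    (mfderiv 𝓘(ℝ, E) 𝓘(ℝ, E) φ x)

/-- The differential `df` of a function, as a one-form. -/
def differential (f : M → ℝ) (x : M) : CotangentSpace E x := mvfderiv 𝓘(ℝ, E) f x

/-- The Courant bracket
`[(X, α), (Y, β)] = ([X, Y], L_X β - L_Y α - (1/2) d(β(X) - α(Y)))`. -/
def courantBracket (σ τ : ∀ x : M, GenTangentSpace E x) (x : M) : GenTangentSpace E x :=
  (mlieBracket 𝓘(ℝ, E) (fun y ↦ (σ y).1) (fun y ↦ (τ y).1) x,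
    lieDerivOneForm (fun y ↦ (σ y).1) (fun y ↦ (τ y).2) x
      - lieDerivOneForm (fun y ↦ (τ y).1) (fun y ↦ (σ y).2) x
      - (1 / 2 : ℝ) • differential (fun y ↦ (τ y).2 (σ y).1 - (σ y).2 (τ y).1) x)

variable (E M) in
/-- A Dirac structure on `M`: a smooth subbundle of `TM ⊕ T*M` of rank `dim M` which is isotropic
for the pairing and involutive for the Courant bracket. -/
structure DiracStructure where
  /-- The fiber `D_x ⊆ T_x M ⊕ T*_x M`. -/
  fiber : ∀ x : M, Submodule ℝ (GenTangentSpace E x)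
  /-- `D` is a smooth subbundle of rank `dim M`: it has smooth local frames. -/
  subbundle : ∀ x₀ : M, ∃ U : Set M, IsOpen U ∧ x₀ ∈ U ∧
    ∃ e : Fin (Module.finrank ℝ E) → ∀ x : M, GenTangentSpace E x,
      (∀ i, SmoothSectionOn (e i) U) ∧
      ∀ x ∈ U, LinearIndependent ℝ (fun i ↦ e i x) ∧
        Submodule.span ℝ (Set.range fun i ↦ e i x) = fiber x
  isotropic : ∀ (x : M), ∀ a ∈ fiber x, ∀ b ∈ fiber x, pairing a b = 0
  involutive : ∀ σ τ : ∀ x : M, GenTangentSpace E x,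
    SmoothSectionOn σ univ → (∀ x, σ x ∈ fiber x) →
    SmoothSectionOn τ univ → (∀ x, τ x ∈ fiber x) →
    ∀ x, courantBracket σ τ x ∈ fiber x

namespace DiracStructure

variable (D : DiracStructure E M)

/-- The space `Γ(D)` of smooth sections of `D`. -/
structure Sec where
  toFun : ∀ x : M, GenTangentSpace E x
  smooth : SmoothSectionOn toFun univ
  mem : ∀ x, toFun x ∈ D.fiber x

variable {D}

/-- The value of a section of `D` at a point, as an element of the fiber of `D`. -/
def Sec.val (σ : D.Sec) (x : M) : D.fiber x := ⟨σ.toFun x, σ.mem x⟩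

/-- The bracket of two sections of `D`, evaluated at a point. -/
def Sec.bracket (σ τ : D.Sec) (x : M) : D.fiber x :=
  ⟨courantBracket σ.toFun τ.toFun x,
    D.involutive σ.toFun τ.toFun σ.smooth σ.mem τ.smooth τ.mem x⟩

variable (D)

/-- The anchor `ρ : D → TM`, `(v, α) ↦ v`. -/
def anchor (x : M) : D.fiber x →ₗ[ℝ] TangentSpace 𝓘(ℝ, E) x :=
  (LinearMap.fst ℝ (TangentSpace 𝓘(ℝ, E) x) (CotangentSpace E x)).comp (D.fiber x).subtype

/-- The space `Γ(D*)` of smooth sections of the dual bundle of `D`: fiberwise linear functionals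
whose evaluation on every smooth section of `D` is a smooth function. -/
structure DualSec where
  toFun : ∀ x : M, D.fiber x →ₗ[ℝ] ℝ
  smooth : ∀ σ : D.Sec, ContMDiff 𝓘(ℝ, E) 𝓘(ℝ, ℝ) ∞ (fun x ↦ toFun x (σ.val x))

variable {D}

/-- The Lie algebroid differential of `θ ∈ Γ(D*)`,
`(d_D θ)(σ, τ) = ρ(σ)(θ(τ)) - ρ(τ)(θ(σ)) - θ([σ, τ])`. -/
def DualSec.dD (θ : D.DualSec) (σ τ : D.Sec) (x : M) : ℝ :=
  mvfderiv 𝓘(ℝ, E) (fun y ↦ θ.toFun y (τ.val y)) x (D.anchor x (σ.val x))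
    - mvfderiv 𝓘(ℝ, E) (fun y ↦ θ.toFun y (σ.val y)) x (D.anchor x (τ.val x))
    - θ.toFun x (σ.bracket τ x)

variable (D) in
/-- The natural two-form of `D`,
`ω_D((v, α), (w, β)) = (1/2) (α(w) - β(v))`, equal to `α(w)` as `D` is isotropic. -/
def omega (x : M) (a b : D.fiber x) : ℝ :=
  (1 / 2 : ℝ) * (a.1.2 b.1.1 - b.1.2 a.1.1)

/-- `θ ∈ Γ(D*)^hor`: both `θ` and `d_D θ` vanish, at every point of `M`, as soon as one
argument is in the kernel of the anchor. -/
def DualSec.IsHorizontal (θ : D.DualSec) : Prop :=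
  (∀ (x : M) (a : D.fiber x), D.anchor x a = 0 → θ.toFun x a = 0) ∧
  ∀ (x : M) (σ τ : D.Sec), D.anchor x (σ.val x) = 0 → θ.dD σ τ x = 0

/-- `θ` is a primitive of `ω_D` for the Lie algebroid differential: `d_D θ = ω_D`. -/
def DualSec.IsPrimitive (θ : D.DualSec) : Prop :=
  ∀ (σ τ : D.Sec) (x : M), θ.dD σ τ x = D.omega x (σ.val x) (τ.val x)

open Classical in
/-- The value `θ(a)` for `a ∈ D`, as a function on all of `TM ⊕ T*M` (zero outside `D`). -/
def DualSec.eval (θ : D.DualSec) (a : GenTangentBundle E M) : ℝ :=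
  if h : a.2 ∈ D.fiber a.1 then θ.toFun a.1 ⟨a.2, h⟩ else 0

end DiracStructure

/-- The velocity at time `t` of a path defined on `[a, b]` (one-sided at the end points). -/
def velocity (a b : ℝ) (γ : ℝ → M) (t : ℝ) : TangentSpace 𝓘(ℝ, E) (γ t) :=
  mfderivWithin 𝓘(ℝ, ℝ) 𝓘(ℝ, E) γ (Icc a b) t (1 : ℝ)

variable (D : DiracStructure E M) (a b : ℝ)

/-- `γ : [a, b] → M` is a Hamiltonian curve of `H`: `(γ'(t), dH_{γ(t)}) ∈ D` for all `t`. -/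
def IsHamiltonianCurve (H : M → ℝ) (γ : ℝ → M) : Prop :=
  ∀ t ∈ Icc a b,
    ((velocity a b γ t, differential H (γ t)) : GenTangentSpace E (γ t)) ∈ D.fiber (γ t)

/-- `ζ : [a, b] → D` is a Dirac path: it is smooth, takes values in `D`, and its anchor is the
velocity of its base path. -/
structure IsDiracPath (ζ : ℝ → GenTangentBundle E M) : Prop where
  smooth : ContMDiffOn 𝓘(ℝ, ℝ) (genModel E) ∞ ζ (Icc a b)
  mem : ∀ t ∈ Icc a b, (ζ t).2 ∈ D.fiber (ζ t).1
  anchor_eq : ∀ t ∈ Icc a b, (ζ t).2.1 = velocity a b (fun u ↦ (ζ u).1) t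

/-- `ζ` is a Dirac path over the path `γ`. -/
def IsDiracPathOver (γ : ℝ → M) (ζ : ℝ → GenTangentBundle E M) : Prop :=
  IsDiracPath D a b ζ ∧ ∀ t ∈ Icc a b, (ζ t).1 = γ t

/-- A smooth variation `Z(t, s)`, `(t, s) ∈ [a, b] × (-ε, ε)`, of `ζ` among Dirac paths whose base
paths have the same end points as the base path of `ζ`. -/
structure IsDiracVariation (ζ : ℝ → GenTangentBundle E M) (ε : ℝ)
    (Z : ℝ → ℝ → GenTangentBundle E M) : Prop where
  smooth : ContMDiffOn 𝓘(ℝ, ℝ × ℝ) (genModel E) ∞ (fun p : ℝ × ℝ ↦ Z p.1 p.2)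
    (Icc a b ×ˢ Ioo (-ε) ε)
  initial : ∀ t ∈ Icc a b, Z t 0 = ζ t
  diracPath : ∀ s ∈ Ioo (-ε) ε, IsDiracPath D a b (fun t ↦ Z t s)
  left_end : ∀ s ∈ Ioo (-ε) ε, (Z a s).1 = (ζ a).1
  right_end : ∀ s ∈ Ioo (-ε) ε, (Z b s).1 = (ζ b).1

variable {D}

/-- The functional `ζ ↦ ∫ (θ(ζ(t)) + H(γ(t))) dt`, with `γ` the base path of `ζ`. -/
def action (θ : D.DualSec) (H : M → ℝ) (ζ : ℝ → GenTangentBundle E M) : ℝ :=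
  ∫ t in a..b, (θ.eval (ζ t) + H (ζ t).1)

/-- `ζ` is a critical point of the functional among Dirac paths with the same end points: along
every smooth variation, the derivative of the functional at `s = 0` exists and vanishes. -/
def IsCritical (θ : D.DualSec) (H : M → ℝ) (ζ : ℝ → GenTangentBundle E M) : Prop :=
  ∀ (ε : ℝ) (Z : ℝ → ℝ → GenTangentBundle E M), 0 < ε → IsDiracVariation D a b ζ ε Z →
    HasDerivAt (fun s ↦ action a b θ H (fun t ↦ Z t s)) 0 0

end Defs

end DiracGeometry

end

/-! Let `ζ = (ċ, α)` be a Dirac path and `v` the variation field of its base path. Everything rests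
on the first variation formula `IsDiracVariation.hasDerivAt_action`: along a variation with fixed
end points, the derivative of `S` at `s = 0` is `∫ (dH(v) - α(v)) dt`.

To obtain it, let `y(t, s)` be the components of the variation in a local frame of `D`, and solve
the linear equation `β' = ∂ₛy - [y, β]`, where the bracket is built from the structure functions of
the frame. The anchor of `β` satisfies the same linear equation as `v`, so `β` stays a lift of `v`
once it is one; and `d_D θ = ω_D` says exactly that `θ(β)' = ∂ₛ θ(ζ) + α(v)`
(`LocalModel.exists_transport`). Starting from the lift `0` at `a` and passing from chart to chart
(`IsDiracVariation.exists_lift`), one reaches at `b` a lift of `v(b) = 0`. It lies in the kernel of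
the anchor, though it need not be zero, and `θ` kills it by horizontality. Hence `∫ ∂ₛ θ(ζ) = -∫
α(v)`. The same argument shows that `v` always takes values in `ρ(D)`.

Suppose the base path is Hamiltonian and `e ∈ D` lifts `v(t)`. Isotropy, applied to `e` against `(ċ,
dH)` and against `(ċ, α)`, gives `dH(v) = α(v)`, so the integrand vanishes whatever the Dirac path
over that base. The path `(ċ, dH)` itself provides the existence in (ii).

Conversely, criticality has to be tested on enough variations. The flow of a frame field `X i` lifts
to the frame components in such a way that the equation `ċ = ρ(ζ)` is preserved. Moving the point at
time `t` by flow time `s η(t)`, and adding `s η'(t)` to the `i`-th component, yields a Dirac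
variation with `v = η X i` (`exists_isDiracVariation`). With bump functions `η`, criticality forces
`dH - α` to vanish on `ρ(D)` along the path. Then `(ċ, dH)` is orthogonal to `D`, and `D`, isotropic
of half the rank of `TM ⊕ T*M`, is its own orthogonal (`mem_of_isotropic`).

Smoothness of the flow in time and initial point comes from the inverse function theorem in the
Banach space of continuous curves on `[-1, 1]`. -/

namespace DiracGeometry

/-! ### Composition operators on spaces of continuous functions. -/

section Nemytskii

variable {K : Type*} [TopologicalSpace K] [CompactSpace K]

/-- A continuous bilinear map applied pointwise to continuous functions. -/
noncomputable def pointwiseBilin {P F G : Type*} [NormedAddCommGroup P] [NormedSpace ℝ P]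
    [NormedAddCommGroup F] [NormedSpace ℝ F] [NormedAddCommGroup G] [NormedSpace ℝ G]
    (B : P →L[ℝ] F →L[ℝ] G) : C(K, P) →L[ℝ] C(K, F) →L[ℝ] C(K, G) :=
  LinearMap.mkContinuous₂
    (LinearMap.mk₂ ℝ (fun (A : C(K, P)) (h : C(K, F)) ↦
        (⟨fun t ↦ B (A t) (h t), by fun_prop⟩ : C(K, G)))
      (fun A A' h ↦ by ext t; simp) (fun c A h ↦ by ext t; simp)
      (fun A h k ↦ by ext t; simp) (fun c A h ↦ by ext t; simp)) ‖B‖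
    (fun A h ↦ by
      refine (ContinuousMap.norm_le _ (by positivity)).2 fun t ↦ ?_
      exact B.le_of_opNorm₂_le_of_le le_rfl (A.norm_coe_le_norm t) (h.norm_coe_le_norm t))

theorem pointwiseBilin_apply {P F G : Type*} [NormedAddCommGroup P] [NormedSpace ℝ P]
    [NormedAddCommGroup F] [NormedSpace ℝ F] [NormedAddCommGroup G] [NormedSpace ℝ G]
    (B : P →L[ℝ] F →L[ℝ] G) (A : C(K, P)) (h : C(K, F)) (t : K) :
    pointwiseBilin B A h t = B (A t) (h t) := rfl

/-- The range of `u` is compact, so `f'` at points near the range is uniformly close to its value at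
the nearby `u t`. The mean value inequality on balls of one common radius around the points `u t`
then bounds the remainder uniformly in `t`. -/
theorem hasFDerivAt_postcomp {F G : Type*} [NormedAddCommGroup F] [NormedSpace ℝ F]
    [NormedAddCommGroup G] [NormedSpace ℝ G] {f : F → G} {f' : F → F →L[ℝ] G}
    (hf : ∀ x, HasFDerivAt f (f' x) x) (hf' : Continuous f') (u : C(K, F)) :
    HasFDerivAt (fun w : C(K, F) ↦
        (ContinuousMap.mk f (continuous_iff_continuousAt.2 fun x ↦ (hf x).continuousAt)).comp w)
      (pointwiseBilin (.id ℝ (F →L[ℝ] G)) ((ContinuousMap.mk f' hf').comp u)) u := by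
  rw [hasFDerivAt_iff_isLittleO_nhds_zero, Asymptotics.isLittleO_iff]
  intro ε hε
  have hc : IsCompact (range u) := isCompact_range u.continuous
  have h := hc.uniformContinuousAt_of_continuousAt f' (fun x _ ↦ hf'.continuousAt)
    (Metric.dist_mem_uniformity hε)
  obtain ⟨δ, hδ, hδ'⟩ := Metric.mem_uniformity_dist.1 h
  filter_upwards [Metric.ball_mem_nhds (0 : C(K, F)) hδ] with k hk
  rw [mem_ball_zero_iff] at hk
  refine (ContinuousMap.norm_le _ (by positivity)).2 fun t ↦ ?_
  have hkt : ‖k t‖ < δ := (k.norm_coe_le_norm t).trans_lt hk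
  have := (convex_ball (u t) δ).norm_image_sub_le_of_norm_hasFDerivWithin_le'
    (f := f) (f' := f') (φ := f' (u t)) (C := ε)
    (fun x _ ↦ (hf x).hasFDerivWithinAt) (fun x hx ↦ by
      have := hδ' (a := u t) (b := x) (by rw [dist_comm]; exact hx) (mem_range_self t)
      rw [← dist_eq_norm, dist_comm]; exact this.le)
    (Metric.mem_ball_self hδ) (y := u t + k t) (by simpa [Metric.mem_ball, dist_eq_norm] using hkt)
  simp only [add_sub_cancel_left] at this
  refine le_trans ?_ (this.trans (mul_le_mul_of_nonneg_left (k.norm_coe_le_norm t) hε.le))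
  simp [pointwiseBilin_apply]

/-- The derivative of composition with `f` is composition with `f'` followed by a continuous linear
map, so induction on the order applies. The target must vary in the induction, since `f'` takes
values in `F →L[ℝ] G`; for the same reason both spaces live in one universe. -/
theorem contDiff_postcomp_nat.{u} {F : Type u} [NormedAddCommGroup F] [NormedSpace ℝ F] (n : ℕ) :
    ∀ {G : Type u} [NormedAddCommGroup G] [NormedSpace ℝ G] {f : F → G} (hf : ContDiff ℝ n f),
    ContDiff ℝ n (fun w : C(K, F) ↦ (ContinuousMap.mk f hf.continuous).comp w) := by
  induction n with
  | zero =>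
    intro G _ _ f hf
    exact contDiff_zero.2 (ContinuousMap.continuous_postcomp _)
  | succ n ih =>
    intro G _ _ f hf
    have hf2 : ContDiff ℝ (n + 1 : ℕ∞ω) f := by exact_mod_cast hf
    have h1 := (contDiff_succ_iff_fderiv.1 hf2)
    have h2 : ContDiff ℝ (n + 1 : ℕ∞ω)
      (fun w : C(K, F) ↦ (ContinuousMap.mk f hf.continuous).comp w) := by
      rw [contDiff_succ_iff_hasFDerivAt]
      refine ⟨fun u ↦ pointwiseBilin (.id ℝ (F →L[ℝ] G)) ((ContinuousMap.mk (fderiv ℝ f) h1.2.2.continuous).comp u),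
        ContDiff.comp (g := pointwiseBilin (K := K) (.id ℝ (F →L[ℝ] G)))
          (f := fun w ↦ (ContinuousMap.mk (fderiv ℝ f) h1.2.2.continuous).comp w)
          (ContinuousLinearMap.contDiff _) (ih h1.2.2), fun u ↦ ?_⟩
      exact hasFDerivAt_postcomp (fun x ↦ (h1.1 x).hasFDerivAt) h1.2.2.continuous u
    exact_mod_cast h2

/-- Composition with a smooth map is a smooth map between spaces of continuous functions. -/
theorem contDiff_postcomp.{u} {F G : Type u} [NormedAddCommGroup F] [NormedSpace ℝ F]
    [NormedAddCommGroup G] [NormedSpace ℝ G] {f : F → G} (hf : ContDiff ℝ ∞ f) :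
    ContDiff ℝ ∞ (fun w : C(K, F) ↦ (ContinuousMap.mk f hf.continuous).comp w) :=
  contDiff_infty.2 fun n ↦ contDiff_postcomp_nat n (contDiff_infty.1 hf n)

end Nemytskii

/-! ### Smooth local flows through the inverse function theorem. -/

section Flow

variable {F : Type*} [NormedAddCommGroup F] [NormedSpace ℝ F]

theorem neg_one_le_one_real : (-1 : ℝ) ≤ 1 := by norm_num

/-- The primitive vanishing at `0` of a continuous function on `[-1, 1]`. -/
noncomputable def primitiveL (F : Type*) [NormedAddCommGroup F] [NormedSpace ℝ F] :
    C(Icc (-1 : ℝ) 1, F) →L[ℝ] C(Icc (-1 : ℝ) 1, F) :=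
  LinearMap.mkContinuous
    { toFun := fun u ↦ ⟨fun t ↦ ∫ τ in (0 : ℝ)..t, IccExtend neg_one_le_one_real u τ, by
        have h : Continuous (IccExtend neg_one_le_one_real u) := u.continuous.Icc_extend'
        exact (intervalIntegral.continuous_primitive (fun a b ↦ h.intervalIntegrable a b) 0).comp
          continuous_subtype_val⟩
      map_add' := fun u w ↦ by
        ext t
        have h : ∀ u : C(Icc (-1 : ℝ) 1, F), Continuous (IccExtend neg_one_le_one_real u) :=
          fun u ↦ u.continuous.Icc_extend'
        simp only [ContinuousMap.coe_mk, ContinuousMap.add_apply]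
        rw [← intervalIntegral.integral_add ((h u).intervalIntegrable _ _)
          ((h w).intervalIntegrable _ _)]
        rfl
      map_smul' := fun c u ↦ by
        ext t
        simp only [ContinuousMap.coe_mk, ContinuousMap.smul_apply, RingHom.id_apply]
        rw [← intervalIntegral.integral_smul]
        rfl } 1
    (fun u ↦ by
      refine (ContinuousMap.norm_le _ (by positivity)).2 fun t ↦ ?_
      have := intervalIntegral.norm_integral_le_of_norm_le_const (a := 0) (b := (t : ℝ))
        (f := IccExtend neg_one_le_one_real u) (C := ‖u‖) (fun x _ ↦ u.norm_coe_le_norm _)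
      refine this.trans ?_
      rw [one_mul, sub_zero]
      exact mul_le_of_le_one_right (norm_nonneg _) (abs_le.2 t.2))

/-- The constant function, as a continuous linear map. -/
noncomputable def constL (F : Type*) [NormedAddCommGroup F] [NormedSpace ℝ F] :
    F →L[ℝ] C(Icc (-1 : ℝ) 1, F) :=
  LinearMap.mkContinuous
    { toFun := fun x ↦ ContinuousMap.const _ x
      map_add' := fun x y ↦ rfl
      map_smul' := fun c x ↦ rfl } 1
    (fun x ↦ (ContinuousMap.norm_le _ (by positivity)).2 fun t ↦ by
      rw [one_mul]; exact le_rfl)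

/-- The defect of `u` as a solution of `u' = s • f(u)`, `u(0) = x`, where `z = ((s, x), u)`. -/
noncomputable def odeDefect (f : C(F, F)) (z : (ℝ × F) × C(Icc (-1 : ℝ) 1, F)) :
    C(Icc (-1 : ℝ) 1, F) :=
  z.2 - constL F z.1.2 - z.1.1 • primitiveL F (f.comp z.2)

theorem contDiff_odeDefect.{u} {F : Type u} [NormedAddCommGroup F] [NormedSpace ℝ F]
    (f : C(F, F)) (hf : ContDiff ℝ ∞ f) : ContDiff ℝ ∞ (odeDefect f) := by
  have h1 : ContDiff ℝ ∞ (fun w : C(Icc (-1 : ℝ) 1, F) ↦ f.comp w) := contDiff_postcomp hf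
  have h2 : ContDiff ℝ ∞ (fun z : (ℝ × F) × C(Icc (-1 : ℝ) 1, F) ↦ f.comp z.2) :=
    h1.comp contDiff_snd
  unfold odeDefect
  fun_prop

/-- The factor `s` multiplies the nonlinear term. At `s = 0` the derivative of `f` therefore drops
out, and the partial derivative in `u` is the identity. This is the reason for rescaling time:
invertibility of the linearization costs no estimate. -/
theorem hasFDerivAt_odeDefect.{u} {F : Type u} [NormedAddCommGroup F] [NormedSpace ℝ F]
    (f : C(F, F)) (hf : ContDiff ℝ ∞ f) (x : F) (u : C(Icc (-1 : ℝ) 1, F)) :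
    HasFDerivAt (odeDefect f)
      (ContinuousLinearMap.snd ℝ (ℝ × F) C(Icc (-1 : ℝ) 1, F)
        + (-(constL F ∘L .snd ℝ ℝ F)
          - (ContinuousLinearMap.fst ℝ ℝ F).smulRight (primitiveL F (f.comp u))) ∘L .fst ℝ _ _)
      (((0 : ℝ), x), u) := by
  have h1 : ContDiff ℝ ∞ (fun w : C(Icc (-1 : ℝ) 1, F) ↦ f.comp w) := contDiff_postcomp hf
  have h2 : HasFDerivAt (fun w : C(Icc (-1 : ℝ) 1, F) ↦ primitiveL F (f.comp w))
      (primitiveL F ∘L fderiv ℝ (fun w : C(Icc (-1 : ℝ) 1, F) ↦ f.comp w) u) u :=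
    (primitiveL F).hasFDerivAt.comp u (h1.differentiable (by simp) u).hasFDerivAt
  have h3 : HasFDerivAt
      (fun z : (ℝ × F) × C(Icc (-1 : ℝ) 1, F) ↦ primitiveL F (f.comp z.2))
      ((primitiveL F ∘L fderiv ℝ (fun w : C(Icc (-1 : ℝ) 1, F) ↦ f.comp w) u) ∘L .snd ℝ _ _)
      (((0 : ℝ), x), u) :=
    HasFDerivAt.comp (f := Prod.snd) (((0 : ℝ), x), u) h2 hasFDerivAt_snd
  have h4 : HasFDerivAt (fun z : (ℝ × F) × C(Icc (-1 : ℝ) 1, F) ↦ z.1.1)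
      (ContinuousLinearMap.fst ℝ ℝ F ∘L .fst ℝ _ _) (((0 : ℝ), x), u) :=
    ((ContinuousLinearMap.fst ℝ ℝ F) ∘L
      (.fst ℝ (ℝ × F) C(Icc (-1 : ℝ) 1, F))).hasFDerivAt
  have h5 : HasFDerivAt (fun z : (ℝ × F) × C(Icc (-1 : ℝ) 1, F) ↦ z.2 - constL F z.1.2)
      (ContinuousLinearMap.snd ℝ (ℝ × F) C(Icc (-1 : ℝ) 1, F)
        - constL F ∘L .snd ℝ ℝ F ∘L .fst ℝ _ _) (((0 : ℝ), x), u) :=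
    (ContinuousLinearMap.snd ℝ (ℝ × F) C(Icc (-1 : ℝ) 1, F)
        - constL F ∘L .snd ℝ ℝ F ∘L .fst ℝ _ _).hasFDerivAt
  convert! h5.sub (h4.smul h3) using 1
  ext z t <;> simp [sub_eq_add_neg]

/-- The solutions of `u' = s • f(u)`, `u(0) = x` on `[-1, 1]` form a smooth family. -/
theorem exists_smooth_solution_family.{u} {F : Type u} [NormedAddCommGroup F] [NormedSpace ℝ F]
    [CompleteSpace F] (f : C(F, F)) (hf : ContDiff ℝ ∞ f) (p : F) :
    ∃ U : ℝ × F → C(Icc (-1 : ℝ) 1, F), ∃ ε > 0,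
      ContDiffOn ℝ ∞ U (Metric.ball (0, p) ε) ∧ U (0, p) = constL F p ∧
      (∀ q ∈ Metric.ball ((0 : ℝ), p) ε, odeDefect f (q, U q) = 0) ∧
      ∀ q ∈ Metric.ball ((0 : ℝ), p) ε, ∀ w ∈ Metric.ball (constL F p) ε,
        odeDefect f (q, w) = 0 → w = U q := by
  set B := C(Icc (-1 : ℝ) 1, F)
  let G : (ℝ × F) × B → (ℝ × F) × B := fun z ↦ (z.1, odeDefect f z)
  have hG : ContDiff ℝ ∞ G := contDiff_fst.prodMk (contDiff_odeDefect f hf)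
  let z₀ : (ℝ × F) × B := ((0, p), constL F p)
  -- The derivative of `G` at the constant solution is triangular with identities on the diagonal.
  let e₀ : ((ℝ × F) × B) ≃L[ℝ] ((ℝ × F) × B) :=
    (ContinuousLinearEquiv.refl ℝ (ℝ × F)).skewProd (ContinuousLinearEquiv.refl ℝ B)
      (-(constL F ∘L .snd ℝ ℝ F)
          - (ContinuousLinearMap.fst ℝ ℝ F).smulRight (primitiveL F (f.comp (constL F p))))
  have hGd : HasFDerivAt G (e₀ : ((ℝ × F) × B) →L[ℝ] ((ℝ × F) × B)) z₀ := by
    have := (hasFDerivAt_fst (𝕜 := ℝ) (p := z₀)).prodMk (hasFDerivAt_odeDefect f hf p (constL F p))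
    convert! this using 1
  have hGs : HasStrictFDerivAt G (e₀ : ((ℝ × F) × B) →L[ℝ] ((ℝ × F) × B)) z₀ :=
    hG.contDiffAt.hasStrictFDerivAt' hGd (by simp)
  let e := hGs.toOpenPartialHomeomorph G
  have hz₀ : z₀ ∈ e.source := hGs.mem_toOpenPartialHomeomorph_source
  have heG : ∀ z, e z = G z := fun z ↦ by rw [hGs.toOpenPartialHomeomorph_coe]
  have hG0 : G z₀ = ((0, p), 0) := by
    simp [G, z₀, odeDefect]
  -- Smoothness of the local inverse at a point requires an invertible derivative there; invertible
  -- operators form an open set, so this holds near `z₀` too.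
  have hinv : ∀ᶠ z in 𝓝 z₀, fderiv ℝ G z ∈
      range ((↑) : (((ℝ × F) × B) ≃L[ℝ] ((ℝ × F) × B)) → _) := by
    have hc : ContinuousAt (fderiv ℝ G) z₀ := (hG.continuous_fderiv (by simp)).continuousAt
    refine hc.eventually ?_
    rw [hGd.fderiv]
    exact ContinuousLinearEquiv.nhds e₀
  have htgt : ∀ᶠ y in 𝓝 (G z₀), y ∈ e.target ∧
      fderiv ℝ G (e.symm y) ∈ range ((↑) : (((ℝ × F) × B) ≃L[ℝ] ((ℝ × F) × B)) → _) := by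
    have h1 : e.target ∈ 𝓝 (G z₀) := by
      rw [← heG]; exact e.open_target.mem_nhds (e.map_source hz₀)
    have h2 : Filter.Tendsto e.symm (𝓝 (G z₀)) (𝓝 z₀) := by
      rw [← heG]; exact e.tendsto_symm hz₀
    exact Filter.Eventually.and h1 (h2.eventually hinv)
  have hι : Continuous (fun q : ℝ × F ↦ (q, (0 : B))) := by fun_prop
  have h3 : ∀ᶠ q in 𝓝 ((0 : ℝ), p), (q, (0 : B)) ∈ e.target ∧
      fderiv ℝ G (e.symm (q, 0)) ∈
        range ((↑) : (((ℝ × F) × B) ≃L[ℝ] ((ℝ × F) × B)) → _) := by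
    rw [hG0] at htgt
    exact hι.continuousAt.eventually htgt
  have h4 : ∀ᶠ z in 𝓝 z₀, z ∈ e.source := e.open_source.mem_nhds hz₀
  obtain ⟨ε₁, hε₁, h3⟩ := Metric.eventually_nhds_iff_ball.1 h3
  obtain ⟨ε₂, hε₂, h4⟩ := Metric.eventually_nhds_iff_ball.1 h4
  have hfst : ∀ q ∈ Metric.ball ((0 : ℝ), p) ε₁, (e.symm (q, 0)).1 = q ∧
      odeDefect f (q, (e.symm (q, 0)).2) = 0 := by
    intro q hq
    have h5 := e.right_inv (h3 q hq).1
    rw [heG] at h5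
    have h6 : (e.symm (q, 0)).1 = q := congrArg Prod.fst h5
    refine ⟨h6, ?_⟩
    have h7 : odeDefect f (e.symm (q, 0)) = 0 := congrArg Prod.snd h5
    rwa [← Prod.mk.eta (p := e.symm (q, 0)), h6] at h7
  refine ⟨fun q ↦ (e.symm (q, 0)).2, min ε₁ ε₂, lt_min hε₁ hε₂, ?_, ?_, ?_, ?_⟩
  · intro q hq
    have hq1 := Metric.ball_subset_ball (min_le_left _ _) hq
    obtain ⟨e', he'⟩ := (h3 q hq1).2
    have h5 : HasFDerivAt e (e' : ((ℝ × F) × B) →L[ℝ] ((ℝ × F) × B)) (e.symm (q, 0)) := by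
      rw [he', hGs.toOpenPartialHomeomorph_coe]
      exact (hG.differentiable (by simp) _).hasFDerivAt
    have h6 : ContDiffAt ℝ ∞ e.symm (q, 0) :=
      e.contDiffAt_symm (h3 q hq1).1 h5 (by
        rw [hGs.toOpenPartialHomeomorph_coe]; exact hG.contDiffAt)
    have h7 : ContDiffAt ℝ ∞ (fun q : ℝ × F ↦ (q, (0 : B))) q := by fun_prop
    exact (contDiffAt_snd.comp q (h6.comp q h7)).contDiffWithinAt
  · have := e.left_inv hz₀
    rw [heG, hG0] at this
    exact congrArg Prod.snd this
  · exact fun q hq ↦ (hfst q (Metric.ball_subset_ball (min_le_left _ _) hq)).2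
  · intro q hq w hw h0
    have h5 : (q, w) ∈ e.source := by
      apply h4
      rw [← ball_prod_same]
      exact ⟨Metric.ball_subset_ball (min_le_right _ _) hq,
        Metric.ball_subset_ball (min_le_right _ _) hw⟩
    have h6 := e.left_inv h5
    rw [heG] at h6
    simp only [G, h0] at h6
    exact (congrArg Prod.snd h6).symm

theorem odeDefect_eq_zero_iff (f : C(F, F)) (s : ℝ) (x : F) (u : C(Icc (-1 : ℝ) 1, F)) :
    odeDefect f ((s, x), u) = 0 ↔ ∀ t : Icc (-1 : ℝ) 1,
      u t = x + s • ∫ τ in (0 : ℝ)..t, f (IccExtend neg_one_le_one_real u τ) := by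
  rw [ContinuousMap.ext_iff]
  refine forall_congr' fun t ↦ ?_
  have : odeDefect f ((s, x), u) t
      = u t - x - s • ∫ τ in (0 : ℝ)..t, f (IccExtend neg_one_le_one_real u τ) := rfl
  rw [this, ContinuousMap.zero_apply, sub_sub, sub_eq_zero]

/-- Smooth local flow of a smooth vector field. -/
theorem exists_smooth_local_flow_of_contDiff.{u} {F : Type u} [NormedAddCommGroup F]
    [NormedSpace ℝ F] [CompleteSpace F] {f : F → F} (hf : ContDiff ℝ ∞ f) (p : F) :
    ∃ φ : ℝ × F → F, ∃ ε > 0,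
      ContDiffOn ℝ ∞ φ (Metric.ball (0, p) ε) ∧
      (∀ x ∈ Metric.ball p ε, φ (0, x) = x) ∧
      ∀ q ∈ Metric.ball ((0 : ℝ), p) ε, HasDerivAt (fun s ↦ φ (s, q.2)) (f (φ q)) q.1 := by
  let f' : C(F, F) := ⟨f, hf.continuous⟩
  obtain ⟨U, ε, hε, hU, hU0, hsol, huniq⟩ := exists_smooth_solution_family f' hf p
  have hp : ((0 : ℝ), p) ∈ Metric.ball ((0 : ℝ), p) ε := Metric.mem_ball_self hε
  have hUc : ContinuousAt U (0, p) :=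
    (hU.contDiffAt (Metric.ball_mem_nhds _ hε)).continuousAt
  have h1 : ∀ᶠ q in 𝓝 ((0 : ℝ), p), U q ∈ Metric.ball (constL F p) ε :=
    hUc.eventually (by rw [hU0]; exact Metric.ball_mem_nhds _ hε)
  obtain ⟨δ, hδ, h1⟩ := Metric.eventually_nhds_iff_ball.1
    (h1.and (Metric.ball_mem_nhds ((0 : ℝ), p) hε))
  -- Slowing time by the factor `t` turns the solution for `s` into a solution for `s * t`, no
  -- farther from the constant curve; local uniqueness identifies it with `U (s * t, x)`. Hence `U
  -- (s, x) 1` is a flow with time `s`.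
  have hscale : ∀ s : ℝ, ∀ x : F, (s, x) ∈ Metric.ball ((0 : ℝ), p) δ →
      ∀ t : Icc (-1 : ℝ) 1, U (s, x) t = U (s * t, x) ⟨1, by norm_num⟩ := by
    intro s x hq t
    have hq' : (s, x) ∈ Metric.ball ((0 : ℝ), p) ε := (h1 _ hq).2
    have hst : (s * t, x) ∈ Metric.ball ((0 : ℝ), p) ε := by
      rw [← ball_prod_same] at hq' ⊢
      refine ⟨?_, hq'.2⟩
      have h2 := hq'.1
      simp only [Metric.mem_ball, dist_zero_right, Real.norm_eq_abs] at h2 ⊢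
      rw [abs_mul]
      exact (mul_le_of_le_one_right (abs_nonneg _) (abs_le.2 t.2)).trans_lt h2
    have hmul : ∀ τ : Icc (-1 : ℝ) 1, (t : ℝ) * τ ∈ Icc (-1 : ℝ) 1 := fun τ ↦
      abs_le.1 (by
        rw [abs_mul]
        exact mul_le_one₀ (abs_le.2 t.2) (abs_nonneg _) (abs_le.2 τ.2))
    let w : C(Icc (-1 : ℝ) 1, F) := ⟨fun τ ↦ U (s, x) ⟨t * τ, hmul τ⟩, by fun_prop⟩
    have hw : w ∈ Metric.ball (constL F p) ε := by
      have h3 := (h1 _ hq).1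
      rw [mem_ball_iff_norm] at h3 ⊢
      refine lt_of_le_of_lt ((ContinuousMap.norm_le _ (norm_nonneg _)).2 fun τ ↦ ?_) h3
      exact (U (s, x) - constL F p).norm_coe_le_norm ⟨t * τ, hmul τ⟩
    have h0 : odeDefect f' ((s * t, x), w) = 0 := by
      rw [odeDefect_eq_zero_iff]
      intro τ
      have h4 := (odeDefect_eq_zero_iff f' s x (U (s, x))).1 (hsol _ hq') ⟨t * τ, hmul τ⟩
      refine h4.trans ?_
      have h5 := intervalIntegral.smul_integral_comp_mul_left (a := 0) (b := (τ : ℝ))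
        (fun r ↦ f' (IccExtend neg_one_le_one_real (U (s, x)) r)) (t : ℝ)
      rw [mul_zero] at h5
      rw [mul_smul]
      simp only
      rw [← h5]
      congr 3
      refine intervalIntegral.integral_congr fun r hr ↦ ?_
      have hr' : r ∈ Icc (-1 : ℝ) 1 := by
        have h6 := abs_le.2 τ.2
        have := Set.abs_sub_left_of_mem_uIcc hr
        simp only [sub_zero] at this
        exact abs_le.1 (this.trans h6)
      have e1 : IccExtend neg_one_le_one_real w r = w ⟨r, hr'⟩ :=
        IccExtend_of_mem _ _ hr'
      have e2 : IccExtend neg_one_le_one_real (U (s, x)) (t * r)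
          = U (s, x) ⟨t * r, hmul ⟨r, hr'⟩⟩ := IccExtend_of_mem _ _ (hmul ⟨r, hr'⟩)
      simp only [e1, e2]
      rfl
    have h5 := huniq _ hst w hw h0
    rw [← h5]
    simp [w]
  refine ⟨fun q ↦ U q ⟨1, by norm_num⟩, δ / 4, by positivity, ?_, ?_, ?_⟩
  · intro q hq
    have hq' := (h1 q (Metric.ball_subset_ball (by linarith) hq)).2
    have h2 : ContDiffAt ℝ ∞ U q := hU.contDiffAt (Metric.isOpen_ball.mem_nhds hq')
    exact ((ContinuousMap.evalCLM ℝ (⟨1, by norm_num⟩ : Icc (-1 : ℝ) 1)).contDiff.contDiffAt.comp q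
      h2).contDiffWithinAt
  · intro x hx
    have hq : ((0 : ℝ), x) ∈ Metric.ball ((0 : ℝ), p) ε := by
      refine (h1 _ ?_).2
      rw [← ball_prod_same]
      exact ⟨Metric.mem_ball_self hδ, Metric.ball_subset_ball (by linarith) hx⟩
    have h4 := (odeDefect_eq_zero_iff f' 0 x (U (0, x))).1 (hsol _ hq) ⟨1, by norm_num⟩
    simpa using h4
  · rintro ⟨s, x⟩ hq
    rw [← ball_prod_same] at hq
    have hs : |s| < δ / 4 := by simpa using hq.1
    -- The single curve with parameter `δ / 2` contains all times `|σ| < δ / 4`, at the parameters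
    -- `σ / (δ / 2)`. Differentiation in the flow time thus reduces to the fundamental theorem of
    -- calculus for one curve.
    have hs1 : (δ / 2, x) ∈ Metric.ball ((0 : ℝ), p) δ := by
      rw [← ball_prod_same]
      refine ⟨?_, Metric.ball_subset_ball (by linarith) hq.2⟩
      simp only [Metric.mem_ball, dist_zero_right, Real.norm_eq_abs]
      rw [abs_of_pos (by positivity)]; linarith
    have hsol1 := (odeDefect_eq_zero_iff f' _ x (U (δ / 2, x))).1 (hsol _ (h1 _ hs1).2)
    have hmem : ∀ σ : ℝ, |σ| < δ / 4 → σ / (δ / 2) ∈ Icc (-1 : ℝ) 1 := fun σ hσ ↦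
      abs_le.1 (by
        rw [abs_div, abs_of_pos (by positivity : 0 < δ / 2), div_le_one (by positivity)]
        linarith)
    have key : ∀ σ : ℝ, |σ| < δ / 4 → U (σ, x) ⟨1, by norm_num⟩ =
        x + (δ / 2) • ∫ τ in (0 : ℝ)..(σ / (δ / 2)),
          f (IccExtend neg_one_le_one_real (U (δ / 2, x)) τ) := fun σ hσ ↦ by
      have h2 := hscale _ x hs1 ⟨σ / (δ / 2), hmem σ hσ⟩
      rw [hsol1] at h2
      rw [mul_div_cancel₀ _ (by positivity : δ / 2 ≠ 0)] at h2
      exact h2.symm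
    have hc : Continuous (fun τ ↦ f (IccExtend neg_one_le_one_real (U (δ / 2, x)) τ)) :=
      hf.continuous.comp (U (δ / 2, x)).continuous.Icc_extend'
    have hd : HasDerivAt (fun σ : ℝ ↦ x + (δ / 2) • ∫ τ in (0 : ℝ)..(σ / (δ / 2)),
          f (IccExtend neg_one_le_one_real (U (δ / 2, x)) τ))
        (f (IccExtend neg_one_le_one_real (U (δ / 2, x)) (s / (δ / 2)))) s := by
      have h2 := (hc.integral_hasStrictDerivAt 0 (s / (δ / 2))).hasDerivAt
      have h3 := ((h2.scomp s ((hasDerivAt_id s).div_const (δ / 2))).const_smul (δ / 2)).const_add x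
      convert! h3 using 1
      rw [smul_smul]
      rw [mul_one_div_cancel (by positivity), one_smul]
    have h6 : IccExtend neg_one_le_one_real (U (δ / 2, x)) (s / (δ / 2))
        = U (s, x) ⟨1, by norm_num⟩ := by
      rw [IccExtend_of_mem _ _ (hmem s hs), hscale _ x hs1 ⟨s / (δ / 2), hmem s hs⟩]
      congr 3
      exact mul_div_cancel₀ s (by positivity : δ / 2 ≠ 0)
    rw [h6] at hd
    refine hd.congr_of_eventuallyEq ?_
    have : ∀ᶠ σ : ℝ in 𝓝 s, |σ| < δ / 4 := continuous_abs.continuousAt.eventually_lt_const hs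
    filter_upwards [this] with σ hσ using key σ hσ

/-- Smooth local flow of a vector field which is smooth near a point. -/
theorem exists_smooth_local_flow.{u} {F : Type u} [NormedAddCommGroup F]
    [NormedSpace ℝ F] [FiniteDimensional ℝ F] {f : F → F} {O : Set F} (hO : IsOpen O)
    (hf : ContDiffOn ℝ ∞ f O) {p : F} (hp : p ∈ O) :
    ∃ φ : ℝ × F → F, ∃ ε > 0,
      ContDiffOn ℝ ∞ φ (Metric.ball (0, p) ε) ∧
      (∀ q ∈ Metric.ball ((0 : ℝ), p) ε, φ q ∈ O) ∧
      (∀ x ∈ Metric.ball p ε, φ (0, x) = x) ∧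
      ∀ q ∈ Metric.ball ((0 : ℝ), p) ε, HasDerivAt (fun s ↦ φ (s, q.2)) (f (φ q)) q.1 := by
  have : CompleteSpace F := FiniteDimensional.complete ℝ F
  obtain ⟨r, hr, hrO⟩ := Metric.isOpen_iff.1 hO p hp
  -- The field is cut off to be globally smooth. Close to `(0, p)` the flow stays in the ball of
  -- radius `r / 4`, where the cutoff equals `1`.
  let χ : ContDiffBump p := ⟨r / 4, r / 2, by positivity, by linarith⟩
  let g : F → F := fun x ↦ χ x • f x
  have hg : ContDiff ℝ ∞ g := by
    rw [contDiff_iff_contDiffAt]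
    intro x
    by_cases hx : x ∈ Metric.ball p r
    · exact χ.contDiff.contDiffAt.smul (hf.contDiffAt (hO.mem_nhds (hrO hx)))
    · have : g =ᶠ[𝓝 x] fun _ ↦ 0 := by
        have h2 : (Metric.closedBall p (r / 2))ᶜ ∈ 𝓝 x := by
          refine Metric.isClosed_closedBall.isOpen_compl.mem_nhds fun h ↦ hx ?_
          exact Metric.closedBall_subset_ball (by linarith) h
        filter_upwards [h2] with y hy
        have : χ y = 0 := χ.zero_of_le_dist (by
          simp only [mem_compl_iff, Metric.mem_closedBall, not_le] at hy
          exact hy.le)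
        simp [g, this]
      exact contDiffAt_const.congr_of_eventuallyEq this
  obtain ⟨φ, ε, hε, h1, h2, h3⟩ := exists_smooth_local_flow_of_contDiff hg p
  have hc : ContinuousAt φ (0, p) := (h1.contDiffAt (Metric.ball_mem_nhds _ hε)).continuousAt
  have h4 : ∀ᶠ q in 𝓝 ((0 : ℝ), p), φ q ∈ Metric.ball p (r / 4) := by
    refine hc.eventually ?_
    rw [h2 p (Metric.mem_ball_self hε)]
    exact Metric.ball_mem_nhds _ (by positivity)
  obtain ⟨δ, hδ, h4⟩ := Metric.eventually_nhds_iff_ball.1 h4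
  refine ⟨φ, min ε δ, lt_min hε hδ, h1.mono (Metric.ball_subset_ball (min_le_left _ _)), ?_, ?_, ?_⟩
  · intro q hq
    exact hrO (Metric.ball_subset_ball (by linarith)
      (h4 q (Metric.ball_subset_ball (min_le_right _ _) hq)))
  · exact fun x hx ↦ h2 x (Metric.ball_subset_ball (min_le_left _ _) hx)
  · intro q hq
    have h5 := h3 q (Metric.ball_subset_ball (min_le_left _ _) hq)
    have h6 : χ (φ q) = 1 := χ.one_of_mem_closedBall
      (Metric.ball_subset_closedBall (h4 q (Metric.ball_subset_ball (min_le_right _ _) hq)))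
    simpa [g, h6] using h5

end Flow
end DiracGeometry

namespace DiracGeometry

/-! ### Parameter integrals and linear differential equations on a segment. -/

section Calculus

variable {V : Type*} [NormedAddCommGroup V] [NormedSpace ℝ V]

theorem uniqueDiffOn_Icc_prod_Ioo {a b r : ℝ} (hab : a < b) :
    UniqueDiffOn ℝ (Icc a b ×ˢ Ioo (-r) r) :=
  (uniqueDiffOn_Icc hab).prod isOpen_Ioo.uniqueDiffOn

theorem hasDerivAt_snd_of_contDiffOn {a b r : ℝ} {f : ℝ × ℝ → V}
    (hf : ContDiffOn ℝ 1 f (Icc a b ×ˢ Ioo (-r) r)) {t s : ℝ} (ht : t ∈ Icc a b)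
    (hs : s ∈ Ioo (-r) r) :
    HasDerivAt (fun σ ↦ f (t, σ))
      (fderivWithin ℝ f (Icc a b ×ˢ Ioo (-r) r) (t, s) (0, 1)) s := by
  have h1 := ((hf.differentiableOn (by simp)) (t, s) ⟨ht, hs⟩).hasFDerivWithinAt
  have h2 : HasDerivWithinAt (fun σ : ℝ ↦ (t, σ)) ((0 : ℝ), (1 : ℝ)) (Ioo (-r) r) s :=
    ((hasDerivAt_const s t).prodMk (hasDerivAt_id s)).hasDerivWithinAt
  have h3 := h1.comp_hasDerivWithinAt s h2 (fun σ hσ ↦ ⟨ht, hσ⟩)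
  exact h3.hasDerivAt (isOpen_Ioo.mem_nhds hs)

theorem deriv_snd_of_contDiffOn {a b r : ℝ} {f : ℝ × ℝ → V}
    (hf : ContDiffOn ℝ 1 f (Icc a b ×ˢ Ioo (-r) r)) {t s : ℝ} (ht : t ∈ Icc a b)
    (hs : s ∈ Ioo (-r) r) :
    HasDerivAt (fun σ ↦ f (t, σ)) (deriv (fun σ ↦ f (t, σ)) s) s :=
  (hasDerivAt_snd_of_contDiffOn hf ht hs).differentiableAt.hasDerivAt

theorem continuousOn_deriv_snd {a b r : ℝ} (hab : a < b) {f : ℝ × ℝ → V}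
    (hf : ContDiffOn ℝ 1 f (Icc a b ×ˢ Ioo (-r) r)) :
    ContinuousOn (fun p : ℝ × ℝ ↦ deriv (fun σ ↦ f (p.1, σ)) p.2) (Icc a b ×ˢ Ioo (-r) r) := by
  have h := (hf.continuousOn_fderivWithin (uniqueDiffOn_Icc_prod_Ioo hab) le_rfl).clm_apply
    (continuousOn_const (c := ((0 : ℝ), (1 : ℝ))))
  refine h.congr fun p hp ↦ ?_
  exact (hasDerivAt_snd_of_contDiffOn hf hp.1 hp.2).deriv

omit [NormedSpace ℝ V] in
theorem continuousOn_slice {a b r : ℝ} {f : ℝ × ℝ → V} {s : ℝ} (hs : s ∈ Ioo (-r) r)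
    (hf : ContinuousOn f (Icc a b ×ˢ Ioo (-r) r)) : ContinuousOn (fun t ↦ f (t, s)) (Icc a b) :=
  hf.comp (by fun_prop) fun t ht ↦ ⟨ht, hs⟩

/-- Differentiation under the integral sign. -/
theorem hasDerivAt_integral_snd [CompleteSpace V] {a b r : ℝ} (hr : 0 < r) (hab : a < b)
    {f : ℝ × ℝ → V} (hf : ContDiffOn ℝ 1 f (Icc a b ×ˢ Ioo (-r) r)) {t₁ t₂ : ℝ}
    (ht₁ : t₁ ∈ Icc a b) (ht₂ : t₂ ∈ Icc a b) :
    HasDerivAt (fun s ↦ ∫ t in t₁..t₂, f (t, s))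
      (∫ t in t₁..t₂, deriv (fun σ ↦ f (t, σ)) 0) 0 := by
  have h0 : (0 : ℝ) ∈ Ioo (-r) r := by simp [hr]
  have hsub : uIcc t₁ t₂ ⊆ Icc a b := uIcc_subset_Icc ht₁ ht₂
  have hsub' : Set.uIoc t₁ t₂ ⊆ Icc a b := uIoc_subset_uIcc.trans hsub
  have hd := continuousOn_deriv_snd hab hf
  -- Halving the parameter interval gives a compact rectangle, on which the continuous parameter
  -- derivative has a constant bound.
  have hK : IsCompact (Icc a b ×ˢ Icc (-(r / 2)) (r / 2)) := isCompact_Icc.prod isCompact_Icc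
  have hKs : Icc a b ×ˢ Icc (-(r / 2)) (r / 2) ⊆ Icc a b ×ˢ Ioo (-r) r :=
    prod_mono le_rfl (Icc_subset_Ioo (by linarith) (by linarith))
  obtain ⟨C, hC⟩ := hK.exists_bound_of_continuousOn (hd.mono hKs)
  have hmeas : ∀ g : ℝ → V, ContinuousOn g (Icc a b) →
      MeasureTheory.AEStronglyMeasurable g
        (MeasureTheory.volume.restrict (Set.uIoc t₁ t₂)) := fun g hg ↦
    (hg.mono hsub').aestronglyMeasurable measurableSet_uIoc
  refine (intervalIntegral.hasDerivAt_integral_of_dominated_loc_of_deriv_le (bound := fun _ ↦ C)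
    (F := fun s t ↦ f (t, s))
    (F' := fun s t ↦ deriv (fun σ ↦ f (t, σ)) s) (Ioo_mem_nhds (by linarith : -(r / 2) < 0)
      (by linarith : 0 < r / 2)) ?_ ?_ ?_ ?_ ?_ ?_).2
  · filter_upwards [isOpen_Ioo.mem_nhds h0] with s hs
    exact hmeas _ (continuousOn_slice hs hf.continuousOn)
  · exact ((continuousOn_slice h0 hf.continuousOn).mono hsub).intervalIntegrable
  · exact hmeas _ (continuousOn_slice h0 hd)
  · exact Filter.Eventually.of_forall fun t ht s hs ↦
      hC (t, s) ⟨hsub' ht, Ioo_subset_Icc_self hs⟩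
  · exact intervalIntegrable_const
  · refine Filter.Eventually.of_forall fun t ht s hs ↦ ?_
    exact deriv_snd_of_contDiffOn hf (hsub' ht) ⟨by linarith [hs.1], by linarith [hs.2]⟩

/-- The primitive of a function which is continuous on a segment. -/
theorem hasDerivWithinAt_primitive [CompleteSpace V] {a b : ℝ} {f : ℝ → V}
    (hf : ContinuousOn f (Icc a b)) {t₀ : ℝ} (ht₀ : t₀ ∈ Icc a b) {t : ℝ} (ht : t ∈ Icc a b) :
    HasDerivWithinAt (fun u ↦ ∫ τ in t₀..u, f τ) (f t) (Icc a b) t := by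
  have : Fact (t ∈ Icc a b) := ⟨ht⟩
  exact intervalIntegral.integral_hasDerivWithinAt_right
    ((hf.mono (uIcc_subset_Icc ht₀ ht)).intervalIntegrable)
    (hf.stronglyMeasurableAtFilter_nhdsWithin measurableSet_Icc t) (hf t ht)

theorem integral_eq_sub_of_hasDerivWithinAt_Icc [CompleteSpace V] {a b : ℝ} (hab : a ≤ b)
    {f f' : ℝ → V} (hf : ∀ t ∈ Icc a b, HasDerivWithinAt f (f' t) (Icc a b) t)
    (hf' : ContinuousOn f' (Icc a b)) : ∫ t in a..b, f' t = f b - f a :=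
  intervalIntegral.integral_eq_sub_of_hasDerivAt_of_le hab
    (fun t ht ↦ (hf t ht).continuousWithinAt)
    (fun t ht ↦ (hf t (Ioo_subset_Icc_self ht)).hasDerivAt (Icc_mem_nhds ht.1 ht.2))
    ((uIcc_of_le hab ▸ hf').intervalIntegrable)

/-- Linear ordinary differential equations have solutions on short intervals whose length does not
depend on the initial value. -/
theorem exists_linear_ode_solution [CompleteSpace V] {a b M : ℝ} (hab : a ≤ b) (hM : 0 ≤ M)
    (hMb : M * (b - a) ≤ 1 / 2)
    {A : ℝ → V →L[ℝ] V} {g : ℝ → V} (hA : ContinuousOn A (Icc a b))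
    (hg : ContinuousOn g (Icc a b)) (hAM : ∀ t ∈ Icc a b, ‖A t‖ ≤ M) (x₀ : V) :
    ∃ u : ℝ → V, u a = x₀ ∧
      ∀ t ∈ Icc a b, HasDerivWithinAt u (A t (u t) + g t) (Icc a b) t := by
  obtain ⟨G, hG⟩ := isCompact_Icc.exists_bound_of_continuousOn hg
  have hG0 : 0 ≤ G := (norm_nonneg _).trans (hG a ⟨le_rfl, hab⟩)
  have hba : 0 ≤ b - a := by linarith
  -- On the ball of radius `R` the field has norm at most `LL`. Since `M * (b - a) ≤ 1 / 2`, this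
  -- choice of `R` gives `LL * (b - a) ≤ R`, so the Picard iteration does not leave the ball over
  -- the whole segment.
  let R : ℝ := 2 * (G * (b - a) + ‖x₀‖)
  have hR : 0 ≤ R := by positivity
  let LL : ℝ := M * (R + ‖x₀‖) + G
  have hLL : 0 ≤ LL := by positivity
  have hpl : IsPicardLindelof (fun t x ↦ A t x + g t) (⟨a, le_rfl, hab⟩ : Icc a b) x₀
      ⟨R, hR⟩ 0 ⟨LL, hLL⟩ ⟨M, hM⟩ := by
    refine ⟨fun t ht ↦ ?_, fun x _ ↦ ?_, fun t ht x hx ↦ ?_, ?_⟩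
    · refine LipschitzOnWith.of_dist_le_mul fun x _ y _ ↦ ?_
      rw [dist_add_right, dist_eq_norm, dist_eq_norm, ← map_sub]
      exact (A t).le_of_opNorm_le (hAM t ht) _
    · exact (hA.clm_apply continuousOn_const).add hg
    · refine (norm_add_le _ _).trans (add_le_add ?_ (hG t ht))
      have hx' : ‖x‖ ≤ R + ‖x₀‖ := by
        have h1 : ‖x - x₀‖ ≤ R := mem_closedBall_iff_norm.1 hx
        have h2 := norm_add_le (x - x₀) x₀
        rw [sub_add_cancel] at h2
        linarith
      exact (A t).le_of_opNorm_le_of_le (hAM t ht) hx'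
    · simp only [sub_self]
      rw [max_eq_left hba]
      show LL * (b - a) ≤ R - 0
      have h1 : LL * (b - a) = M * (b - a) * (R + ‖x₀‖) + G * (b - a) := by ring
      have h2 : M * (b - a) * (R + ‖x₀‖) ≤ 1 / 2 * (R + ‖x₀‖) :=
        mul_le_mul_of_nonneg_right hMb (by positivity)
      have h3 : R = 2 * (G * (b - a)) + 2 * ‖x₀‖ := by simp only [R]; ring
      have := norm_nonneg x₀
      linarith
  obtain ⟨u, hu, hu'⟩ := hpl.exists_eq_forall_mem_Icc_hasDerivWithinAt₀
  exact ⟨u, hu, hu'⟩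

theorem linear_ode_unique {a b : ℝ} {A : ℝ → V →L[ℝ] V} {g : ℝ → V}
    (hA : ContinuousOn A (Icc a b)) {u w : ℝ → V}
    (hu : ∀ t ∈ Icc a b, HasDerivWithinAt u (A t (u t) + g t) (Icc a b) t)
    (hw : ∀ t ∈ Icc a b, HasDerivWithinAt w (A t (w t) + g t) (Icc a b) t) (h0 : u a = w a) :
    EqOn u w (Icc a b) := by
  obtain ⟨M, hM⟩ := isCompact_Icc.exists_bound_of_continuousOn hA
  have hM' : ∀ t ∈ Icc a b, ‖A t‖ ≤ max M 0 := fun t ht ↦ (hM t ht).trans (le_max_left _ _)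
  refine ODE_solution_unique_of_mem_Icc_right (v := fun t x ↦ A t x + g t) (s := fun _ ↦ univ)
    (K := ⟨max M 0, le_max_right _ _⟩) (fun t ht ↦ ?_)
    (fun t ht ↦ (hu t ht).continuousWithinAt) (fun t ht ↦ ?_) (fun _ _ ↦ mem_univ _)
    (fun t ht ↦ (hw t ht).continuousWithinAt) (fun t ht ↦ ?_) (fun _ _ ↦ mem_univ _) h0
  · refine LipschitzOnWith.of_dist_le_mul fun x _ y _ ↦ ?_
    rw [dist_add_right, dist_eq_norm, dist_eq_norm, ← map_sub]
    exact (A t).le_of_opNorm_le (hM' t (Ico_subset_Icc_self ht)) _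
  · exact (hu t (Ico_subset_Icc_self ht)).mono_of_mem_nhdsWithin (Icc_mem_nhdsGE_of_mem ht)
  · exact (hw t (Ico_subset_Icc_self ht)).mono_of_mem_nhdsWithin (Icc_mem_nhdsGE_of_mem ht)

/-- A property which propagates forward on short intervals propagates along a segment. -/
theorem propagate_on_Icc {P : ℝ → Prop} {a b : ℝ} (hab : a ≤ b) (ha : P a)
    (h : ∀ t₀ ∈ Icc a b, ∃ δ > 0, ∀ t₁ ∈ Icc a b, ∀ t₂ ∈ Icc a b, |t₁ - t₀| < δ →
      |t₂ - t₀| < δ → t₁ ≤ t₂ → P t₁ → P t₂) : P b := by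
  let S : Set ℝ := {t ∈ Icc a b | P t}
  have hSa : a ∈ S := ⟨⟨le_rfl, hab⟩, ha⟩
  have hSb : BddAbove S := ⟨b, fun t ht ↦ ht.1.2⟩
  have hT : sSup S ∈ Icc a b := ⟨le_csSup hSb hSa, csSup_le ⟨a, hSa⟩ fun t ht ↦ ht.1.2⟩
  obtain ⟨δ, hδ, H⟩ := h _ hT
  obtain ⟨t₁, ht₁, hlt⟩ := exists_lt_of_lt_csSup ⟨a, hSa⟩ (sub_lt_self (sSup S) hδ)
  have hle : t₁ ≤ sSup S := le_csSup hSb ht₁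
  have h1 : |t₁ - sSup S| < δ := by rw [abs_lt]; constructor <;> linarith
  -- This point can be reached from `t₁`, so it cannot exceed the supremum; hence the minimum is
  -- `b`.
  have hm : min b (sSup S + δ / 2) ∈ Icc a b :=
    ⟨le_min hab (by linarith [hT.1]), min_le_left _ _⟩
  have hm' : sSup S ≤ min b (sSup S + δ / 2) := le_min hT.2 (by linarith)
  have h2 : |min b (sSup S + δ / 2) - sSup S| < δ := by
    rw [abs_of_nonneg (by linarith)]
    linarith [min_le_right b (sSup S + δ / 2)]
  have h3 := H t₁ ht₁.1 _ hm h1 h2 (hle.trans hm') ht₁.2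
  have h4 : min b (sSup S + δ / 2) ≤ sSup S := le_csSup hSb ⟨hm, h3⟩
  have h5 : min b (sSup S + δ / 2) = b := by
    rcases min_choice b (sSup S + δ / 2) with h | h
    · exact h
    · rw [h] at h4; linarith
  rwa [h5] at h3

end Calculus

end DiracGeometry

/-! ### The first variation in coordinates. -/

namespace DiracGeometry

/-- The coordinate expression of a Dirac structure with a primitive of its natural two-form:
a frame `(X k, A k)`, the structure functions `C` of its brackets and the components `Θ` of the
primitive, on an open subset of a vector space. -/
structure LocalModel (E : Type*) [NormedAddCommGroup E] [NormedSpace ℝ E] (n : ℕ) where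
  /-- the domain -/
  O : Set E
  /-- the tangent parts of the frame -/
  X : Fin n → E → E
  /-- the cotangent parts of the frame -/
  A : Fin n → E → E →L[ℝ] ℝ
  /-- the structure functions -/
  C : Fin n → Fin n → Fin n → E → ℝ
  /-- the components of the primitive -/
  Θ : Fin n → E → ℝ
  isOpen : IsOpen O
  smooth_X : ∀ k, ContDiffOn ℝ ∞ (X k) O
  smooth_A : ∀ k, ContDiffOn ℝ ∞ (A k) O
  smooth_C : ∀ j i k, ContDiffOn ℝ ∞ (C j i k) O
  smooth_Θ : ∀ k, ContDiffOn ℝ ∞ (Θ k) O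
  bracket_eq : ∀ p ∈ O, ∀ j i,
    fderiv ℝ (X i) p (X j p) - fderiv ℝ (X j) p (X i p) = ∑ k, C j i k p • X k p
  primitive_eq : ∀ p ∈ O, ∀ j i,
    fderiv ℝ (Θ i) p (X j p) - fderiv ℝ (Θ j) p (X i p) - ∑ k, C j i k p * Θ k p = A j p (X i p)

section Variation

variable {E : Type*} [NormedAddCommGroup E] [NormedSpace ℝ E] [CompleteSpace E] {n : ℕ}

/-- Interchange of the two partial derivatives, valid up to the end points in `t`. The equation is
integrated in `t`, differentiated in the parameter under the integral sign, and the resulting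
primitive is differentiated in `t`; second derivatives of `c` are never needed. -/
theorem hasDerivWithinAt_deriv_snd {a b r : ℝ} (hr : 0 < r) (hab : a < b) {c f : ℝ × ℝ → E}
    (hc : ContDiffOn ℝ 1 c (Icc a b ×ˢ Ioo (-r) r))
    (hf : ContDiffOn ℝ 1 f (Icc a b ×ˢ Ioo (-r) r))
    (h : ∀ t ∈ Icc a b, ∀ s ∈ Ioo (-r) r,
      HasDerivWithinAt (fun τ ↦ c (τ, s)) (f (t, s)) (Icc a b) t) {t : ℝ} (ht : t ∈ Icc a b) :
    HasDerivWithinAt (fun τ ↦ deriv (fun σ ↦ c (τ, σ)) 0) (deriv (fun σ ↦ f (t, σ)) 0)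
      (Icc a b) t := by
  have h0 : (0 : ℝ) ∈ Ioo (-r) r := by simp [hr]
  have ha : a ∈ Icc a b := ⟨le_rfl, hab.le⟩
  have key : ∀ τ ∈ Icc a b, deriv (fun σ ↦ c (τ, σ)) 0 =
      deriv (fun σ ↦ c (a, σ)) 0 + ∫ u in a..τ, deriv (fun σ ↦ f (u, σ)) 0 := by
    intro τ hτ
    have h1 := (deriv_snd_of_contDiffOn hc ha h0).add
      (hasDerivAt_integral_snd hr hab hf ha hτ)
    refine (HasDerivAt.congr_of_eventuallyEq h1 ?_).deriv
    filter_upwards [isOpen_Ioo.mem_nhds h0] with s hs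
    have hsub : Icc a τ ⊆ Icc a b := Icc_subset_Icc_right hτ.2
    have h2 := integral_eq_sub_of_hasDerivWithinAt_Icc hτ.1
      (fun u hu ↦ (h u (hsub hu) s hs).mono hsub)
      ((continuousOn_slice hs hf.continuousOn).mono hsub)
    simp only [Pi.add_apply]
    rw [h2]; abel
  have h3 := (hasDerivWithinAt_primitive (continuousOn_slice h0 (continuousOn_deriv_snd hab hf))
    ha ht).const_add (deriv (fun σ ↦ c (a, σ)) 0)
  exact h3.congr key (key t ht)

namespace LocalModel

variable (m : LocalModel E n)

/-- The tangent vector with frame components `y`. -/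
def vec (y : Fin n → ℝ) (p : E) : E := ∑ k, y k • m.X k p

/-- The covector with frame components `y`. -/
def covec (y : Fin n → ℝ) (p : E) : E →L[ℝ] ℝ := ∑ k, y k • m.A k p

/-- The value of the primitive on the vector with frame components `y`. -/
def prim (y : Fin n → ℝ) (p : E) : ℝ := ∑ k, y k * m.Θ k p

/-- First variation in coordinates: transport of the component of the variation. -/
theorem exists_transport {a b r : ℝ} (hr : 0 < r) (hab : a < b) {c : ℝ × ℝ → E}
    {y : ℝ × ℝ → Fin n → ℝ}
    (hc : ContDiffOn ℝ ∞ c (Icc a b ×ˢ Ioo (-r) r)) (hcO : MapsTo c (Icc a b ×ˢ Ioo (-r) r) m.O)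
    (hy : ContDiffOn ℝ ∞ y (Icc a b ×ˢ Ioo (-r) r))
    (hcy : ∀ t ∈ Icc a b, ∀ s ∈ Ioo (-r) r,
      HasDerivWithinAt (fun τ ↦ c (τ, s)) (m.vec (y (t, s)) (c (t, s))) (Icc a b) t) :
    ∃ δ > 0, ∀ t₁ ∈ Icc a b, ∀ t₂ ∈ Icc a b, t₁ ≤ t₂ → t₂ - t₁ ≤ δ → ∀ b₁ : Fin n → ℝ,
      m.vec b₁ (c (t₁, 0)) = deriv (fun σ ↦ c (t₁, σ)) 0 →
      ∃ b₂ : Fin n → ℝ, m.vec b₂ (c (t₂, 0)) = deriv (fun σ ↦ c (t₂, σ)) 0 ∧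
        ∫ t in t₁..t₂, (deriv (fun σ ↦ m.prim (y (t, σ)) (c (t, σ))) 0
            + m.covec (y (t, 0)) (c (t, 0)) (deriv (fun σ ↦ c (t, σ)) 0))
          = m.prim b₂ (c (t₂, 0)) - m.prim b₁ (c (t₁, 0)) := by
  have h0 : (0 : ℝ) ∈ Ioo (-r) r := by simp [hr]
  have h1i : (1 : WithTop ℕ∞) ≤ ∞ := by simp
  set S := Icc a b ×ˢ Ioo (-r) r with hS
  have hyk : ∀ k, ContDiffOn ℝ ∞ (fun q ↦ y q k) S := fun k ↦ contDiffOn_pi.1 hy k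
  have hX : ∀ k, ContDiffOn ℝ ∞ (fun q ↦ m.X k (c q)) S := fun k ↦
    (m.smooth_X k).comp hc hcO
  have hΘ : ∀ k, ContDiffOn ℝ ∞ (fun q ↦ m.Θ k (c q)) S := fun k ↦
    (m.smooth_Θ k).comp hc hcO
  have hA : ∀ k, ContDiffOn ℝ ∞ (fun q ↦ m.A k (c q)) S := fun k ↦
    (m.smooth_A k).comp hc hcO
  have hC : ∀ j i k, ContDiffOn ℝ ∞ (fun q ↦ m.C j i k (c q)) S := fun j i k ↦
    (m.smooth_C j i k).comp hc hcO
  have hDX : ∀ k, ContDiffOn ℝ ∞ (fun q ↦ fderiv ℝ (m.X k) (c q)) S := fun k ↦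
    ((m.smooth_X k).fderiv_of_isOpen m.isOpen (by simp)).comp hc hcO
  have hDΘ : ∀ k, ContDiffOn ℝ ∞ (fun q ↦ fderiv ℝ (m.Θ k) (c q)) S := fun k ↦
    ((m.smooth_Θ k).fderiv_of_isOpen m.isOpen (by simp)).comp hc hcO
  have hvec : ContDiffOn ℝ ∞ (fun q ↦ m.vec (y q) (c q)) S :=
    ContDiffOn.sum fun k _ ↦ (hyk k).smul (hX k)
  have hprim : ContDiffOn ℝ ∞ (fun q ↦ m.prim (y q) (c q)) S :=
    ContDiffOn.sum fun k _ ↦ (hyk k).mul (hΘ k)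
  have hcO0 : ∀ t ∈ Icc a b, c (t, 0) ∈ m.O := fun t ht ↦ hcO ⟨ht, h0⟩
  let v : ℝ → E := fun t ↦ deriv (fun σ ↦ c (t, σ)) 0
  let y' : ℝ → Fin n → ℝ := fun t ↦ deriv (fun σ ↦ y (t, σ)) 0
  have hv : ∀ t ∈ Icc a b, HasDerivAt (fun σ ↦ c (t, σ)) (v t) 0 := fun t ht ↦
    deriv_snd_of_contDiffOn (hc.of_le h1i) ht h0
  have hy' : ∀ t ∈ Icc a b, ∀ k, HasDerivAt (fun σ ↦ y (t, σ) k) (y' t k) 0 := fun t ht ↦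
    hasDerivAt_pi.1 (deriv_snd_of_contDiffOn (hy.of_le h1i) ht h0)
  have hvcont : ContinuousOn v (Icc a b) :=
    continuousOn_slice h0 (continuousOn_deriv_snd hab (hc.of_le h1i))
  have hy'cont : ContinuousOn y' (Icc a b) :=
    continuousOn_slice h0 (continuousOn_deriv_snd hab (hy.of_le h1i))
  have hXd : ∀ p ∈ m.O, ∀ k, HasFDerivAt (m.X k) (fderiv ℝ (m.X k) p) p := fun p hp k ↦
    ((m.smooth_X k).contDiffAt (m.isOpen.mem_nhds hp)).differentiableAt (by simp) |>.hasFDerivAt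
  have hΘd : ∀ p ∈ m.O, ∀ k, HasFDerivAt (m.Θ k) (fderiv ℝ (m.Θ k) p) p := fun p hp k ↦
    ((m.smooth_Θ k).contDiffAt (m.isOpen.mem_nhds hp)).differentiableAt (by simp) |>.hasFDerivAt
  -- the operators of the two linear equations
  let B : ℝ → E →L[ℝ] E := fun t ↦ ∑ k, y (t, 0) k • fderiv ℝ (m.X k) (c (t, 0))
  let g : ℝ → E := fun t ↦ ∑ k, y' t k • m.X k (c (t, 0))
  let Q : ℝ → (Fin n → ℝ) →L[ℝ] (Fin n → ℝ) := fun t ↦ ∑ k, ∑ i,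
    (-∑ j, m.C j i k (c (t, 0)) * y (t, 0) j) •
      (ContinuousLinearMap.proj (R := ℝ) (φ := fun _ : Fin n ↦ ℝ) i).smulRight
        (Pi.single k (1 : ℝ))
  have hQ : ∀ t w k, Q t w k = -∑ i, ∑ j, m.C j i k (c (t, 0)) * y (t, 0) j * w i := by
    intro t w k
    simp only [Q, sum_apply, smul_apply,
      ContinuousLinearMap.smulRight_apply, ContinuousLinearMap.proj_apply, Finset.sum_apply,
      Pi.smul_apply, smul_eq_mul, Pi.single_apply]
    rw [Finset.sum_eq_single k]
    · rw [← Finset.sum_neg_distrib]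
      refine Finset.sum_congr rfl fun i _ ↦ ?_
      rw [if_pos rfl, mul_one, neg_mul, Finset.sum_mul]
    · intro k' _ hk'
      exact Finset.sum_eq_zero fun i _ ↦ by rw [if_neg hk'.symm]; simp
    · simp
  have hBcont : ContinuousOn B (Icc a b) := by
    refine continuousOn_finsetSum _ fun k _ ↦ ?_
    exact (continuousOn_slice h0 (hyk k).continuousOn).smul
      (continuousOn_slice h0 (hDX k).continuousOn)
  have hgcont : ContinuousOn g (Icc a b) := by
    refine continuousOn_finsetSum _ fun k _ ↦ ?_
    exact (continuousOn_pi.1 hy'cont k).smul (continuousOn_slice h0 (hX k).continuousOn)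
  have hQcont : ContinuousOn Q (Icc a b) := by
    refine continuousOn_finsetSum _ fun k _ ↦ continuousOn_finsetSum _ fun i _ ↦ ?_
    have h2 : ContinuousOn (fun t ↦ ∑ j, m.C j i k (c (t, 0)) * y (t, 0) j) (Icc a b) := by
      refine continuousOn_finsetSum _ fun j _ ↦ ?_
      exact (continuousOn_slice h0 (hC j i k).continuousOn).mul
        (continuousOn_slice h0 (hyk j).continuousOn)
    exact h2.neg.smul continuousOn_const
  have hprim' : ∀ t ∈ Icc a b, deriv (fun σ ↦ m.prim (y (t, σ)) (c (t, σ))) 0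
      = ∑ k, (y' t k * m.Θ k (c (t, 0)) + y (t, 0) k * fderiv ℝ (m.Θ k) (c (t, 0)) (v t)) := by
    intro t ht
    refine HasDerivAt.deriv ?_
    exact HasDerivAt.fun_sum fun k _ ↦ (hy' t ht k).mul
      ((hΘd _ (hcO0 t ht) k).comp_hasDerivAt (0 : ℝ) (hv t ht))
  have hv' : ∀ t ∈ Icc a b, HasDerivWithinAt v (B t (v t) + g t) (Icc a b) t := by
    intro t ht
    have h1 := hasDerivWithinAt_deriv_snd hr hab (hc.of_le h1i) (hvec.of_le h1i) hcy ht
    have h2 : deriv (fun σ ↦ m.vec (y (t, σ)) (c (t, σ))) 0 = B t (v t) + g t := by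
      refine HasDerivAt.deriv ?_
      have h3 : HasDerivAt (fun σ ↦ m.vec (y (t, σ)) (c (t, σ)))
          (∑ k, (y (t, 0) k • fderiv ℝ (m.X k) (c (t, 0)) (v t) + y' t k • m.X k (c (t, 0)))) 0 :=
        HasDerivAt.fun_sum fun k _ ↦ (hy' t ht k).smul
          ((hXd _ (hcO0 t ht) k).comp_hasDerivAt (0 : ℝ) (hv t ht))
      convert! h3 using 1
      simp [B, g, Finset.sum_add_distrib]
    rwa [h2] at h1
  obtain ⟨M, hM⟩ := isCompact_Icc.exists_bound_of_continuousOn hQcont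
  have hM' : ∀ t ∈ Icc a b, ‖Q t‖ ≤ max M 1 := fun t ht ↦ (hM t ht).trans (le_max_left _ _)
  have hMpos : 0 < max M 1 := lt_of_lt_of_le one_pos (le_max_right _ _)
  -- The step length depends only on a bound for `Q` and not on `b₁`, which is what allows the steps
  -- to be chained later.
  refine ⟨1 / (2 * max M 1), by positivity, fun t₁ ht₁ t₂ ht₂ h12 hδ b₁ hb₁ ↦ ?_⟩
  have hsub : Icc t₁ t₂ ⊆ Icc a b := Icc_subset_Icc ht₁.1 ht₂.2
  have hMδ : max M 1 * (t₂ - t₁) ≤ 1 / 2 := by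
    have := mul_le_mul_of_nonneg_left hδ hMpos.le
    refine this.trans (le_of_eq ?_)
    field_simp
  -- `β` solves `β' = ∂ₛy - [y, β]`. The anchor may have a kernel, so lifts of the variation field
  -- are not unique and the initial lift `b₁` has to be prescribed.
  obtain ⟨β, hβ₁, hβ⟩ := exists_linear_ode_solution h12 hMpos.le hMδ (hQcont.mono hsub)
    (hy'cont.mono hsub) (fun t ht ↦ hM' t (hsub ht)) b₁
  have hβk : ∀ t ∈ Icc t₁ t₂, ∀ k, HasDerivWithinAt (fun τ ↦ β τ k)
      (y' t k - ∑ i, ∑ j, m.C j i k (c (t, 0)) * y (t, 0) j * β t i) (Icc t₁ t₂) t := by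
    intro t ht k
    have := hasDerivWithinAt_pi.1 (hβ t ht) k
    simp only [Pi.add_apply, hQ] at this
    convert! this using 1
    ring
  have hct : ∀ t ∈ Icc t₁ t₂, HasDerivWithinAt (fun τ ↦ c (τ, 0))
      (m.vec (y (t, 0)) (c (t, 0))) (Icc t₁ t₂) t := fun t ht ↦ (hcy t (hsub ht) 0 h0).mono hsub
  -- The anchor of `β` obeys the linearized equation satisfied by `v`. The two sides differ by `∑
  -- y_j β_i (DX_i·X_j - DX_j·X_i - ∑ C_{ji}^k X_k)`, which vanishes by `bracket_eq`. Here `e1` to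
  -- `e4` only reorder the sums.
  have hu : ∀ t ∈ Icc t₁ t₂, HasDerivWithinAt (fun τ ↦ m.vec (β τ) (c (τ, 0)))
      (B t (m.vec (β t) (c (t, 0))) + g t) (Icc t₁ t₂) t := by
    intro t ht
    have hp := hcO0 t (hsub ht)
    have h3 : HasDerivWithinAt (fun τ ↦ m.vec (β τ) (c (τ, 0)))
        (∑ k, (β t k • fderiv ℝ (m.X k) (c (t, 0)) (m.vec (y (t, 0)) (c (t, 0))) +
          (y' t k - ∑ i, ∑ j, m.C j i k (c (t, 0)) * y (t, 0) j * β t i) • m.X k (c (t, 0))))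
        (Icc t₁ t₂) t :=
      HasDerivWithinAt.fun_sum fun k _ ↦ (hβk t ht k).smul
        ((hXd _ hp k).comp_hasDerivWithinAt t (hct t ht))
    convert! h3 using 1
    have e1 : ∀ k, fderiv ℝ (m.X k) (c (t, 0)) (m.vec (y (t, 0)) (c (t, 0)))
        = ∑ j, y (t, 0) j • fderiv ℝ (m.X k) (c (t, 0)) (m.X j (c (t, 0))) := fun k ↦ by
      simp [vec]
    have e2 : B t (m.vec (β t) (c (t, 0)))
        = ∑ j, ∑ i, (y (t, 0) j * β t i) • fderiv ℝ (m.X j) (c (t, 0)) (m.X i (c (t, 0))) := by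
      simp only [B, vec, sum_apply, smul_apply, map_sum, map_smul, Finset.smul_sum, smul_smul]
      rw [Finset.sum_comm]
      refine Finset.sum_congr rfl fun j _ ↦ Finset.sum_congr rfl fun k _ ↦ ?_
      congr 1; ring
    have e3 : ∑ k, (∑ i, ∑ j, m.C j i k (c (t, 0)) * y (t, 0) j * β t i) • m.X k (c (t, 0))
        = ∑ j, ∑ i, (y (t, 0) j * β t i) • ∑ k, m.C j i k (c (t, 0)) • m.X k (c (t, 0)) := by
      simp only [Finset.sum_smul, Finset.smul_sum, smul_smul]
      rw [Finset.sum_comm]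
      rw [Finset.sum_comm (γ := Fin n) (s := Finset.univ) (t := Finset.univ)
        (f := fun j i ↦ ∑ k, (y (t, 0) j * β t i * m.C j i k (c (t, 0))) • m.X k (c (t, 0)))]
      refine Finset.sum_congr rfl fun i _ ↦ ?_
      rw [Finset.sum_comm]
      refine Finset.sum_congr rfl fun j _ ↦ Finset.sum_congr rfl fun k _ ↦ ?_
      congr 1; ring
    have e4 : ∑ k, β t k • fderiv ℝ (m.X k) (c (t, 0)) (m.vec (y (t, 0)) (c (t, 0)))
        = ∑ j, ∑ i, (y (t, 0) j * β t i) • fderiv ℝ (m.X i) (c (t, 0)) (m.X j (c (t, 0))) := by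
      simp only [e1, Finset.smul_sum, smul_smul]
      rw [Finset.sum_comm]
      refine Finset.sum_congr rfl fun j _ ↦ Finset.sum_congr rfl fun k _ ↦ ?_
      congr 1; ring
    simp only [sub_smul, Finset.sum_add_distrib, Finset.sum_sub_distrib]
    rw [e2, e3, e4]
    simp only [← m.bracket_eq _ hp, smul_sub, Finset.sum_sub_distrib]
    simp only [g]
    abel
  have hvβ : ∀ t ∈ Icc t₁ t₂, m.vec (β t) (c (t, 0)) = v t := by
    have := linear_ode_unique (hBcont.mono hsub) hu (fun t ht ↦ (hv' t (hsub ht)).mono hsub)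
      (by rw [hβ₁]; exact hb₁)
    exact this
  -- The same cancellation with `Θ` in place of `X`: the commutator now leaves `∑ y_j β_i A_j(X_i)`,
  -- which is the covector of the path applied to the variation field.
  have hN : ∀ t ∈ Icc t₁ t₂, HasDerivWithinAt (fun τ ↦ m.prim (β τ) (c (τ, 0)))
      (deriv (fun σ ↦ m.prim (y (t, σ)) (c (t, σ))) 0
        + m.covec (y (t, 0)) (c (t, 0)) (v t)) (Icc t₁ t₂) t := by
    intro t ht
    have hp := hcO0 t (hsub ht)
    have h3 : HasDerivWithinAt (fun τ ↦ m.prim (β τ) (c (τ, 0)))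
        (∑ k, ((y' t k - ∑ i, ∑ j, m.C j i k (c (t, 0)) * y (t, 0) j * β t i) * m.Θ k (c (t, 0))
          + β t k * fderiv ℝ (m.Θ k) (c (t, 0)) (m.vec (y (t, 0)) (c (t, 0)))))
        (Icc t₁ t₂) t :=
      HasDerivWithinAt.fun_sum fun k _ ↦ (hβk t ht k).mul
        ((hΘd _ hp k).comp_hasDerivWithinAt t (hct t ht))
    convert! h3 using 1
    rw [hprim' t (hsub ht), ← hvβ t ht]
    have e1 : ∑ k, y (t, 0) k * fderiv ℝ (m.Θ k) (c (t, 0)) (m.vec (β t) (c (t, 0)))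
        = ∑ j, ∑ i, (y (t, 0) j * β t i) * fderiv ℝ (m.Θ j) (c (t, 0)) (m.X i (c (t, 0))) := by
      simp [vec, Finset.mul_sum, mul_assoc]
    have e2 : m.covec (y (t, 0)) (c (t, 0)) (m.vec (β t) (c (t, 0)))
        = ∑ j, ∑ i, (y (t, 0) j * β t i) * m.A j (c (t, 0)) (m.X i (c (t, 0))) := by
      simp [vec, covec, Finset.mul_sum, mul_assoc]
      rw [Finset.sum_comm]
      refine Finset.sum_congr rfl fun j _ ↦ Finset.sum_congr rfl fun k _ ↦ ?_
      ring
    have e3 : ∑ k, (∑ i, ∑ j, m.C j i k (c (t, 0)) * y (t, 0) j * β t i) * m.Θ k (c (t, 0))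
        = ∑ j, ∑ i, (y (t, 0) j * β t i) * ∑ k, m.C j i k (c (t, 0)) * m.Θ k (c (t, 0)) := by
      simp only [Finset.sum_mul, Finset.mul_sum]
      rw [Finset.sum_comm]
      rw [Finset.sum_comm (γ := Fin n) (s := Finset.univ) (t := Finset.univ)
        (f := fun j i ↦ ∑ k, (y (t, 0) j * β t i * (m.C j i k (c (t, 0)) * m.Θ k (c (t, 0)))))]
      refine Finset.sum_congr rfl fun i _ ↦ ?_
      rw [Finset.sum_comm]
      refine Finset.sum_congr rfl fun j _ ↦ Finset.sum_congr rfl fun k _ ↦ ?_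
      ring
    have e4 : ∑ k, β t k * fderiv ℝ (m.Θ k) (c (t, 0)) (m.vec (y (t, 0)) (c (t, 0)))
        = ∑ j, ∑ i, (y (t, 0) j * β t i) * fderiv ℝ (m.Θ i) (c (t, 0)) (m.X j (c (t, 0))) := by
      simp only [vec, map_sum, map_smul, smul_eq_mul, Finset.mul_sum]
      rw [Finset.sum_comm]
      refine Finset.sum_congr rfl fun j _ ↦ Finset.sum_congr rfl fun k _ ↦ ?_
      ring
    simp only [sub_mul, Finset.sum_add_distrib, Finset.sum_sub_distrib]
    rw [e1, e2, e3, e4]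
    simp only [← m.primitive_eq _ hp, mul_sub, Finset.sum_sub_distrib]
    ring
  refine ⟨β t₂, hvβ t₂ ⟨h12, le_rfl⟩, ?_⟩
  have hcov : ContinuousOn (fun t ↦ m.covec (y (t, 0)) (c (t, 0)) (v t)) (Icc a b) := by
    refine ContinuousOn.clm_apply ?_ hvcont
    refine continuousOn_finsetSum _ fun k _ ↦ ?_
    exact (continuousOn_slice h0 (hyk k).continuousOn).smul
      (continuousOn_slice h0 (hA k).continuousOn)
  have hpc := continuousOn_slice h0 (continuousOn_deriv_snd hab (hprim.of_le h1i))
  have := integral_eq_sub_of_hasDerivWithinAt_Icc h12 hN ((hpc.add hcov).mono hsub)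
  rw [this, hβ₁]

end LocalModel

end Variation

end DiracGeometry

noncomputable section

namespace DiracGeometry

/-! ### Coordinates on the generalized tangent bundle. -/

section Charts

variable {E : Type*} [NormedAddCommGroup E] [NormedSpace ℝ E]
  {M : Type*} [TopologicalSpace M] [ChartedSpace E M] [IsManifold 𝓘(ℝ, E) ∞ M]

variable (E) in
/-- The tangent coordinates given by the preferred chart at `x₀`. -/
def tcoord (x₀ x : M) : TangentSpace 𝓘(ℝ, E) x →L[ℝ] E :=
  (trivializationAt E (TangentSpace 𝓘(ℝ, E)) x₀).continuousLinearMapAt ℝ x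

variable (E) in
/-- The tangent vector with given coordinates in the preferred chart at `x₀`. -/
def tsymm (x₀ x : M) : E →L[ℝ] TangentSpace 𝓘(ℝ, E) x :=
  (trivializationAt E (TangentSpace 𝓘(ℝ, E)) x₀).symmL ℝ x

/-- The coordinates of an element of the generalized tangent bundle in the preferred chart
at `x₀`. -/
def gcoord (x₀ x : M) (a : GenTangentSpace E x) : E × (E →L[ℝ] ℝ) :=
  (tcoord E x₀ x a.1, a.2.comp (tsymm E x₀ x))

/-- The tangent bundle of a manifold of class `n + 1` is of class `n`; for `n = ∞` no derivative is
lost. -/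
instance : IsManifold 𝓘(ℝ, E) (∞ + 1) M := ‹IsManifold 𝓘(ℝ, E) ∞ M›

theorem gcoord_add (x₀ x : M) (a b : GenTangentSpace E x) :
    gcoord x₀ x (a + b) = gcoord x₀ x a + gcoord x₀ x b := by
  ext <;> simp [gcoord]

theorem gcoord_smul (x₀ x : M) (r : ℝ) (a : GenTangentSpace E x) :
    gcoord x₀ x (r • a) = r • gcoord x₀ x a := by
  ext <;> simp [gcoord]

theorem mem_baseSet_of_mem_source {x₀ x : M} (hx : x ∈ (extChartAt 𝓘(ℝ, E) x₀).source) :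
    x ∈ (trivializationAt E (TangentSpace 𝓘(ℝ, E)) x₀).baseSet := by
  simpa using hx

theorem tcoord_tsymm {x₀ x : M} (hx : x ∈ (extChartAt 𝓘(ℝ, E) x₀).source) (w : E) :
    tcoord E x₀ x (tsymm E x₀ x w) = w :=
  Trivialization.continuousLinearMapAt_symmL _ (mem_baseSet_of_mem_source hx) w

theorem tsymm_tcoord {x₀ x : M} (hx : x ∈ (extChartAt 𝓘(ℝ, E) x₀).source)
    (v : TangentSpace 𝓘(ℝ, E) x) : tsymm E x₀ x (tcoord E x₀ x v) = v :=
  Trivialization.symmL_continuousLinearMapAt _ (mem_baseSet_of_mem_source hx) v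

theorem gcoord_injective {x₀ x : M} (hx : x ∈ (extChartAt 𝓘(ℝ, E) x₀).source) :
    Function.Injective (gcoord (E := E) x₀ x) := by
  intro a b hab
  have h1 : tcoord E x₀ x a.1 = tcoord E x₀ x b.1 := congrArg Prod.fst hab
  have h2 : a.2.comp (tsymm E x₀ x) = b.2.comp (tsymm E x₀ x) := congrArg Prod.snd hab
  refine Prod.ext ?_ ?_
  · rw [← tsymm_tcoord hx a.1, h1, tsymm_tcoord hx]
  · ext v
    have := congrArg (fun f ↦ f (tcoord E x₀ x v)) h2
    simpa [tsymm_tcoord hx] using this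

theorem gcoord_snd_apply {x₀ x : M} (hx : x ∈ (extChartAt 𝓘(ℝ, E) x₀).source)
    (a : GenTangentSpace E x) (v : TangentSpace 𝓘(ℝ, E) x) :
    (gcoord x₀ x a).2 (tcoord E x₀ x v) = a.2 v := by
  show a.2 (tsymm E x₀ x (tcoord E x₀ x v)) = a.2 v
  rw [tsymm_tcoord hx]

theorem trivializationAt_gen_apply {x₀ : M} {z : GenTangentBundle E M}
    (hz : z.1 ∈ (extChartAt 𝓘(ℝ, E) x₀).source) :
    (trivializationAt (E × (E →L[ℝ] ℝ)) (fun x : M ↦ GenTangentSpace E x) x₀ z).2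
      = gcoord x₀ z.1 z.2 := by
  have hb := mem_baseSet_of_mem_source hz
  refine Prod.ext ?_ ?_
  · show (trivializationAt E (TangentSpace 𝓘(ℝ, E)) x₀ ⟨z.1, z.2.1⟩).2 = _
    simp only [gcoord, tcoord]
    rw [Trivialization.continuousLinearMapAt_apply, Trivialization.coe_linearMapAt_of_mem _ hb]
  · show (trivializationAt (E →L[ℝ] ℝ) (fun x : M ↦ CotangentSpace E x) x₀ ⟨z.1, z.2.2⟩).2 = _
    rw [hom_trivializationAt_apply]
    ext w
    simp [ContinuousLinearMap.inCoordinates, gcoord, tsymm]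

theorem mem_gen_source {x₀ : M} {z : GenTangentBundle E M}
    (hz : z.1 ∈ (extChartAt 𝓘(ℝ, E) x₀).source) :
    z ∈ (trivializationAt (E × (E →L[ℝ] ℝ)) (fun x : M ↦ GenTangentSpace E x) x₀).source := by
  rw [Trivialization.mem_source]
  simpa using hz

variable {EN : Type*} [NormedAddCommGroup EN] [NormedSpace ℝ EN]

/-- The chart center `x₀` is free here, so that a single chart serves a whole neighbourhood of times
and parameters. All smoothness questions about Dirac paths and their variations pass through this
criterion. -/
theorem contMDiffWithinAt_gen_iff {f : EN → GenTangentBundle E M} {s : Set EN} {q : EN} {x₀ : M}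
    (hq : (f q).1 ∈ (extChartAt 𝓘(ℝ, E) x₀).source) :
    ContMDiffWithinAt 𝓘(ℝ, EN) (genModel E) ∞ f s q ↔
      ContMDiffWithinAt 𝓘(ℝ, EN) 𝓘(ℝ, E) ∞ (fun p ↦ (f p).1) s q ∧
      ContDiffWithinAt ℝ ∞ (fun p ↦ gcoord x₀ (f p).1 (f p).2) s q := by
  rw [Trivialization.contMDiffWithinAt_iff
    (e := trivializationAt (E × (E →L[ℝ] ℝ)) (fun x : M ↦ GenTangentSpace E x) x₀)
    (mem_gen_source hq)]
  refine and_congr_right fun h ↦ ?_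
  rw [← contMDiffWithinAt_iff_contDiffWithinAt]
  have h1 : ∀ᶠ p in 𝓝[s] q, (f p).1 ∈ (extChartAt 𝓘(ℝ, E) x₀).source :=
    h.continuousWithinAt.eventually ((isOpen_extChartAt_source x₀).mem_nhds hq)
  have h2 : (fun p ↦ (trivializationAt (E × (E →L[ℝ] ℝ)) (fun x : M ↦ GenTangentSpace E x) x₀
      (f p)).2) =ᶠ[𝓝[s] q] fun p ↦ gcoord x₀ (f p).1 (f p).2 := by
    filter_upwards [h1] with p hp using trivializationAt_gen_apply hp
  exact h2.contMDiffWithinAt_iff (trivializationAt_gen_apply hq)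

end Charts

end DiracGeometry

end

noncomputable section

namespace DiracGeometry

/-! ### Differentials, velocities, Lie brackets and Lie derivatives in a chart. -/

section Charts

variable {E : Type*} [NormedAddCommGroup E] [NormedSpace ℝ E]
  {M : Type*} [TopologicalSpace M] [ChartedSpace E M] [IsManifold 𝓘(ℝ, E) ∞ M]

instance : IsManifold 𝓘(ℝ, E) 1 M := IsManifold.of_le (n := ∞) (by simp)

theorem tcoord_eq_mfderiv {x₀ x : M} (hx : x ∈ (extChartAt 𝓘(ℝ, E) x₀).source) :
    tcoord E x₀ x = mfderiv 𝓘(ℝ, E) 𝓘(ℝ, E) (extChartAt 𝓘(ℝ, E) x₀) x :=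
  TangentBundle.continuousLinearMapAt_trivializationAt (by simpa using hx)

theorem tsymm_eq_mfderiv {x₀ x : M} (hx : x ∈ (extChartAt 𝓘(ℝ, E) x₀).source) :
    tsymm E x₀ x = mfderiv 𝓘(ℝ, E) 𝓘(ℝ, E) (extChartAt 𝓘(ℝ, E) x₀).symm
      (extChartAt 𝓘(ℝ, E) x₀ x) := by
  have h := TangentBundle.symmL_trivializationAt (I := 𝓘(ℝ, E)) (𝕜 := ℝ) (x₀ := x₀) (x := x)
    (by simpa using hx)
  rw [ModelWithCorners.range_eq_univ, mfderivWithin_univ] at h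
  exact h

theorem mdifferentiableAt_extChart {x₀ x : M} (hx : x ∈ (extChartAt 𝓘(ℝ, E) x₀).source) :
    MDifferentiableAt 𝓘(ℝ, E) 𝓘(ℝ, E) (extChartAt 𝓘(ℝ, E) x₀) x :=
  mdifferentiableAt_extChartAt (by simpa using hx)

theorem contMDiffAt_extChart_symm {x₀ : M} {p : E} (hp : p ∈ (extChartAt 𝓘(ℝ, E) x₀).target) :
    ContMDiffAt 𝓘(ℝ, E) 𝓘(ℝ, E) ∞ (extChartAt 𝓘(ℝ, E) x₀).symm p :=
  (contMDiffOn_extChartAt_symm x₀).contMDiffAt ((isOpen_extChartAt_target x₀).mem_nhds hp)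

theorem contMDiffAt_extChart {x₀ x : M} (hx : x ∈ (extChartAt 𝓘(ℝ, E) x₀).source) :
    ContMDiffAt 𝓘(ℝ, E) 𝓘(ℝ, E) ∞ (extChartAt 𝓘(ℝ, E) x₀) x :=
  contMDiffAt_extChartAt' (by simpa using hx)

/-- The differential of a function in a chart. -/
theorem mvfderiv_eq_fderiv_tcoord {f : M → ℝ} {x₀ x : M}
    (hx : x ∈ (extChartAt 𝓘(ℝ, E) x₀).source)
    (hf : DifferentiableAt ℝ (fun p ↦ f ((extChartAt 𝓘(ℝ, E) x₀).symm p))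
      (extChartAt 𝓘(ℝ, E) x₀ x)) (v : TangentSpace 𝓘(ℝ, E) x) :
    mvfderiv 𝓘(ℝ, E) f x v = fderiv ℝ (fun p ↦ f ((extChartAt 𝓘(ℝ, E) x₀).symm p))
      (extChartAt 𝓘(ℝ, E) x₀ x) (tcoord E x₀ x v) := by
  have h1 : f =ᶠ[𝓝 x] (fun p ↦ f ((extChartAt 𝓘(ℝ, E) x₀).symm p)) ∘ extChartAt 𝓘(ℝ, E) x₀ := by
    filter_upwards [(isOpen_extChartAt_source x₀).mem_nhds hx] with y hy
    simp only [Function.comp, (extChartAt 𝓘(ℝ, E) x₀).left_inv hy]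
  have h2 := (hf.mdifferentiableAt.hasMFDerivAt).comp x (mdifferentiableAt_extChart hx).hasMFDerivAt
  have h3 := (h2.congr_of_eventuallyEq h1).mfderiv
  rw [mfderiv_eq_fderiv] at h3
  rw [tcoord_eq_mfderiv hx]
  have h4 := congrArg (fun (L : E →L[ℝ] ℝ) ↦ L v) h3
  exact h4

/-- The velocity of a path in a chart. -/
theorem hasDerivWithinAt_of_velocity {c : ℝ → M} {a b t : ℝ} {x₀ : M}
    (hx : c t ∈ (extChartAt 𝓘(ℝ, E) x₀).source)
    (hc : MDifferentiableWithinAt 𝓘(ℝ, ℝ) 𝓘(ℝ, E) c (Icc a b) t) :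
    HasDerivWithinAt (fun τ ↦ extChartAt 𝓘(ℝ, E) x₀ (c τ))
      (tcoord E x₀ (c t) (velocity a b c t)) (Icc a b) t := by
  obtain ⟨L, hL, hL1⟩ : ∃ L : ℝ →L[ℝ] E,
      HasFDerivWithinAt (fun τ ↦ extChartAt 𝓘(ℝ, E) x₀ (c τ)) L (Icc a b) t ∧
      L 1 = tcoord E x₀ (c t) (velocity a b c t) :=
    ⟨_, ((mdifferentiableAt_extChart hx).hasMFDerivAt.comp_hasMFDerivWithinAt t
      hc.hasMFDerivWithinAt).hasFDerivWithinAt, by rw [tcoord_eq_mfderiv hx]; rfl⟩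
  rw [← hL1]
  exact hL.hasDerivWithinAt

/-- The coordinates of a section of the generalized tangent bundle in a chart. -/
def localRep (x₀ : M) (σ : ∀ x : M, GenTangentSpace E x) (p : E) : E × (E →L[ℝ] ℝ) :=
  gcoord x₀ ((extChartAt 𝓘(ℝ, E) x₀).symm p) (σ ((extChartAt 𝓘(ℝ, E) x₀).symm p))

theorem localRep_extChart {x₀ x : M} (hx : x ∈ (extChartAt 𝓘(ℝ, E) x₀).source)
    (σ : ∀ x : M, GenTangentSpace E x) :
    localRep x₀ σ (extChartAt 𝓘(ℝ, E) x₀ x) = gcoord x₀ x (σ x) := by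
  unfold localRep
  rw [(extChartAt 𝓘(ℝ, E) x₀).left_inv hx]

theorem contDiffAt_localRep {x₀ x : M} (hx : x ∈ (extChartAt 𝓘(ℝ, E) x₀).source)
    {σ : ∀ x : M, GenTangentSpace E x}
    (hσ : ContMDiffAt 𝓘(ℝ, E) (genModel E) ∞
      (fun x ↦ (TotalSpace.mk x (σ x) : GenTangentBundle E M)) x) :
    ContDiffAt ℝ ∞ (localRep x₀ σ) (extChartAt 𝓘(ℝ, E) x₀ x) := by
  have hp := (extChartAt 𝓘(ℝ, E) x₀).map_source hx
  have hxx := (extChartAt 𝓘(ℝ, E) x₀).left_inv hx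
  have h1 : ContMDiffAt 𝓘(ℝ, E) (genModel E) ∞
      (fun x ↦ (TotalSpace.mk x (σ x) : GenTangentBundle E M))
      ((extChartAt 𝓘(ℝ, E) x₀).symm (extChartAt 𝓘(ℝ, E) x₀ x)) := by rwa [hxx]
  have h2 := h1.comp (extChartAt 𝓘(ℝ, E) x₀ x) (contMDiffAt_extChart_symm hp)
  rw [← contMDiffWithinAt_univ, contMDiffWithinAt_gen_iff (x₀ := x₀)
    (by simpa only [Function.comp, hxx] using hx)] at h2
  exact h2.2

/-- The coordinates of a vector field in a chart. -/
def vecRep (x₀ : M) (W : ∀ x : M, TangentSpace 𝓘(ℝ, E) x) (p : E) : E :=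
  tcoord E x₀ ((extChartAt 𝓘(ℝ, E) x₀).symm p) (W ((extChartAt 𝓘(ℝ, E) x₀).symm p))

theorem vecRep_extChart {x₀ x : M} (hx : x ∈ (extChartAt 𝓘(ℝ, E) x₀).source)
    (W : ∀ x : M, TangentSpace 𝓘(ℝ, E) x) :
    vecRep x₀ W (extChartAt 𝓘(ℝ, E) x₀ x) = tcoord E x₀ x (W x) := by
  unfold vecRep
  rw [(extChartAt 𝓘(ℝ, E) x₀).left_inv hx]

theorem contMDiffAt_vectorField_iff {x₀ x : M} (hx : x ∈ (extChartAt 𝓘(ℝ, E) x₀).source)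
    {W : ∀ x : M, TangentSpace 𝓘(ℝ, E) x} :
    ContMDiffAt 𝓘(ℝ, E) (𝓘(ℝ, E).prod 𝓘(ℝ, E)) ∞
      (fun x ↦ (TotalSpace.mk x (W x) : TangentBundle 𝓘(ℝ, E) M)) x ↔
    ContMDiffAt 𝓘(ℝ, E) 𝓘(ℝ, E) ∞ (fun y ↦ tcoord E x₀ y (W y)) x := by
  have hb := mem_baseSet_of_mem_source hx
  have h := Trivialization.contMDiffAt_section_iff (n := ∞) (IB := 𝓘(ℝ, E)) (s := W)
    (trivializationAt E (TangentSpace 𝓘(ℝ, E)) x₀) hb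
  refine h.trans ?_
  refine Filter.EventuallyEq.contMDiffAt_iff ?_
  filter_upwards [(isOpen_extChartAt_source x₀).mem_nhds hx] with y hy
  simp only [tcoord]
  rw [Trivialization.continuousLinearMapAt_apply,
    Trivialization.coe_linearMapAt_of_mem _ (mem_baseSet_of_mem_source hy)]

theorem contDiffAt_vecRep {x₀ x : M} (hx : x ∈ (extChartAt 𝓘(ℝ, E) x₀).source)
    {W : ∀ x : M, TangentSpace 𝓘(ℝ, E) x}
    (hW : ContMDiffAt 𝓘(ℝ, E) (𝓘(ℝ, E).prod 𝓘(ℝ, E)) ∞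
      (fun x ↦ (TotalSpace.mk x (W x) : TangentBundle 𝓘(ℝ, E) M)) x) :
    ContDiffAt ℝ ∞ (vecRep x₀ W) (extChartAt 𝓘(ℝ, E) x₀ x) := by
  have hp := (extChartAt 𝓘(ℝ, E) x₀).map_source hx
  have hxx := (extChartAt 𝓘(ℝ, E) x₀).left_inv hx
  have h1 := (contMDiffAt_vectorField_iff hx).1 hW
  rw [← hxx] at h1
  exact (h1.comp (extChartAt 𝓘(ℝ, E) x₀ x) (contMDiffAt_extChart_symm hp)).contDiffAt

/-- The pullback by the inverse chart applies the inverse of its derivative. That derivative is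
`tsymm`, whose inverse is `tcoord`. -/
theorem mpullback_extChart_symm_eventuallyEq {x₀ : M} {p : E}
    (hp : p ∈ (extChartAt 𝓘(ℝ, E) x₀).target) (W : ∀ x : M, TangentSpace 𝓘(ℝ, E) x) :
    mpullback 𝓘(ℝ, E) 𝓘(ℝ, E) (extChartAt 𝓘(ℝ, E) x₀).symm W =ᶠ[𝓝 p] vecRep x₀ W := by
  filter_upwards [(isOpen_extChartAt_target x₀).mem_nhds hp] with q hq
  have hx := (extChartAt 𝓘(ℝ, E) x₀).map_target hq
  have h1 := tsymm_eq_mfderiv hx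
  rw [(extChartAt 𝓘(ℝ, E) x₀).right_inv hq] at h1
  have h2 : (tsymm E x₀ ((extChartAt 𝓘(ℝ, E) x₀).symm q)).inverse
      = tcoord E x₀ ((extChartAt 𝓘(ℝ, E) x₀).symm q) :=
    ContinuousLinearMap.inverse_eq (by ext w; exact tsymm_tcoord hx w)
      (by ext w; exact tcoord_tsymm hx w)
  rw [mpullback_apply]
  exact (congrArg (fun L : E →L[ℝ] E ↦ L.inverse (W ((extChartAt 𝓘(ℝ, E) x₀).symm q))) h1.symm).trans
    (congrArg (fun L : E →L[ℝ] E ↦ L (W ((extChartAt 𝓘(ℝ, E) x₀).symm q))) h2)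

/-- The Lie bracket of vector fields in a chart. -/
theorem tcoord_mlieBracket [CompleteSpace E] {x₀ x : M}
    (hx : x ∈ (extChartAt 𝓘(ℝ, E) x₀).source)
    {V W : ∀ x : M, TangentSpace 𝓘(ℝ, E) x}
    (hV : ContMDiffAt 𝓘(ℝ, E) (𝓘(ℝ, E).prod 𝓘(ℝ, E)) ∞
      (fun x ↦ (TotalSpace.mk x (V x) : TangentBundle 𝓘(ℝ, E) M)) x)
    (hW : ContMDiffAt 𝓘(ℝ, E) (𝓘(ℝ, E).prod 𝓘(ℝ, E)) ∞
      (fun x ↦ (TotalSpace.mk x (W x) : TangentBundle 𝓘(ℝ, E) M)) x) :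
    tcoord E x₀ x (mlieBracket 𝓘(ℝ, E) V W x) =
      lieBracket ℝ (vecRep x₀ V) (vecRep x₀ W) (extChartAt 𝓘(ℝ, E) x₀ x) := by
  have hp := (extChartAt 𝓘(ℝ, E) x₀).map_source hx
  have hxx := (extChartAt 𝓘(ℝ, E) x₀).left_inv hx
  have : IsManifold 𝓘(ℝ, E) (minSmoothness ℝ 2) M :=
    IsManifold.of_le (n := ∞) (by simp only [minSmoothness_of_isRCLikeNormedField]; exact WithTop.coe_le_coe.2 (le_top (a := (2 : ℕ∞))))
  have h1 := mpullback_mlieBracket (n := ∞) (f := (extChartAt 𝓘(ℝ, E) x₀).symm) (V := V) (W := W)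
    (x₀ := extChartAt 𝓘(ℝ, E) x₀ x) (by rw [hxx]; exact hV.mdifferentiableAt (by simp))
    (by rw [hxx]; exact hW.mdifferentiableAt (by simp)) (contMDiffAt_extChart_symm hp)
    (by simp only [minSmoothness_of_isRCLikeNormedField]; exact WithTop.coe_le_coe.2 (le_top (a := (2 : ℕ∞))))
  rw [(mpullback_extChart_symm_eventuallyEq hp _).eq_of_nhds, vecRep_extChart hx,
    ← mlieBracketWithin_univ (I := 𝓘(ℝ, E)) (M := E), mlieBracketWithin_eq_lieBracketWithin] at h1
  have h2 : ∀ A B : E → E, lieBracketWithin ℝ A B univ (extChartAt 𝓘(ℝ, E) x₀ x)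
      = lieBracket ℝ A B (extChartAt 𝓘(ℝ, E) x₀ x) :=
    fun A B ↦ congrFun lieBracketWithin_univ _
  have h3 : ∀ A B A' B' : E → E, A =ᶠ[𝓝 (extChartAt 𝓘(ℝ, E) x₀ x)] A' →
      B =ᶠ[𝓝 (extChartAt 𝓘(ℝ, E) x₀ x)] B' → lieBracket ℝ A B (extChartAt 𝓘(ℝ, E) x₀ x)
        = lieBracket ℝ A' B' (extChartAt 𝓘(ℝ, E) x₀ x) :=
    fun A B A' B' hA hB ↦ hA.lieBracket_vectorField_eq hB
  exact h1.trans ((h2 _ _).trans (h3 _ _ _ _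
    (mpullback_extChart_symm_eventuallyEq hp V) (mpullback_extChart_symm_eventuallyEq hp W)))

theorem SmoothSection_fst_contMDiffAt {σ : ∀ x : M, GenTangentSpace E x} {x : M}
    (hσ : ContMDiffAt 𝓘(ℝ, E) (genModel E) ∞
      (fun x ↦ (TotalSpace.mk x (σ x) : GenTangentBundle E M)) x) :
    ContMDiffAt 𝓘(ℝ, E) (𝓘(ℝ, E).prod 𝓘(ℝ, E)) ∞
      (fun x ↦ (TotalSpace.mk x (σ x).1 : TangentBundle 𝓘(ℝ, E) M)) x := by
  have hx : x ∈ (extChartAt 𝓘(ℝ, E) x).source := mem_extChartAt_source x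
  rw [contMDiffAt_vectorField_iff hx]
  have h1 := (contDiffAt_localRep hx hσ).contMDiffAt.comp x (contMDiffAt_extChart hx)
  have h2 : ContMDiffAt 𝓘(ℝ, E) 𝓘(ℝ, E) ∞
      (fun y ↦ (localRep x σ (extChartAt 𝓘(ℝ, E) x y)).1) x :=
    contDiffAt_fst.contMDiffAt.comp x h1
  refine h2.congr_of_eventuallyEq ?_
  filter_upwards [(isOpen_extChartAt_source x).mem_nhds hx] with y hy
  rw [localRep_extChart hy]
  rfl

/-- The invariant formula for the Lie derivative of a one-form, in a chart. -/
theorem lieDeriv_chart_formula [CompleteSpace E] {x₀ x : M}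
    (hx : x ∈ (extChartAt 𝓘(ℝ, E) x₀).source)
    {X W : ∀ x : M, TangentSpace 𝓘(ℝ, E) x} {τ : ∀ x : M, GenTangentSpace E x}
    (hX : ContMDiffAt 𝓘(ℝ, E) (𝓘(ℝ, E).prod 𝓘(ℝ, E)) ∞
      (fun x ↦ (TotalSpace.mk x (X x) : TangentBundle 𝓘(ℝ, E) M)) x)
    (hτ : ContMDiffAt 𝓘(ℝ, E) (genModel E) ∞
      (fun x ↦ (TotalSpace.mk x (τ x) : GenTangentBundle E M)) x)
    (hW : ContMDiffAt 𝓘(ℝ, E) (𝓘(ℝ, E).prod 𝓘(ℝ, E)) ∞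
      (fun x ↦ (TotalSpace.mk x (W x) : TangentBundle 𝓘(ℝ, E) M)) x) :
    mvfderiv 𝓘(ℝ, E) (fun y ↦ (τ y).2 (W y)) x (X x) - (τ x).2 (mlieBracket 𝓘(ℝ, E) X W x) =
      (fderiv ℝ (fun p ↦ (localRep x₀ τ p).2) (extChartAt 𝓘(ℝ, E) x₀ x)
          (vecRep x₀ X (extChartAt 𝓘(ℝ, E) x₀ x))
        + ((localRep x₀ τ (extChartAt 𝓘(ℝ, E) x₀ x)).2).comp
          (fderiv ℝ (vecRep x₀ X) (extChartAt 𝓘(ℝ, E) x₀ x))) (tcoord E x₀ x (W x)) := by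
  set p := extChartAt 𝓘(ℝ, E) x₀ x with hp_def
  have hp := (extChartAt 𝓘(ℝ, E) x₀).map_source hx
  have hXd := (contDiffAt_vecRep hx hX).differentiableAt (by simp)
  have hWd := (contDiffAt_vecRep hx hW).differentiableAt (by simp)
  have hτd : DifferentiableAt ℝ (fun p ↦ (localRep x₀ τ p).2) p :=
    ((contDiffAt_localRep hx hτ).differentiableAt (by simp)).snd
  have h1 : (fun q ↦ (τ ((extChartAt 𝓘(ℝ, E) x₀).symm q)).2 (W ((extChartAt 𝓘(ℝ, E) x₀).symm q)))
      =ᶠ[𝓝 p] fun q ↦ (localRep x₀ τ q).2 (vecRep x₀ W q) := by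
    filter_upwards [(isOpen_extChartAt_target x₀).mem_nhds hp] with q hq
    exact (gcoord_snd_apply ((extChartAt 𝓘(ℝ, E) x₀).map_target hq) _ _).symm
  have h2 : HasFDerivAt (fun q ↦ (localRep x₀ τ q).2 (vecRep x₀ W q)) _ p :=
    hτd.hasFDerivAt.clm_apply hWd.hasFDerivAt
  have h3 := h2.congr_of_eventuallyEq h1
  rw [mvfderiv_eq_fderiv_tcoord hx h3.differentiableAt, h3.fderiv, ← vecRep_extChart hx X,
    ← gcoord_snd_apply hx, tcoord_mlieBracket hx hX hW, ← localRep_extChart hx τ,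
    ← vecRep_extChart hx W, ← hp_def]
  simp only [lieBracket, add_apply, ContinuousLinearMap.comp_apply,
    ContinuousLinearMap.flip_apply, map_sub]
  abel

/-- This is the case of `lieDeriv_chart_formula` in the chart used by the definition. Since the
right-hand side mentions no chart, comparison with the formula at another center proves independence
of the chart. -/
theorem lieDerivOneForm_apply [CompleteSpace E] {x : M}
    {X W : ∀ x : M, TangentSpace 𝓘(ℝ, E) x} {τ : ∀ x : M, GenTangentSpace E x}
    (hX : ContMDiffAt 𝓘(ℝ, E) (𝓘(ℝ, E).prod 𝓘(ℝ, E)) ∞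
      (fun x ↦ (TotalSpace.mk x (X x) : TangentBundle 𝓘(ℝ, E) M)) x)
    (hτ : ContMDiffAt 𝓘(ℝ, E) (genModel E) ∞
      (fun x ↦ (TotalSpace.mk x (τ x) : GenTangentBundle E M)) x)
    (hW : ContMDiffAt 𝓘(ℝ, E) (𝓘(ℝ, E).prod 𝓘(ℝ, E)) ∞
      (fun x ↦ (TotalSpace.mk x (W x) : TangentBundle 𝓘(ℝ, E) M)) x) :
    lieDerivOneForm X (fun y ↦ (τ y).2) x (W x) =
      mvfderiv 𝓘(ℝ, E) (fun y ↦ (τ y).2 (W y)) x (X x)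
        - (τ x).2 (mlieBracket 𝓘(ℝ, E) X W x) := by
  have hx : x ∈ (extChartAt 𝓘(ℝ, E) x).source := mem_extChartAt_source x
  have hp := (extChartAt 𝓘(ℝ, E) x).map_source hx
  rw [lieDeriv_chart_formula hx hX hτ hW]
  have hX' := mpullback_extChart_symm_eventuallyEq hp X
  have hτ' : (fun p ↦ ((τ ((extChartAt 𝓘(ℝ, E) x).symm p)).2.comp
      (mfderiv 𝓘(ℝ, E) 𝓘(ℝ, E) (extChartAt 𝓘(ℝ, E) x).symm p) : E →L[ℝ] ℝ))
      =ᶠ[𝓝 (extChartAt 𝓘(ℝ, E) x x)] fun p ↦ (localRep x τ p).2 := by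
    filter_upwards [(isOpen_extChartAt_target x).mem_nhds hp] with q hq
    have h1 := tsymm_eq_mfderiv ((extChartAt 𝓘(ℝ, E) x).map_target hq)
    rw [(extChartAt 𝓘(ℝ, E) x).right_inv hq] at h1
    rw [← h1]
    rfl
  have key : ∀ (X₁ X₂ : E → E) (β₁ β₂ : E → E →L[ℝ] ℝ) (L₁ L₂ : E →L[ℝ] E) (p w : E),
      X₁ =ᶠ[𝓝 p] X₂ → β₁ =ᶠ[𝓝 p] β₂ → L₁ = L₂ →
      ((fderiv ℝ β₁ p (X₁ p) + (β₁ p).comp (fderiv ℝ X₁ p)).comp L₁) w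
        = (fderiv ℝ β₂ p (X₂ p) + (β₂ p).comp (fderiv ℝ X₂ p)) (L₂ w) := by
    intro X₁ X₂ β₁ β₂ L₁ L₂ p w h1 h2 h3
    rw [h1.fderiv_eq, h2.fderiv_eq, h1.eq_of_nhds, h2.eq_of_nhds, h3]
    rfl
  exact key _ _ _ _ _ _ _ _ hX' hτ' (tcoord_eq_mfderiv hx).symm

end Charts

end DiracGeometry

end

noncomputable section

namespace DiracGeometry

/-! ### The Courant bracket in a chart. -/

section ChartCourant

variable {E : Type*} [NormedAddCommGroup E] [NormedSpace ℝ E]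

/-- The Courant bracket in a vector space. -/
def chartCourant (s t : E → E × (E →L[ℝ] ℝ)) (p : E) : E × (E →L[ℝ] ℝ) :=
  (lieBracket ℝ (fun q ↦ (s q).1) (fun q ↦ (t q).1) p,
    (fderiv ℝ (fun q ↦ (t q).2) p (s p).1 + (t p).2.comp (fderiv ℝ (fun q ↦ (s q).1) p))
      - (fderiv ℝ (fun q ↦ (s q).2) p (t p).1 + (s p).2.comp (fderiv ℝ (fun q ↦ (t q).1) p))
      - (1 / 2 : ℝ) • fderiv ℝ (fun q ↦ (t q).2 (s q).1 - (s q).2 (t q).1) p)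

theorem contDiffOn_chartCourant {s t : E → E × (E →L[ℝ] ℝ)} {O : Set E} (hO : IsOpen O)
    (hs : ContDiffOn ℝ ∞ s O) (ht : ContDiffOn ℝ ∞ t O) :
    ContDiffOn ℝ ∞ (chartCourant s t) O := by
  have hs1 : ContDiffOn ℝ ∞ (fun q ↦ (s q).1) O := hs.fst
  have hs2 : ContDiffOn ℝ ∞ (fun q ↦ (s q).2) O := hs.snd
  have ht1 : ContDiffOn ℝ ∞ (fun q ↦ (t q).1) O := ht.fst
  have ht2 : ContDiffOn ℝ ∞ (fun q ↦ (t q).2) O := ht.snd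
  have ds1 : ContDiffOn ℝ ∞ (fderiv ℝ fun q ↦ (s q).1) O := hs1.fderiv_of_isOpen hO (by simp)
  have ds2 : ContDiffOn ℝ ∞ (fderiv ℝ fun q ↦ (s q).2) O := hs2.fderiv_of_isOpen hO (by simp)
  have dt1 : ContDiffOn ℝ ∞ (fderiv ℝ fun q ↦ (t q).1) O := ht1.fderiv_of_isOpen hO (by simp)
  have dt2 : ContDiffOn ℝ ∞ (fderiv ℝ fun q ↦ (t q).2) O := ht2.fderiv_of_isOpen hO (by simp)
  have dd : ContDiffOn ℝ ∞ (fderiv ℝ fun q ↦ (t q).2 (s q).1 - (s q).2 (t q).1) O :=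
    ((ht2.clm_apply hs1).sub (hs2.clm_apply ht1)).fderiv_of_isOpen hO (by simp)
  refine ContDiffOn.prodMk ?_ ?_
  · exact (dt1.clm_apply hs1).sub (ds1.clm_apply ht1)
  · exact (((dt2.clm_apply hs1).add (ht2.clm_comp ds1)).sub
      ((ds2.clm_apply ht1).add (hs2.clm_comp dt1))).sub (dd.const_smul (1 / 2 : ℝ))

variable {M : Type*} [TopologicalSpace M] [ChartedSpace E M] [IsManifold 𝓘(ℝ, E) ∞ M]

/-- The Courant bracket in a chart. -/
theorem gcoord_courantBracket [CompleteSpace E] {x₀ x : M}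
    (hx : x ∈ (extChartAt 𝓘(ℝ, E) x₀).source) {σ τ : ∀ x : M, GenTangentSpace E x}
    (hσ : ContMDiffAt 𝓘(ℝ, E) (genModel E) ∞
      (fun x ↦ (TotalSpace.mk x (σ x) : GenTangentBundle E M)) x)
    (hτ : ContMDiffAt 𝓘(ℝ, E) (genModel E) ∞
      (fun x ↦ (TotalSpace.mk x (τ x) : GenTangentBundle E M)) x) :
    gcoord x₀ x (courantBracket σ τ x)
      = chartCourant (localRep x₀ σ) (localRep x₀ τ) (extChartAt 𝓘(ℝ, E) x₀ x) := by
  have hp := (extChartAt 𝓘(ℝ, E) x₀).map_source hx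
  have hX := SmoothSection_fst_contMDiffAt hσ
  have hY := SmoothSection_fst_contMDiffAt hτ
  refine Prod.ext (tcoord_mlieBracket hx hX hY) ?_
  ext w
  -- The one-form is tested on the field with constant coordinates `w`. The invariant formula then
  -- carries the Lie derivatives from the chart at `x`, where they are defined, to the chart at
  -- `x₀`.
  let W : ∀ y : M, TangentSpace 𝓘(ℝ, E) y := fun y ↦ tsymm E x₀ y w
  have hWx : tcoord E x₀ x (W x) = w := tcoord_tsymm hx w
  have hW : ContMDiffAt 𝓘(ℝ, E) (𝓘(ℝ, E).prod 𝓘(ℝ, E)) ∞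
      (fun x ↦ (TotalSpace.mk x (W x) : TangentBundle 𝓘(ℝ, E) M)) x := by
    rw [contMDiffAt_vectorField_iff hx]
    refine (contMDiffAt_const (c := w)).congr_of_eventuallyEq ?_
    filter_upwards [(isOpen_extChartAt_source x₀).mem_nhds hx] with y hy
    exact tcoord_tsymm hy w
  have h1 := (lieDerivOneForm_apply hX hτ hW).trans (lieDeriv_chart_formula hx hX hτ hW)
  have h2 := (lieDerivOneForm_apply hY hσ hW).trans (lieDeriv_chart_formula hx hY hσ hW)
  have hσd := (contDiffAt_localRep hx hσ).differentiableAt (by simp)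
  have hτd := (contDiffAt_localRep hx hτ).differentiableAt (by simp)
  have h3 : (fun q ↦ (fun y ↦ (τ y).2 (σ y).1 - (σ y).2 (τ y).1)
        ((extChartAt 𝓘(ℝ, E) x₀).symm q))
      =ᶠ[𝓝 (extChartAt 𝓘(ℝ, E) x₀ x)] fun q ↦ (localRep x₀ τ q).2 (localRep x₀ σ q).1
        - (localRep x₀ σ q).2 (localRep x₀ τ q).1 := by
    filter_upwards [(isOpen_extChartAt_target x₀).mem_nhds hp] with q hq
    have hq' := (extChartAt 𝓘(ℝ, E) x₀).map_target hq
    exact congrArg₂ (· - ·) (gcoord_snd_apply hq' _ _).symm (gcoord_snd_apply hq' _ _).symm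
  have h4 : DifferentiableAt ℝ (fun q ↦ (localRep x₀ τ q).2 (localRep x₀ σ q).1
        - (localRep x₀ σ q).2 (localRep x₀ τ q).1) (extChartAt 𝓘(ℝ, E) x₀ x) :=
    (hτd.snd.clm_apply hσd.fst).sub (hσd.snd.clm_apply hτd.fst)
  have h5 := mvfderiv_eq_fderiv_tcoord (f := fun y ↦ (τ y).2 (σ y).1 - (σ y).2 (τ y).1) hx
    (h4.congr_of_eventuallyEq h3) (W x)
  rw [h3.fderiv_eq, hWx] at h5
  rw [hWx] at h1 h2
  have h6 : (gcoord x₀ x (courantBracket σ τ x)).2 w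
      = lieDerivOneForm (fun y ↦ (σ y).1) (fun y ↦ (τ y).2) x (W x)
        - lieDerivOneForm (fun y ↦ (τ y).1) (fun y ↦ (σ y).2) x (W x)
        - (1 / 2 : ℝ) * mvfderiv 𝓘(ℝ, E) (fun y ↦ (τ y).2 (σ y).1 - (σ y).2 (τ y).1) x (W x) := rfl
  rw [h6, h1, h2, h5]
  rfl

end ChartCourant

/-! ### Smooth extraction of frame components. -/

section LeftInverse

/-- A smooth family of linearly independent vectors has a smooth family of left inverses. -/
theorem exists_smooth_leftInverse {E F : Type*} [NormedAddCommGroup E] [NormedSpace ℝ E]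
    [NormedAddCommGroup F] [NormedSpace ℝ F] [FiniteDimensional ℝ F] {n : ℕ} {O : Set E}
    (hO : IsOpen O) {e : Fin n → E → F} (he : ∀ k, ContDiffOn ℝ ∞ (e k) O) {p₀ : E} (hp₀ : p₀ ∈ O)
    (hli : LinearIndependent ℝ fun k ↦ e k p₀) :
    ∃ O' ⊆ O, IsOpen O' ∧ p₀ ∈ O' ∧ ∃ L : E → F →L[ℝ] (Fin n → ℝ), ContDiffOn ℝ ∞ L O' ∧
      ∀ p ∈ O', ∀ y : Fin n → ℝ, L p (∑ k, y k • e k p) = y := by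
  let T : E → (Fin n → ℝ) →L[ℝ] F := fun p ↦
    ∑ k, (ContinuousLinearMap.proj (R := ℝ) (φ := fun _ : Fin n ↦ ℝ) k).smulRight (e k p)
  have hT : ∀ p y, T p y = ∑ k, y k • e k p := fun p y ↦ by simp [T]
  have hTs : ContDiffOn ℝ ∞ T O := ContDiffOn.sum fun k _ ↦
    contDiffOn_const.smulRight (he k)
  have hinj : Function.Injective (T p₀) := by
    rw [← ContinuousLinearMap.coe_coe, ← LinearMap.ker_eq_bot, LinearMap.ker_eq_bot']
    intro y hy
    have : T p₀ y = 0 := hy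
    rw [hT] at this
    exact funext (Fintype.linearIndependent_iff.1 hli y this)
  obtain ⟨g, hg⟩ := (T p₀ : (Fin n → ℝ) →ₗ[ℝ] F).exists_leftInverse_of_injective
    (LinearMap.ker_eq_bot.2 hinj)
  -- A left inverse at `p₀` alone is enough: `g' ∘ T p` stays invertible for nearby `p`, and its
  -- inverse, smooth in `p`, corrects `g'` to a left inverse of `T p`.
  let g' : F →L[ℝ] (Fin n → ℝ) := LinearMap.toContinuousLinearMap g
  let N : E → (Fin n → ℝ) →L[ℝ] (Fin n → ℝ) := fun p ↦ g'.comp (T p)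
  have hN : ContDiffOn ℝ ∞ N O := contDiffOn_const.clm_comp hTs
  have hN0 : N p₀ = 1 := by
    ext1 y
    exact congrArg (fun f ↦ f y) hg
  have hO' : IsOpen (O ∩ N ⁻¹' {A | IsUnit A}) := hN.continuousOn.isOpen_inter_preimage hO Units.isOpen
  refine ⟨O ∩ N ⁻¹' {A | IsUnit A}, inter_subset_left, hO', ⟨hp₀, ?_⟩,
    fun p ↦ (Ring.inverse (N p)).comp g', ?_, ?_⟩
  · show IsUnit (N p₀)
    rw [hN0]; exact isUnit_one
  · refine ContDiffOn.clm_comp ?_ contDiffOn_const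
    rintro p ⟨hp, u, hu⟩
    have h1 := contDiffAt_ringInverse (n := ∞) ℝ u
    rw [hu] at h1
    exact (h1.comp p (hN.contDiffAt (hO.mem_nhds hp))).contDiffWithinAt
  · rintro p ⟨hp, hu⟩ y
    rw [← hT]
    have h2 : Ring.inverse (N p) * N p = 1 := Ring.inverse_mul_cancel _ hu
    exact congrArg (fun f : (Fin n → ℝ) →L[ℝ] (Fin n → ℝ) ↦ f y) h2

end LeftInverse

/-! ### Local frames made of global sections. -/

section Frame

variable {E : Type*} [NormedAddCommGroup E] [NormedSpace ℝ E] [FiniteDimensional ℝ E]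
  {M : Type*} [TopologicalSpace M] [T2Space M] [ChartedSpace E M] [IsManifold 𝓘(ℝ, E) ∞ M]

/-- Dirac structures have local frames made of global sections. -/
theorem DiracStructure.exists_frame (D : DiracStructure E M) (x₀ : M) :
    ∃ U : Set M, IsOpen U ∧ x₀ ∈ U ∧ ∃ σ : Fin (Module.finrank ℝ E) → D.Sec,
      ∀ x ∈ U, LinearIndependent ℝ (fun i ↦ (σ i).toFun x) ∧
        Submodule.span ℝ (Set.range fun i ↦ (σ i).toFun x) = D.fiber x := by
  obtain ⟨U, hU, hx₀, e, he, hspan⟩ := D.subbundle x₀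
  -- Involutivity and the equation `d_D θ = ω_D` speak of global sections only, so the local frame
  -- is multiplied by a bump function equal to `1` near `x₀`.
  obtain ⟨χ, hχ⟩ := (SmoothBumpFunction.nhds_basis_tsupport (I := 𝓘(ℝ, E)) (x₀)).mem_iff.1
    (hU.mem_nhds hx₀)
  obtain ⟨V, hV1, hV, hxV⟩ := eventually_nhds_iff.1 χ.eventuallyEq_one
  refine ⟨U ∩ V, hU.inter hV, ⟨hx₀, hxV⟩, fun i ↦ ⟨fun x ↦ χ x • e i x, ?_, ?_⟩, ?_⟩
  · have h1 := ContMDiffOn.smul_section_of_tsupport (n := ∞) (F := E × (E →L[ℝ] ℝ))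
      (V := fun x : M ↦ GenTangentSpace E x) (s := e i) (ψ := χ)
      (u := U) (I := 𝓘(ℝ, E)) χ.contMDiff.contMDiffOn hU hχ.2 (he i)
    exact h1.contMDiffOn
  · intro x
    by_cases hx : x ∈ U
    · refine Submodule.smul_mem _ _ ?_
      rw [← (hspan x hx).2]
      exact Submodule.subset_span ⟨i, rfl⟩
    · have : χ x = 0 := image_eq_zero_of_notMem_tsupport fun h ↦ hx (hχ.2 h)
      simp only [this, zero_smul]
      exact Submodule.zero_mem _
  · intro x hx
    have h1 : ∀ i, χ x • e i x = e i x := fun i ↦ by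
      have : χ x = 1 := hV1 x hx.2
      rw [this, one_smul]
    simp only [h1]
    exact hspan x hx.1

end Frame

end DiracGeometry

end

noncomputable section

namespace DiracGeometry

/-! ### Reduction of a Dirac structure with a primitive to its coordinate expression. -/

section ChartModel

variable {E : Type*} [NormedAddCommGroup E] [NormedSpace ℝ E]
  {M : Type*} [TopologicalSpace M] [ChartedSpace E M] [IsManifold 𝓘(ℝ, E) ∞ M]

theorem gcoord_sum (x₀ x : M) {n : ℕ} (y : Fin n → ℝ) (e : Fin n → GenTangentSpace E x) :
    gcoord x₀ x (∑ k, y k • e k) = ∑ k, y k • gcoord x₀ x (e k) := by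
  let g : GenTangentSpace E x →ₗ[ℝ] E × (E →L[ℝ] ℝ) :=
    { toFun := gcoord x₀ x
      map_add' := gcoord_add x₀ x
      map_smul' := gcoord_smul x₀ x }
  have h : g (∑ k, y k • e k) = ∑ k, y k • g (e k) := by
    simp only [map_sum, map_smul]
  exact h

/-- `m` is the coordinate expression of the Dirac structure `D` and of `θ` in the chart at `x₀`,
and `L` computes the frame components of the elements of `D`. -/
structure IsChartModel {D : DiracStructure E M} (θ : D.DualSec) (x₀ : M) {n : ℕ}
    (m : LocalModel E n) (L : E → (E × (E →L[ℝ] ℝ)) →L[ℝ] (Fin n → ℝ)) : Prop where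
  subset_target : m.O ⊆ (extChartAt 𝓘(ℝ, E) x₀).target
  smooth_L : ContDiffOn ℝ ∞ L m.O
  L_apply : ∀ p ∈ m.O, ∀ y, L p (m.vec y p, m.covec y p) = y
  exists_mem : ∀ p ∈ m.O, ∀ y, ∃ a ∈ D.fiber ((extChartAt 𝓘(ℝ, E) x₀).symm p),
    gcoord x₀ _ a = (m.vec y p, m.covec y p)
  gcoord_eq : ∀ p ∈ m.O, ∀ a ∈ D.fiber ((extChartAt 𝓘(ℝ, E) x₀).symm p),
    gcoord x₀ _ a = (m.vec (L p (gcoord x₀ _ a)) p, m.covec (L p (gcoord x₀ _ a)) p)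
  prim_eq : ∀ p ∈ m.O, ∀ a : D.fiber ((extChartAt 𝓘(ℝ, E) x₀).symm p),
    θ.toFun _ a = m.prim (L p (gcoord x₀ _ a.1)) p

variable [FiniteDimensional ℝ E] [T2Space M]

theorem exists_isChartModel {D : DiracStructure E M} {θ : D.DualSec} (hprim : θ.IsPrimitive)
    (x₀ : M) : ∃ (m : LocalModel E (Module.finrank ℝ E))
      (L : E → (E × (E →L[ℝ] ℝ)) →L[ℝ] (Fin (Module.finrank ℝ E) → ℝ)),
      extChartAt 𝓘(ℝ, E) x₀ x₀ ∈ m.O ∧ IsChartModel θ x₀ m L := by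
  obtain ⟨U, hU, hx₀, σ, hσ⟩ := D.exists_frame x₀
  have hsm : ∀ k x, ContMDiffAt 𝓘(ℝ, E) (genModel E) ∞
      (fun x ↦ (TotalSpace.mk x ((σ k).toFun x) : GenTangentBundle E M)) x :=
    fun k x ↦ ((σ k).smooth x (mem_univ x)).contMDiffAt Filter.univ_mem
  let φ := extChartAt 𝓘(ℝ, E) x₀
  let O₁ : Set E := φ.target ∩ φ.symm ⁻¹' U
  have hO₁ : IsOpen O₁ :=
    (continuousOn_extChartAt_symm x₀).isOpen_inter_preimage (isOpen_extChartAt_target x₀) hU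
  have hx₀s : x₀ ∈ φ.source := mem_extChartAt_source x₀
  have hp₁ : φ x₀ ∈ O₁ := ⟨φ.map_source hx₀s, by
    show φ.symm (φ x₀) ∈ U
    rw [φ.left_inv hx₀s]; exact hx₀⟩
  have hrep : ∀ k, ContDiffOn ℝ ∞ (localRep x₀ (σ k).toFun) φ.target := by
    intro k p hp
    have h := contDiffAt_localRep (φ.map_target hp) (hsm k (φ.symm p))
    rw [show extChartAt 𝓘(ℝ, E) x₀ (φ.symm p) = p from φ.right_inv hp] at h
    exact h.contDiffWithinAt
  have hli : LinearIndependent ℝ fun k ↦ localRep x₀ (σ k).toFun (φ x₀) := by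
    rw [Fintype.linearIndependent_iff]
    intro y hy
    simp only [φ, localRep_extChart hx₀s, ← gcoord_sum] at hy
    have h0 : gcoord x₀ x₀ (0 : GenTangentSpace E x₀) = 0 := by
      simpa using gcoord_smul x₀ x₀ 0 (0 : GenTangentSpace E x₀)
    exact Fintype.linearIndependent_iff.1 (hσ x₀ hx₀).1 y
      (gcoord_injective hx₀s (hy.trans h0.symm))
  -- `L` is defined on all of `E × E*` but yields frame components only for elements of `D`. Its
  -- smoothness gives that of the structure functions and of the components of paths.
  obtain ⟨O, hOO, hO, hpO, L, hL, hLy⟩ := exists_smooth_leftInverse hO₁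
    (fun k ↦ (hrep k).mono inter_subset_left) hp₁ hli
  have hOt : O ⊆ φ.target := fun p hp ↦ (hOO hp).1
  have hrepO := fun k ↦ (hrep k).mono hOt
  let X : Fin (Module.finrank ℝ E) → E → E := fun k p ↦ (localRep x₀ (σ k).toFun p).1
  let A : Fin (Module.finrank ℝ E) → E → E →L[ℝ] ℝ := fun k p ↦ (localRep x₀ (σ k).toFun p).2
  let Θ : Fin (Module.finrank ℝ E) → E → ℝ :=
    fun k p ↦ θ.toFun (φ.symm p) ((σ k).val (φ.symm p))
  have hsum : ∀ p (y : Fin (Module.finrank ℝ E) → ℝ), gcoord x₀ (φ.symm p) (∑ k, y k • (σ k).toFun (φ.symm p))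
      = (∑ k, y k • X k p, ∑ k, y k • A k p) := by
    intro p y
    rw [gcoord_sum]
    ext1
    · simp only [Prod.fst_sum]; rfl
    · simp only [Prod.snd_sum]; rfl
  have hLv : ∀ p ∈ O, ∀ y : Fin (Module.finrank ℝ E) → ℝ, L p (∑ k, y k • X k p, ∑ k, y k • A k p) = y := by
    intro p hp y
    rw [← hsum, gcoord_sum]
    exact hLy p hp y
  have hfib : ∀ p ∈ O, ∀ a ∈ D.fiber (φ.symm p),
      a = ∑ k, L p (gcoord x₀ _ a) k • (σ k).toFun (φ.symm p) := by
    intro p hp a ha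
    rw [← (hσ (φ.symm p) (hOO hp).2).2, Submodule.mem_span_range_iff_exists_fun] at ha
    obtain ⟨y, rfl⟩ := ha
    rw [hsum, hLv p hp]
  have hθ : ∀ p ∈ O, ∀ a : D.fiber (φ.symm p),
      θ.toFun _ a = ∑ k, L p (gcoord x₀ _ a.1) k * Θ k p := by
    intro p hp a
    have h1 : a = ∑ k, L p (gcoord x₀ _ a.1) k • (σ k).val (φ.symm p) := by
      apply Subtype.ext
      refine (hfib p hp a.1 a.2).trans ?_
      simp only [Submodule.coe_sum, Submodule.coe_smul]
      rfl
    conv_lhs => rw [h1]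
    simp only [map_sum, map_smul, smul_eq_mul]
    rfl
  have hΘ : ∀ k, ContDiffOn ℝ ∞ (Θ k) O := fun k p hp ↦
    ((θ.smooth (σ k) (φ.symm p)).comp p
      (contMDiffAt_extChart_symm (hOt hp))).contDiffAt.contDiffWithinAt
  have hbr : ∀ p ∈ O, ∀ j i, gcoord x₀ _ ((σ j).bracket (σ i) (φ.symm p)).1
      = chartCourant (localRep x₀ (σ j).toFun) (localRep x₀ (σ i).toFun) p := by
    intro p hp j i
    refine (gcoord_courantBracket (φ.map_target (hOt hp)) (hsm j _) (hsm i _)).trans ?_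
    rw [show extChartAt 𝓘(ℝ, E) x₀ (φ.symm p) = p from φ.right_inv (hOt hp)]
  let m : LocalModel E (Module.finrank ℝ E) :=
    { O := O
      X := X
      A := A
      -- By involutivity the bracket lies in `D`, so these are its true frame components.
      C := fun j i k p ↦ L p (chartCourant (localRep x₀ (σ j).toFun) (localRep x₀ (σ i).toFun) p) k
      Θ := Θ
      isOpen := hO
      smooth_X := fun k ↦ (hrepO k).fst
      smooth_A := fun k ↦ (hrepO k).snd
      smooth_C := fun j i k ↦ contDiffOn_pi.1
        (hL.clm_apply (contDiffOn_chartCourant hO (hrepO j) (hrepO i))) k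
      smooth_Θ := hΘ
      bracket_eq := by
        intro p hp j i
        have h1 := hfib p hp _ ((σ j).bracket (σ i) (φ.symm p)).2
        have h2 := congrArg (fun a ↦ (gcoord x₀ (φ.symm p) a).1) h1
        simp only [hsum] at h2
        rw [hbr p hp j i] at h2
        exact h2
      primitive_eq := by
        intro p hp j i
        have hx := φ.map_target (hOt hp)
        have hpp : extChartAt 𝓘(ℝ, E) x₀ (φ.symm p) = p := φ.right_inv (hOt hp)
        have hd : ∀ k (v : TangentSpace 𝓘(ℝ, E) (φ.symm p)),
            mvfderiv 𝓘(ℝ, E) (fun y ↦ θ.toFun y ((σ k).val y)) (φ.symm p) v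
              = fderiv ℝ (Θ k) p (tcoord E x₀ (φ.symm p) v) := by
          intro k v
          have h1 : DifferentiableAt ℝ (Θ k) p :=
            ((hΘ k).contDiffAt (hO.mem_nhds hp)).differentiableAt (by simp)
          have h2 := mvfderiv_eq_fderiv_tcoord (f := fun y ↦ θ.toFun y ((σ k).val y))
            hx (by rw [hpp]; exact h1) v
          rw [hpp] at h2
          exact h2
        have h1 := hprim (σ j) (σ i) (φ.symm p)
        have h2 := D.isotropic (φ.symm p) _ ((σ j).mem _) _ ((σ i).mem _)
        have h3 : ((σ j).toFun (φ.symm p)).2 ((σ i).toFun (φ.symm p)).1 = A j p (X i p) :=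
          (gcoord_snd_apply hx _ _).symm
        unfold DiracStructure.DualSec.dD at h1
        rw [hd, hd, hθ p hp, hbr p hp j i] at h1
        refine h1.trans ?_
        unfold DiracStructure.omega
        unfold pairing at h2
        rw [← h3]
        -- By isotropy the two terms of `ω_D` are opposite, which absorbs the factor `1 / 2`.
        have h4 : ∀ u v : ℝ, u + v = 0 → 1 / 2 * (u - v) = u := by intro u v h; linarith
        exact h4 _ _ h2 }
  refine ⟨m, L, hpO, hOt, hL, hLv, ?_, ?_, hθ⟩
  · intro p hp y
    refine ⟨∑ k, y k • (σ k).toFun (φ.symm p), ?_, hsum p y⟩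
    exact Submodule.sum_mem _ fun k _ ↦ Submodule.smul_mem _ _ ((σ k).mem _)
  · intro p hp a ha
    conv_lhs => rw [hfib p hp a ha]
    exact hsum p _

end ChartModel

end DiracGeometry

end

noncomputable section

namespace DiracGeometry

/-! ### Dirac paths and their variations in a chart. -/

section FirstVariation

variable {E : Type*} [NormedAddCommGroup E] [NormedSpace ℝ E]
  {M : Type*} [TopologicalSpace M] [ChartedSpace E M] [IsManifold 𝓘(ℝ, E) ∞ M]

namespace IsChartModel

variable {D : DiracStructure E M} {θ : D.DualSec} {x₀ : M} {n : ℕ} {m : LocalModel E n}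
  {L : E → (E × (E →L[ℝ] ℝ)) →L[ℝ] (Fin n → ℝ)} (hm : IsChartModel θ x₀ m L)
include hm

theorem exists_mem_extChart {x : M} (hx : x ∈ (extChartAt 𝓘(ℝ, E) x₀).source)
    (hxO : extChartAt 𝓘(ℝ, E) x₀ x ∈ m.O) (y : Fin n → ℝ) : ∃ a ∈ D.fiber x,
    gcoord x₀ x a = (m.vec y (extChartAt 𝓘(ℝ, E) x₀ x), m.covec y (extChartAt 𝓘(ℝ, E) x₀ x)) := by
  have := hm.exists_mem _ hxO y
  rwa [(extChartAt 𝓘(ℝ, E) x₀).left_inv hx] at this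

theorem gcoord_eq_extChart {x : M} (hx : x ∈ (extChartAt 𝓘(ℝ, E) x₀).source)
    (hxO : extChartAt 𝓘(ℝ, E) x₀ x ∈ m.O) {a : GenTangentSpace E x} (ha : a ∈ D.fiber x) :
    gcoord x₀ x a =
      (m.vec (L (extChartAt 𝓘(ℝ, E) x₀ x) (gcoord x₀ x a)) (extChartAt 𝓘(ℝ, E) x₀ x),
      m.covec (L (extChartAt 𝓘(ℝ, E) x₀ x) (gcoord x₀ x a)) (extChartAt 𝓘(ℝ, E) x₀ x)) := by
  have := hm.gcoord_eq _ hxO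
  rw [(extChartAt 𝓘(ℝ, E) x₀).left_inv hx] at this
  exact this a ha

theorem prim_eq_extChart {x : M} (hx : x ∈ (extChartAt 𝓘(ℝ, E) x₀).source)
    (hxO : extChartAt 𝓘(ℝ, E) x₀ x ∈ m.O) (a : D.fiber x) :
    θ.toFun x a = m.prim (L (extChartAt 𝓘(ℝ, E) x₀ x) (gcoord x₀ x a.1))
      (extChartAt 𝓘(ℝ, E) x₀ x) := by
  have := hm.prim_eq _ hxO
  rw [(extChartAt 𝓘(ℝ, E) x₀).left_inv hx] at this
  exact this a

theorem eval_eq_prim {z : GenTangentBundle E M} (hz : z.1 ∈ (extChartAt 𝓘(ℝ, E) x₀).source)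
    (hzO : extChartAt 𝓘(ℝ, E) x₀ z.1 ∈ m.O) (hD : z.2 ∈ D.fiber z.1) :
    θ.eval z = m.prim (L (extChartAt 𝓘(ℝ, E) x₀ z.1) (gcoord x₀ z.1 z.2))
      (extChartAt 𝓘(ℝ, E) x₀ z.1) := by
  unfold DiracStructure.DualSec.eval
  rw [dif_pos hD]
  exact hm.prim_eq_extChart hz hzO _

variable {EN : Type*} [NormedAddCommGroup EN] [NormedSpace ℝ EN] {f : EN → GenTangentBundle E M}
  {s : Set EN} {q : EN}

omit hm in
theorem _root_.DiracGeometry.contDiffWithinAt_extChart_base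
    (hf : ContMDiffWithinAt 𝓘(ℝ, EN) (genModel E) ∞ f s q)
    (hq : (f q).1 ∈ (extChartAt 𝓘(ℝ, E) x₀).source) :
    ContDiffWithinAt ℝ ∞ (fun p ↦ extChartAt 𝓘(ℝ, E) x₀ (f p).1) s q :=
  ((contMDiffAt_extChart hq).comp_contMDiffWithinAt q
    ((contMDiffWithinAt_gen_iff hq).1 hf).1).contDiffWithinAt

theorem contDiffWithinAt_components
    (hf : ContMDiffWithinAt 𝓘(ℝ, EN) (genModel E) ∞ f s q)
    (hq : (f q).1 ∈ (extChartAt 𝓘(ℝ, E) x₀).source)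
    (hqO : extChartAt 𝓘(ℝ, E) x₀ (f q).1 ∈ m.O) :
    ContDiffWithinAt ℝ ∞
      (fun p ↦ L (extChartAt 𝓘(ℝ, E) x₀ (f p).1) (gcoord x₀ (f p).1 (f p).2)) s q :=
  (((hm.smooth_L.contDiffAt (m.isOpen.mem_nhds hqO)).comp_contDiffWithinAt q
    (contDiffWithinAt_extChart_base hf hq))).clm_apply ((contMDiffWithinAt_gen_iff hq).1 hf).2

/-- Smoothness of `θ` is given on sections only; along a map into `D` it follows by writing `θ`
through smooth frame components. Since `eval` is zero off `D`, membership in `D` is needed at all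
points of `s`. -/
theorem contDiffWithinAt_eval (hf : ContMDiffWithinAt 𝓘(ℝ, EN) (genModel E) ∞ f s q)
    (hD : ∀ p ∈ s, (f p).2 ∈ D.fiber (f p).1) (hqs : q ∈ s)
    (hq : (f q).1 ∈ (extChartAt 𝓘(ℝ, E) x₀).source)
    (hqO : extChartAt 𝓘(ℝ, E) x₀ (f q).1 ∈ m.O) :
    ContDiffWithinAt ℝ ∞ (fun p ↦ θ.eval (f p)) s q := by
  have hc := contDiffWithinAt_extChart_base hf hq
  have hy := hm.contDiffWithinAt_components hf hq hqO
  have h1 : ContDiffWithinAt ℝ ∞ (fun p ↦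
      m.prim (L (extChartAt 𝓘(ℝ, E) x₀ (f p).1) (gcoord x₀ (f p).1 (f p).2))
        (extChartAt 𝓘(ℝ, E) x₀ (f p).1)) s q := by
    refine ContDiffWithinAt.sum fun k _ ↦ (contDiffWithinAt_pi.1 hy k).mul ?_
    exact ((m.smooth_Θ k).contDiffAt (m.isOpen.mem_nhds hqO)).comp_contDiffWithinAt q hc
  refine h1.congr_of_eventuallyEq_of_mem ?_ hqs
  have h2 := ((contMDiffWithinAt_gen_iff hq).1 hf).1.continuousWithinAt.eventually
    ((isOpen_extChartAt_source x₀).mem_nhds hq)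
  have h3 := hc.continuousWithinAt.eventually (m.isOpen.mem_nhds hqO)
  filter_upwards [h2, h3, self_mem_nhdsWithin] with p hp1 hp2 hp3
  exact hm.eval_eq_prim hp1 hp2 (hD p hp3)

end IsChartModel

/-- The infinitesimal variation of the base path of a family of paths in `TM ⊕ T*M`. -/
def variationField (Z : ℝ → ℝ → GenTangentBundle E M) (t : ℝ) : TangentSpace 𝓘(ℝ, E) (Z t 0).1 :=
  mfderiv 𝓘(ℝ, ℝ) 𝓘(ℝ, E) (fun σ ↦ (Z t σ).1) 0 (1 : ℝ)

theorem hasDerivAt_extChart_variationField {Z : ℝ → ℝ → GenTangentBundle E M} {t : ℝ} {x₀ : M}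
    (hx : (Z t 0).1 ∈ (extChartAt 𝓘(ℝ, E) x₀).source)
    (h : MDifferentiableAt 𝓘(ℝ, ℝ) 𝓘(ℝ, E) (fun σ ↦ (Z t σ).1) 0) :
    HasDerivAt (fun σ ↦ extChartAt 𝓘(ℝ, E) x₀ (Z t σ).1)
      (tcoord E x₀ (Z t 0).1 (variationField Z t)) 0 := by
  obtain ⟨L, hL, hL1⟩ : ∃ L : ℝ →L[ℝ] E,
      HasFDerivAt (fun σ ↦ extChartAt 𝓘(ℝ, E) x₀ (Z t σ).1) L 0 ∧
      L 1 = tcoord E x₀ (Z t 0).1 (variationField Z t) :=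
    ⟨_, (HasMFDerivAt.comp (g := extChartAt 𝓘(ℝ, E) x₀) (f := fun σ ↦ (Z t σ).1) 0
      (mdifferentiableAt_extChart hx).hasMFDerivAt h.hasMFDerivAt).hasFDerivAt,
      by rw [tcoord_eq_mfderiv hx]; rfl⟩
  rw [← hL1]
  exact hL.hasDerivAt

theorem variationField_eq_zero {Z : ℝ → ℝ → GenTangentBundle E M} {t : ℝ} {x : M}
    (h : MDifferentiableAt 𝓘(ℝ, ℝ) 𝓘(ℝ, E) (fun σ ↦ (Z t σ).1) 0)
    (hc : ∀ᶠ σ in 𝓝 0, (Z t σ).1 = x) : variationField Z t = 0 := by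
  have hx := mem_extChartAt_source (I := 𝓘(ℝ, E)) (Z t 0).1
  have h1 := hasDerivAt_extChart_variationField hx h
  have h2 : (fun σ ↦ extChartAt 𝓘(ℝ, E) (Z t 0).1 (Z t σ).1) =ᶠ[𝓝 0]
      fun _ ↦ extChartAt 𝓘(ℝ, E) (Z t 0).1 x := by
    filter_upwards [hc] with σ hσ
    rw [hσ]
  have h3 := h1.unique ((hasDerivAt_const 0 _).congr_of_eventuallyEq h2)
  rw [← tsymm_tcoord hx (variationField Z t), h3]
  simp

omit [IsManifold 𝓘(ℝ, E) ∞ M] in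
theorem hasDerivAt_comp_variationField {Z : ℝ → ℝ → GenTangentBundle E M} {t : ℝ} {f : M → ℝ}
    (hf : MDifferentiableAt 𝓘(ℝ, E) 𝓘(ℝ, ℝ) f (Z t 0).1)
    (h : MDifferentiableAt 𝓘(ℝ, ℝ) 𝓘(ℝ, E) (fun σ ↦ (Z t σ).1) 0) :
    HasDerivAt (fun σ ↦ f (Z t σ).1) (differential f (Z t 0).1 (variationField Z t)) 0 := by
  obtain ⟨L, hL, hL1⟩ : ∃ L : ℝ →L[ℝ] ℝ, HasFDerivAt (fun σ ↦ f (Z t σ).1) L 0 ∧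
      L 1 = differential f (Z t 0).1 (variationField Z t) :=
    ⟨_, (HasMFDerivAt.comp (g := f) (f := fun σ ↦ (Z t σ).1) 0
      hf.hasMFDerivAt h.hasMFDerivAt).hasFDerivAt, rfl⟩
  rw [← hL1]
  exact hL.hasDerivAt

namespace IsDiracVariation

variable {D : DiracStructure E M} {a b ε : ℝ} {ζ : ℝ → GenTangentBundle E M}
  {Z : ℝ → ℝ → GenTangentBundle E M} (hZ : IsDiracVariation D a b ζ ε Z)
include hZ

theorem mem_fiber {q : ℝ × ℝ} (hq : q ∈ Icc a b ×ˢ Ioo (-ε) ε) :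
    (Z q.1 q.2).2 ∈ D.fiber (Z q.1 q.2).1 :=
  (hZ.diracPath q.2 hq.2).mem q.1 hq.1

theorem contMDiffOn_base :
    ContMDiffOn 𝓘(ℝ, ℝ × ℝ) 𝓘(ℝ, E) ∞ (fun q : ℝ × ℝ ↦ (Z q.1 q.2).1)
      (Icc a b ×ˢ Ioo (-ε) ε) := fun q hq ↦
  ((contMDiffWithinAt_gen_iff (f := fun q : ℝ × ℝ ↦ Z q.1 q.2) (q := q)
    (mem_extChartAt_source (Z q.1 q.2).1)).1 (hZ.smooth q hq)).1

theorem mdifferentiableAt_base (hε : 0 < ε) {t : ℝ} (ht : t ∈ Icc a b) :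
    MDifferentiableAt 𝓘(ℝ, ℝ) 𝓘(ℝ, E) (fun σ ↦ (Z t σ).1) 0 := by
  have h0 : (0 : ℝ) ∈ Ioo (-ε) ε := by simp [hε]
  have h1 : ContMDiffOn 𝓘(ℝ, ℝ) 𝓘(ℝ, ℝ × ℝ) ∞ (fun σ : ℝ ↦ (t, σ)) (Ioo (-ε) ε) :=
    (contDiff_const.prodMk contDiff_id).contMDiff.contMDiffOn
  have h2 : ContMDiffOn 𝓘(ℝ, ℝ) 𝓘(ℝ, E) ∞ (fun σ ↦ (Z t σ).1) (Ioo (-ε) ε) :=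
    hZ.contMDiffOn_base.comp h1 fun σ hσ ↦ ⟨ht, hσ⟩
  exact (h2.contMDiffAt (isOpen_Ioo.mem_nhds h0)).mdifferentiableAt (by simp)

/-- The coordinate results need a product of a nondegenerate closed interval and a symmetric open
one, mapped into one chart. Continuity at `(t₀, 0)` provides it. At the end points of `[a, b]` the
time interval is truncated, but it remains a neighbourhood within `[a, b]`. -/
theorem exists_patch (hab : a < b) (hε : 0 < ε) {t₀ : ℝ} (ht₀ : t₀ ∈ Icc a b) {x₀ : M}
    {O : Set E} (hO : IsOpen O) (hx : (Z t₀ 0).1 ∈ (extChartAt 𝓘(ℝ, E) x₀).source)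
    (hxO : extChartAt 𝓘(ℝ, E) x₀ (Z t₀ 0).1 ∈ O) :
    ∃ a' b' r δ : ℝ, a' < b' ∧ Icc a' b' ⊆ Icc a b ∧ 0 < r ∧ r ≤ ε ∧ 0 < δ ∧
      (∀ t ∈ Icc a b, |t - t₀| < δ → t ∈ Icc a' b') ∧
      ∀ t ∈ Icc a' b', ∀ s ∈ Ioo (-r) r, (Z t s).1 ∈ (extChartAt 𝓘(ℝ, E) x₀).source ∧
        extChartAt 𝓘(ℝ, E) x₀ (Z t s).1 ∈ O := by
  have h0 : (0 : ℝ) ∈ Ioo (-ε) ε := by simp [hε]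
  have h1 := (hZ.contMDiffOn_base (t₀, 0) ⟨ht₀, h0⟩).continuousWithinAt.preimage_mem_nhdsWithin
    (((isOpen_extChartAt_source x₀).mem_nhds hx))
  have h2 := (contDiffWithinAt_extChart_base (hZ.smooth (t₀, 0) ⟨ht₀, h0⟩)
    hx).continuousWithinAt.preimage_mem_nhdsWithin (hO.mem_nhds hxO)
  obtain ⟨δ, hδ, H⟩ := Metric.mem_nhdsWithin_iff.1 (Filter.inter_mem h1 h2)
  refine ⟨max a (t₀ - δ / 2), min b (t₀ + δ / 2), min δ ε, δ / 2, ?_, ?_, by positivity,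
    min_le_right _ _, by positivity, ?_, ?_⟩
  · have := ht₀.1
    have := ht₀.2
    rw [max_lt_iff, lt_min_iff, lt_min_iff]
    refine ⟨⟨hab, ?_⟩, ?_, ?_⟩ <;> linarith
  · exact Icc_subset_Icc (le_max_left _ _) (min_le_left _ _)
  · intro t ht h
    rw [abs_lt] at h
    exact ⟨max_le ht.1 (by linarith), le_min ht.2 (by linarith)⟩
  · intro t ht s hs
    have ht1 := max_le_iff.1 ht.1
    have ht2 := le_min_iff.1 ht.2
    have hs2 : |s| < min δ ε := abs_lt.2 hs
    refine @H (t, s) ⟨?_, ⟨ht1.1, ht2.1⟩, abs_lt.1 (hs2.trans_le (min_le_right _ _))⟩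
    rw [Metric.mem_ball, Prod.dist_eq, max_lt_iff, Real.dist_eq, Real.dist_eq]
    refine ⟨abs_lt.2 ⟨?_, ?_⟩, ?_⟩
    · show -δ < t - t₀
      linarith
    · show t - t₀ < δ
      linarith
    · show |s - 0| < δ
      rw [sub_zero]
      exact hs2.trans_le (min_le_left _ _)

end IsDiracVariation

end FirstVariation

/-! ### The first variation formula. -/

section FirstVariationFormula

variable {E : Type*} [NormedAddCommGroup E] [NormedSpace ℝ E] [FiniteDimensional ℝ E]
  {M : Type*} [TopologicalSpace M] [ChartedSpace E M] [IsManifold 𝓘(ℝ, E) ∞ M] [T2Space M]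
  {D : DiracStructure E M} {a b ε : ℝ} {ζ : ℝ → GenTangentBundle E M}
  {Z : ℝ → ℝ → GenTangentBundle E M}

namespace IsDiracVariation

theorem contDiffOn_eval {θ : D.DualSec} (hprim : θ.IsPrimitive)
    (hZ : IsDiracVariation D a b ζ ε Z) :
    ContDiffOn ℝ ∞ (fun q : ℝ × ℝ ↦ θ.eval (Z q.1 q.2)) (Icc a b ×ˢ Ioo (-ε) ε) := by
  intro q hq
  obtain ⟨m, L, hxO, hm⟩ := exists_isChartModel hprim (Z q.1 q.2).1
  exact hm.contDiffWithinAt_eval (hZ.smooth q hq) (fun p hp ↦ hZ.mem_fiber hp) hq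
    (mem_extChartAt_source _) hxO

omit [FiniteDimensional ℝ E] [T2Space M] in
theorem continuousOn_covector_variationField (hab : a < b) (hε : 0 < ε)
    (hZ : IsDiracVariation D a b ζ ε Z) :
    ContinuousOn (fun t ↦ (Z t 0).2.2 (variationField Z t)) (Icc a b) := by
  intro t₀ ht₀
  have hx := mem_extChartAt_source (I := 𝓘(ℝ, E)) (Z t₀ 0).1
  obtain ⟨a', b', r, δ, hab', hsub, hr, hrε, hδ, hnear, hch⟩ :=
    hZ.exists_patch hab hε ht₀ isOpen_univ hx (mem_univ _)
  have h0 : (0 : ℝ) ∈ Ioo (-r) r := by simp [hr]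
  have hR : Icc a' b' ×ˢ Ioo (-r) r ⊆ Icc a b ×ˢ Ioo (-ε) ε :=
    prod_mono hsub (Ioo_subset_Ioo (by linarith) hrε)
  set φ := extChartAt 𝓘(ℝ, E) (Z t₀ 0).1
  have hc : ContDiffOn ℝ ∞ (fun q : ℝ × ℝ ↦ φ (Z q.1 q.2).1) (Icc a' b' ×ˢ Ioo (-r) r) :=
    fun q hq ↦ (contDiffWithinAt_extChart_base (hZ.smooth q (hR hq)) (hch _ hq.1 _ hq.2).1).mono hR
  have hg : ContDiffOn ℝ ∞ (fun q : ℝ × ℝ ↦ gcoord (Z t₀ 0).1 (Z q.1 q.2).1 (Z q.1 q.2).2)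
      (Icc a' b' ×ˢ Ioo (-r) r) :=
    fun q hq ↦ (((contMDiffWithinAt_gen_iff (f := fun q : ℝ × ℝ ↦ Z q.1 q.2) (q := q) (hch _ hq.1 _ hq.2).1).1
      (hZ.smooth q (hR hq))).2).mono hR
  have h1 : ContinuousOn (fun t ↦ (gcoord (Z t₀ 0).1 (Z t 0).1 (Z t 0).2).2
      (deriv (fun σ ↦ φ (Z t σ).1) 0)) (Icc a' b') :=
    (continuousOn_slice h0 hg.snd.continuousOn).clm_apply
      (continuousOn_slice h0 (continuousOn_deriv_snd hab' (hc.of_le (by simp))))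
  have h2 : ContinuousOn (fun t ↦ (Z t 0).2.2 (variationField Z t)) (Icc a' b') := by
    refine h1.congr fun t ht ↦ ?_
    have h3 := (hch t ht 0 h0).1
    have h5 : deriv (fun σ ↦ φ (Z t σ).1) 0 = tcoord E (Z t₀ 0).1 _ (variationField Z t) :=
      (hasDerivAt_extChart_variationField h3 (hZ.mdifferentiableAt_base hε (hsub ht))).deriv
    simp only [h5]
    exact (gcoord_snd_apply h3 _ _).symm
  have h4 : Icc a' b' ∈ 𝓝[Icc a b] t₀ :=
    Metric.mem_nhdsWithin_iff.2 ⟨δ, hδ, fun t ht ↦ hnear t ht.2 ht.1⟩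
  exact (h2 t₀ (hnear t₀ ht₀ (by simpa using hδ))).mono_of_mem_nhdsWithin h4

omit [FiniteDimensional ℝ E] [T2Space M] in
theorem deriv_comp_base {H : M → ℝ} (hH : ContMDiff 𝓘(ℝ, E) 𝓘(ℝ, ℝ) ∞ H) (hε : 0 < ε)
    (hZ : IsDiracVariation D a b ζ ε Z) {t : ℝ} (ht : t ∈ Icc a b) :
    deriv (fun σ ↦ H (Z t σ).1) 0 = differential H (Z t 0).1 (variationField Z t) :=
  (hasDerivAt_comp_variationField (hH.mdifferentiableAt (by simp))
    (hZ.mdifferentiableAt_base hε ht)).deriv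

omit [FiniteDimensional ℝ E] [T2Space M] in
theorem contDiffOn_comp_base {H : M → ℝ} (hH : ContMDiff 𝓘(ℝ, E) 𝓘(ℝ, ℝ) ∞ H)
    (hZ : IsDiracVariation D a b ζ ε Z) :
    ContDiffOn ℝ 1 (fun q : ℝ × ℝ ↦ H (Z q.1 q.2).1) (Icc a b ×ˢ Ioo (-ε) ε) :=
  (hH.comp_contMDiffOn hZ.contMDiffOn_base).contDiffOn.of_le (by simp)

omit [FiniteDimensional ℝ E] [T2Space M] in
theorem continuousOn_differential_variationField {H : M → ℝ}
    (hH : ContMDiff 𝓘(ℝ, E) 𝓘(ℝ, ℝ) ∞ H) (hab : a < b) (hε : 0 < ε)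
    (hZ : IsDiracVariation D a b ζ ε Z) :
    ContinuousOn (fun t ↦ differential H (Z t 0).1 (variationField Z t)) (Icc a b) := by
  have h0ε : (0 : ℝ) ∈ Ioo (-ε) ε := by simp [hε]
  exact (continuousOn_slice h0ε (continuousOn_deriv_snd hab (hZ.contDiffOn_comp_base hH))).congr
    fun t ht ↦ (hZ.deriv_comp_base hH hε ht).symm

/-- The infinitesimal variation of the base path is tangent to the characteristic distribution,
and the value of the primitive on its lifts is given by an integral. -/
theorem exists_lift {θ : D.DualSec} (hprim : θ.IsPrimitive) (hab : a < b)
    (hε : 0 < ε) (hZ : IsDiracVariation D a b ζ ε Z) {t : ℝ} (ht : t ∈ Icc a b) :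
    ∃ e : D.fiber (Z t 0).1, D.anchor _ e = variationField Z t ∧
      ∫ τ in a..t, (deriv (fun σ ↦ θ.eval (Z τ σ)) 0 + (Z τ 0).2.2 (variationField Z τ))
        = θ.toFun _ e := by
  have h0ε : (0 : ℝ) ∈ Ioo (-ε) ε := by simp [hε]
  have hFc : ContinuousOn (fun τ ↦ deriv (fun σ ↦ θ.eval (Z τ σ)) 0
      + (Z τ 0).2.2 (variationField Z τ)) (Icc a b) :=
    (continuousOn_slice h0ε (continuousOn_deriv_snd hab
      ((hZ.contDiffOn_eval hprim).of_le (by simp)))).add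
      (hZ.continuousOn_covector_variationField hab hε)
  have hFi : ∀ t₁ ∈ Icc a b, ∀ t₂ ∈ Icc a b, IntervalIntegrable
      (fun τ ↦ deriv (fun σ ↦ θ.eval (Z τ σ)) 0 + (Z τ 0).2.2 (variationField Z τ))
      MeasureTheory.volume t₁ t₂ := fun t₁ h₁ t₂ h₂ ↦
    (hFc.mono (uIcc_subset_Icc h₁ h₂)).intervalIntegrable
  have ha : a ∈ Icc a b := ⟨le_rfl, hab.le⟩
  -- The existence of a lift and the value of `θ` on it are propagated together: each chart changes
  -- the lift, and the integral has to follow that same lift. At `a` the base point is fixed and the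
  -- lift is `0`.
  refine propagate_on_Icc (P := fun t ↦ ∃ e : D.fiber (Z t 0).1,
    D.anchor _ e = variationField Z t ∧
      ∫ τ in a..t, (deriv (fun σ ↦ θ.eval (Z τ σ)) 0 + (Z τ 0).2.2 (variationField Z τ))
        = θ.toFun _ e) ht.1 ?_ ?_
  · refine ⟨0, ?_, by simp⟩
    rw [map_zero]
    exact (variationField_eq_zero (x := (ζ a).1) (hZ.mdifferentiableAt_base hε ha)
      (by filter_upwards [isOpen_Ioo.mem_nhds h0ε] using hZ.left_end)).symm
  intro t₀ ht₀
  have ht₀' : t₀ ∈ Icc a b := ⟨ht₀.1, ht₀.2.trans ht.2⟩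
  obtain ⟨m, L, hxO, hm⟩ := exists_isChartModel hprim (Z t₀ 0).1
  have hx := mem_extChartAt_source (I := 𝓘(ℝ, E)) (Z t₀ 0).1
  obtain ⟨a', b', r, δ, hab', hsub, hr, hrε, hδ, hnear, hch⟩ :=
    hZ.exists_patch hab hε ht₀' m.isOpen hx hxO
  have h0 : (0 : ℝ) ∈ Ioo (-r) r := by simp [hr]
  have hRs : Ioo (-r) r ⊆ Ioo (-ε) ε := Ioo_subset_Ioo (by linarith) hrε
  have hR : Icc a' b' ×ˢ Ioo (-r) r ⊆ Icc a b ×ˢ Ioo (-ε) ε := prod_mono hsub hRs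
  set x₀ := (Z t₀ 0).1 with hx₀
  set φ := extChartAt 𝓘(ℝ, E) x₀
  let c : ℝ × ℝ → E := fun q ↦ φ (Z q.1 q.2).1
  let y : ℝ × ℝ → Fin (Module.finrank ℝ E) → ℝ :=
    fun q ↦ L (c q) (gcoord x₀ (Z q.1 q.2).1 (Z q.1 q.2).2)
  have hc : ContDiffOn ℝ ∞ c (Icc a' b' ×ˢ Ioo (-r) r) :=
    fun q hq ↦ (contDiffWithinAt_extChart_base (hZ.smooth q (hR hq)) (hch _ hq.1 _ hq.2).1).mono hR
  have hy : ContDiffOn ℝ ∞ y (Icc a' b' ×ˢ Ioo (-r) r) :=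
    fun q hq ↦ (hm.contDiffWithinAt_components (hZ.smooth q (hR hq)) (hch _ hq.1 _ hq.2).1
      (hch _ hq.1 _ hq.2).2).mono hR
  have hgc : ∀ t ∈ Icc a' b', ∀ s ∈ Ioo (-r) r,
      gcoord x₀ (Z t s).1 (Z t s).2 = (m.vec (y (t, s)) (c (t, s)), m.covec (y (t, s)) (c (t, s))) :=
    fun t ht s hs ↦ hm.gcoord_eq_extChart (hch t ht s hs).1 (hch t ht s hs).2
      (hZ.mem_fiber (hR ⟨ht, hs⟩ : ((t, s) : ℝ × ℝ) ∈ _))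
  have hcy : ∀ t ∈ Icc a' b', ∀ s ∈ Ioo (-r) r,
      HasDerivWithinAt (fun τ ↦ c (τ, s)) (m.vec (y (t, s)) (c (t, s))) (Icc a' b') t := by
    intro t ht s hs
    have hp := hZ.diracPath s (hRs hs)
    have h1 : MDifferentiableWithinAt 𝓘(ℝ, ℝ) 𝓘(ℝ, E) (fun u ↦ (Z u s).1) (Icc a b) t :=
      ((contMDiffWithinAt_gen_iff (f := fun u ↦ Z u s) (q := t) (hch t ht s hs).1).1
        (hp.smooth t (hsub ht))).1.mdifferentiableWithinAt (by simp)
    have h2 := (hasDerivWithinAt_of_velocity (hch t ht s hs).1 h1).mono hsub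
    rw [← hp.anchor_eq t (hsub ht)] at h2
    have h3 := congrArg Prod.fst (hgc t ht s hs)
    rw [← show tcoord E x₀ (Z t s).1 (Z t s).2.1 = m.vec (y (t, s)) (c (t, s)) from h3]
    exact h2
  have hcO : MapsTo c (Icc a' b' ×ˢ Ioo (-r) r) m.O := fun q hq ↦ (hch _ hq.1 _ hq.2).2
  obtain ⟨η, hη, H⟩ := m.exists_transport hr hab' hc hcO hy hcy
  have hv : ∀ t ∈ Icc a' b', deriv (fun σ ↦ c (t, σ)) 0 = tcoord E x₀ _ (variationField Z t) :=
    fun t ht ↦ (hasDerivAt_extChart_variationField (hch t ht 0 h0).1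
      (hZ.mdifferentiableAt_base hε (hsub ht))).deriv
  -- Two times within `η / 2` of `t₀` differ by less than `η`, the step allowed by the transport.
  refine ⟨min δ (η / 2), by positivity, fun t₁ ht₁ t₂ ht₂ h₁ h₂ h12 ↦ ?_⟩
  have hat₁ : t₁ ∈ Icc a b := ⟨ht₁.1, ht₁.2.trans ht.2⟩
  have hat₂ : t₂ ∈ Icc a b := ⟨ht₂.1, ht₂.2.trans ht.2⟩
  have hb₁ := hnear t₁ hat₁ (h₁.trans_le (min_le_left _ _))
  have hb₂ := hnear t₂ hat₂ (h₂.trans_le (min_le_left _ _))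
  have hd : t₂ - t₁ ≤ η := by
    have h3 := (abs_lt.1 (h₁.trans_le (min_le_right _ _))).1
    have h4 := (abs_lt.1 (h₂.trans_le (min_le_right _ _))).2
    linarith
  rintro ⟨e₁, he₁, hI₁⟩
  have hg₁ := hm.gcoord_eq_extChart (hch t₁ hb₁ 0 h0).1 (hch t₁ hb₁ 0 h0).2 e₁.2
  obtain ⟨y₂, hy₂, hI₂⟩ := H t₁ hb₁ t₂ hb₂ h12 hd (L (c (t₁, 0)) (gcoord x₀ _ e₁.1)) (by
    rw [hv t₁ hb₁, ← he₁]
    exact (congrArg Prod.fst hg₁).symm)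
  obtain ⟨e₂, he₂, hg₂⟩ := hm.exists_mem_extChart (hch t₂ hb₂ 0 h0).1 (hch t₂ hb₂ 0 h0).2 y₂
  refine ⟨⟨e₂, he₂⟩, ?_, ?_⟩
  · have h3 : tcoord E x₀ _ e₂.1 = tcoord E x₀ _ (variationField Z t₂) := by
      rw [← hv t₂ hb₂, ← hy₂]
      exact congrArg Prod.fst hg₂
    have h4 := congrArg (tsymm E x₀ (Z t₂ 0).1) h3
    rw [tsymm_tcoord (hch t₂ hb₂ 0 h0).1, tsymm_tcoord (hch t₂ hb₂ 0 h0).1] at h4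
    exact h4
  · rw [← intervalIntegral.integral_add_adjacent_intervals (hFi a ha t₁ hat₁)
      (hFi t₁ hat₁ t₂ hat₂), hI₁]
    have h3 : ∫ τ in t₁..t₂, (deriv (fun σ ↦ θ.eval (Z τ σ)) 0
        + (Z τ 0).2.2 (variationField Z τ))
        = ∫ t in t₁..t₂, (deriv (fun σ ↦ m.prim (y (t, σ)) (c (t, σ))) 0
            + m.covec (y (t, 0)) (c (t, 0)) (deriv (fun σ ↦ c (t, σ)) 0)) := by
      refine intervalIntegral.integral_congr fun τ hτ ↦ ?_
      rw [uIcc_of_le h12] at hτ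
      have hτ' : τ ∈ Icc a' b' := ⟨hb₁.1.trans hτ.1, hτ.2.trans hb₂.2⟩
      have h4 : (fun σ ↦ θ.eval (Z τ σ)) =ᶠ[𝓝 0] fun σ ↦ m.prim (y (τ, σ)) (c (τ, σ)) := by
        filter_upwards [isOpen_Ioo.mem_nhds h0] with σ hσ
        exact hm.eval_eq_prim (hch τ hτ' σ hσ).1 (hch τ hτ' σ hσ).2
          (hZ.mem_fiber (hR ⟨hτ', hσ⟩ : ((τ, σ) : ℝ × ℝ) ∈ _))
      have h5 : (Z τ 0).2.2 (variationField Z τ)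
          = m.covec (y (τ, 0)) (c (τ, 0)) (deriv (fun σ ↦ c (τ, σ)) 0) := by
        rw [hv τ hτ', ← gcoord_snd_apply (hch τ hτ' 0 h0).1, hgc τ hτ' 0 h0]
      simp only [h4.deriv_eq, h5]
    have hθ₁ := hm.prim_eq_extChart (hch t₁ hb₁ 0 h0).1 (hch t₁ hb₁ 0 h0).2 e₁
    have hθ₂ := hm.prim_eq_extChart (hch t₂ hb₂ 0 h0).1 (hch t₂ hb₂ 0 h0).2 ⟨e₂, he₂⟩
    rw [h3, hI₂, hθ₁, hθ₂, hg₂, hm.L_apply _ (hch t₂ hb₂ 0 h0).2]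
    exact add_sub_cancel _ _

/-- The first variation formula. -/
theorem hasDerivAt_action {θ : D.DualSec} (hθ : θ.IsHorizontal) (hprim : θ.IsPrimitive)
    {H : M → ℝ} (hH : ContMDiff 𝓘(ℝ, E) 𝓘(ℝ, ℝ) ∞ H) (hab : a < b)
    (hε : 0 < ε) (hZ : IsDiracVariation D a b ζ ε Z) :
    HasDerivAt (fun s ↦ action a b θ H (fun t ↦ Z t s))
      (∫ t in a..b, (differential H (Z t 0).1 (variationField Z t)
        - (Z t 0).2.2 (variationField Z t))) 0 := by
  have h0ε : (0 : ℝ) ∈ Ioo (-ε) ε := by simp [hε]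
  have ha : a ∈ Icc a b := ⟨le_rfl, hab.le⟩
  have hb : b ∈ Icc a b := ⟨hab.le, le_rfl⟩
  have hE := hZ.contDiffOn_eval hprim
  have hE1 : ContDiffOn ℝ 1 (fun q : ℝ × ℝ ↦ θ.eval (Z q.1 q.2)) (Icc a b ×ˢ Ioo (-ε) ε) :=
    hE.of_le (by simp)
  have hH1 := hZ.contDiffOn_comp_base hH
  have h1 := hasDerivAt_integral_snd hε hab (hE1.add hH1) ha hb
  refine h1.congr_deriv ?_
  obtain ⟨e, he, hI⟩ := hZ.exists_lift hprim hab hε hb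
  have hvb : variationField Z b = 0 :=
    variationField_eq_zero (x := (ζ b).1) (hZ.mdifferentiableAt_base hε hb)
      (by filter_upwards [isOpen_Ioo.mem_nhds h0ε] using hZ.right_end)
  -- The transported lift at `b` lies over the zero vector without having to vanish; this is where
  -- horizontality of `θ` enters.
  rw [hθ.1 _ e (he.trans hvb)] at hI
  have hαc := hZ.continuousOn_covector_variationField hab hε
  have hEd := continuousOn_slice h0ε (continuousOn_deriv_snd hab hE1)
  have hHd := hZ.continuousOn_differential_variationField hH hab hε
  -- The term `α(v)` is added and subtracted, so that the first bracket is the integrand of `hI`,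
  -- whose total integral is zero.
  have h2 : ∀ t ∈ Icc a b, deriv (fun σ ↦ θ.eval (Z t σ) + H (Z t σ).1) 0
      = (deriv (fun σ ↦ θ.eval (Z t σ)) 0 + (Z t 0).2.2 (variationField Z t))
        + (differential H (Z t 0).1 (variationField Z t)
          - (Z t 0).2.2 (variationField Z t)) := by
    intro t ht
    refine ((deriv_snd_of_contDiffOn hE1 ht h0ε).add
      (deriv_snd_of_contDiffOn hH1 ht h0ε)).deriv.trans ?_
    show deriv (fun σ ↦ θ.eval (Z t σ)) 0 + deriv (fun σ ↦ H (Z t σ).1) 0 = _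
    rw [hZ.deriv_comp_base hH hε ht]
    ring
  rw [intervalIntegral.integral_congr (g := fun t ↦
      (deriv (fun σ ↦ θ.eval (Z t σ)) 0 + (Z t 0).2.2 (variationField Z t))
        + (differential H (Z t 0).1 (variationField Z t)
          - (Z t 0).2.2 (variationField Z t))) (fun t ht ↦ h2 t (uIcc_of_le hab.le ▸ ht)),
    intervalIntegral.integral_add, hI, zero_add]
  · exact ((uIcc_of_le hab.le).symm ▸ hEd.add hαc :
      ContinuousOn _ (uIcc a b)).intervalIntegrable
  · exact ((uIcc_of_le hab.le).symm ▸ hHd.sub hαc :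
      ContinuousOn _ (uIcc a b)).intervalIntegrable

end IsDiracVariation

end FirstVariationFormula

end DiracGeometry

end

noncomputable section

namespace DiracGeometry

/-! ### Construction of variations in coordinates. -/

section CoordinateVariation

variable {E : Type*} [NormedAddCommGroup E] [NormedSpace ℝ E] {n : ℕ}

namespace LocalModel

variable (m : LocalModel E n)

/-- The vector field whose flow lifts the flow of `X i` to the Dirac structure. -/
def liftField (i : Fin n) (q : E × (Fin n → ℝ)) : E × (Fin n → ℝ) :=
  (m.X i q.1, fun k ↦ -∑ j, m.C i j k q.1 * q.2 j)

theorem contDiffOn_liftField (i : Fin n) : ContDiffOn ℝ ∞ (m.liftField i) (m.O ×ˢ univ) := by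
  have h1 : ContDiffOn ℝ ∞ (fun q : E × (Fin n → ℝ) ↦ q.1) (m.O ×ˢ univ) := contDiffOn_fst
  have h2 : MapsTo (fun q : E × (Fin n → ℝ) ↦ q.1) (m.O ×ˢ univ) m.O := fun q hq ↦ hq.1
  refine ((m.smooth_X i).comp h1 h2).prodMk (contDiffOn_pi.2 fun k ↦ ?_)
  refine (ContDiffOn.sum fun j _ ↦ ((m.smooth_C i j k).comp h1 h2).mul ?_).neg
  exact contDiffOn_pi.1 contDiffOn_snd j

/-- Infinitesimal form of the invariance of `ċ = ∑ y_k X_k(c)` under the lifted flow: the left side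
is the derivative of `∑ y_k X_k` along the lifted field, the right side the linearization of `X i`
applied to `ċ`. The choice of `-C` in `liftField` makes them agree. -/
theorem liftField_vec (i : Fin n) {q : E × (Fin n → ℝ)} (hq : q.1 ∈ m.O) :
    m.vec (m.liftField i q).2 q.1 + ∑ k, q.2 k • fderiv ℝ (m.X k) q.1 (m.X i q.1)
      = fderiv ℝ (m.X i) q.1 (m.vec q.2 q.1) := by
  have h1 : m.vec (m.liftField i q).2 q.1
      = -∑ j, q.2 j • ∑ k, m.C i j k q.1 • m.X k q.1 := by
    simp only [vec, liftField, neg_smul, Finset.sum_smul, Finset.smul_sum, smul_smul,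
      Finset.sum_neg_distrib]
    rw [Finset.sum_comm]
    simp only [mul_comm]
  rw [h1]
  simp only [← m.bracket_eq q.1 hq i, vec, map_sum, map_smul, smul_sub, Finset.sum_sub_distrib]
  abel

variable [CompleteSpace E]

/-- The flow of the lifted vector field preserves the anchor condition. -/
theorem deriv_flow_eq_vec {i : Fin n} {Fl : ℝ × (E × (Fin n → ℝ)) → E × (Fin n → ℝ)}
    {p : E × (Fin n → ℝ)} {ε : ℝ}
    (hFl : ContDiffOn ℝ ∞ Fl (Metric.ball (0, p) ε))
    (hO : ∀ q ∈ Metric.ball ((0 : ℝ), p) ε, (Fl q).1 ∈ m.O)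
    (h0 : ∀ x ∈ Metric.ball p ε, Fl (0, x) = x)
    (hd : ∀ q ∈ Metric.ball ((0 : ℝ), p) ε,
      HasDerivAt (fun s ↦ Fl (s, q.2)) (m.liftField i (Fl q)) q.1)
    {c : ℝ → E} {y : ℝ → Fin n → ℝ} {V : Set ℝ} (hV : IsOpen V)
    (hc : ContDiffOn ℝ ∞ c V) (hy : ContDiffOn ℝ ∞ y V)
    (hcy : ∀ t ∈ V, HasDerivAt c (m.vec (y t) (c t)) t)
    (hVp : ∀ t ∈ V, (c t, y t) ∈ Metric.ball p ε) {t s τ : ℝ} (ht : t ∈ V) (hs : |s| < ε)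
    (hτ : τ ∈ Icc (0 : ℝ) 1) :
    deriv (fun u ↦ (Fl (τ * s, (c (t + u), y (t + u)))).1) 0
      = m.vec (Fl (τ * s, (c t, y t))).2 (Fl (τ * s, (c t, y t))).1 := by
  -- Flow time is written `τ * s` with `τ ∈ [0, 1]`, so both signs of `s` are treated at once. The
  -- derivative of the flowed curve and the vector given by the flowed components, as functions of
  -- `τ`, solve one linear equation with one initial value.
  obtain ⟨r, hr, hrV⟩ := Metric.isOpen_iff.1 hV t ht
  have hR0 : (0 : ℝ) ∈ Ioo (-r) r := by simp [hr]
  have htu : ∀ u ∈ Ioo (-r) r, t + u ∈ V := fun u hu ↦ hrV (by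
    rw [Metric.mem_ball, Real.dist_eq, add_sub_cancel_left]; exact abs_lt.2 hu)
  have hball : ∀ τ ∈ Icc (0 : ℝ) 1, ∀ u ∈ Ioo (-r) r,
      ((τ * s, (c (t + u), y (t + u))) : ℝ × (E × (Fin n → ℝ))) ∈ Metric.ball (0, p) ε := by
    intro τ hτ u hu
    rw [Metric.mem_ball, Prod.dist_eq, max_lt_iff]
    refine ⟨?_, hVp _ (htu u hu)⟩
    rw [Real.dist_eq, sub_zero, abs_mul, abs_of_nonneg hτ.1]
    exact (mul_le_of_le_one_left (abs_nonneg s) hτ.2).trans_lt hs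
  have hshift : ContDiffOn ℝ ∞ (fun q : ℝ × ℝ ↦ t + q.2) (Icc 0 1 ×ˢ Ioo (-r) r) :=
    contDiffOn_const.add contDiffOn_snd
  have hshiftV : MapsTo (fun q : ℝ × ℝ ↦ t + q.2) (Icc 0 1 ×ˢ Ioo (-r) r) V :=
    fun q hq ↦ htu _ hq.2
  have hG : ContDiffOn ℝ ∞ (fun q : ℝ × ℝ ↦ Fl (q.1 * s, (c (t + q.2), y (t + q.2))))
      (Icc 0 1 ×ˢ Ioo (-r) r) :=
    hFl.comp ((contDiffOn_fst.mul contDiffOn_const).prodMk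
      ((hc.comp hshift hshiftV).prodMk (hy.comp hshift hshiftV))) fun q hq ↦ hball _ hq.1 _ hq.2
  let cc : ℝ × ℝ → E := fun q ↦ (Fl (q.1 * s, (c (t + q.2), y (t + q.2)))).1
  let ff : ℝ × ℝ → E := fun q ↦ s • m.X i (cc q)
  have hcc : ContDiffOn ℝ ∞ cc (Icc 0 1 ×ˢ Ioo (-r) r) := hG.fst
  have hccO : MapsTo cc (Icc 0 1 ×ˢ Ioo (-r) r) m.O := fun q hq ↦ hO _ (hball _ hq.1 _ hq.2)
  have hff : ContDiffOn ℝ ∞ ff (Icc 0 1 ×ˢ Ioo (-r) r) :=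
    contDiffOn_const.smul ((m.smooth_X i).comp hcc hccO)
  have hflow : ∀ τ ∈ Icc (0 : ℝ) 1, ∀ u ∈ Ioo (-r) r,
      HasDerivWithinAt (fun τ ↦ Fl (τ * s, (c (t + u), y (t + u))))
        (s • m.liftField i (Fl (τ * s, (c (t + u), y (t + u))))) (Icc 0 1) τ := by
    intro τ hτ u hu
    have h1 := hd _ (hball τ hτ u hu)
    have h2 : HasDerivAt (fun τ : ℝ ↦ τ * s) s τ := by simpa using (hasDerivAt_id τ).mul_const s
    exact (HasDerivAt.scomp τ h1 h2).hasDerivWithinAt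
  have hw := fun τ (hτ : τ ∈ Icc (0 : ℝ) 1) ↦ hasDerivWithinAt_deriv_snd hr zero_lt_one
    (hcc.of_le (by simp)) (hff.of_le (by simp)) (fun τ hτ u hu ↦ (hflow τ hτ u hu).fst) hτ
  have hXd : ∀ k, ∀ q ∈ m.O, HasFDerivAt (m.X k) (fderiv ℝ (m.X k) q) q := fun k q hq ↦
    (((m.smooth_X k).contDiffAt (m.isOpen.mem_nhds hq)).differentiableAt (by simp)).hasFDerivAt
  let A : ℝ → E →L[ℝ] E := fun τ ↦ s • fderiv ℝ (m.X i) (cc (τ, 0))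
  have hA : ContinuousOn A (Icc 0 1) := by
    have h1 : ContinuousOn (fderiv ℝ (m.X i)) m.O :=
      ((m.smooth_X i).fderiv_of_isOpen m.isOpen (m := ∞) (by simp)).continuousOn
    exact (h1.comp (continuousOn_slice hR0 hcc.continuousOn)
      fun τ hτ ↦ hccO ⟨hτ, hR0⟩).const_smul s
  have hw' : ∀ τ ∈ Icc (0 : ℝ) 1, HasDerivWithinAt (fun τ ↦ deriv (fun u ↦ cc (τ, u)) 0)
      (A τ (deriv (fun u ↦ cc (τ, u)) 0) + 0) (Icc 0 1) τ := by
    intro τ hτ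
    have h1 := deriv_snd_of_contDiffOn (hcc.of_le (by simp)) hτ hR0
    have h2 : HasDerivAt (fun u ↦ ff (τ, u))
        (s • fderiv ℝ (m.X i) (cc (τ, 0)) (deriv (fun u ↦ cc (τ, u)) 0)) 0 :=
      ((hXd i _ (hccO ⟨hτ, hR0⟩)).comp_hasDerivAt 0 h1).const_smul s
    rw [add_zero]
    exact (hw τ hτ).congr_deriv h2.deriv
  let yy : ℝ → Fin n → ℝ := fun τ ↦ (Fl (τ * s, (c (t + 0), y (t + 0)))).2
  have hu : ∀ τ ∈ Icc (0 : ℝ) 1, HasDerivWithinAt (fun τ ↦ m.vec (yy τ) (cc (τ, 0)))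
      (A τ (m.vec (yy τ) (cc (τ, 0))) + 0) (Icc 0 1) τ := by
    intro τ hτ
    have hO' := hccO (⟨hτ, hR0⟩ : ((τ, 0) : ℝ × ℝ) ∈ Icc (0 : ℝ) 1 ×ˢ Ioo (-r) r)
    have h1 := hflow τ hτ 0 hR0
    have h2 : ∀ k, HasDerivWithinAt (fun τ ↦ yy τ k)
        (s * (m.liftField i (Fl (τ * s, (c (t + 0), y (t + 0))))).2 k) (Icc 0 1) τ := fun k ↦
      hasDerivWithinAt_pi.1 h1.snd k
    have h3 : HasDerivWithinAt (fun τ ↦ m.vec (yy τ) (cc (τ, 0)))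
        (∑ k, (yy τ k • fderiv ℝ (m.X k) (cc (τ, 0)) (s • m.X i (cc (τ, 0)))
          + (s * (m.liftField i (Fl (τ * s, (c (t + 0), y (t + 0))))).2 k) • m.X k (cc (τ, 0))))
        (Icc 0 1) τ :=
      HasDerivWithinAt.fun_sum fun k _ ↦ (h2 k).smul
        ((hXd k _ hO').comp_hasDerivWithinAt τ h1.fst)
    convert! h3 using 1
    rw [add_zero]
    have h4 := m.liftField_vec i (q := Fl (τ * s, (c (t + 0), y (t + 0)))) hO'
    have h5 : A τ (m.vec (yy τ) (cc (τ, 0))) = s • fderiv ℝ (m.X i) (cc (τ, 0))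
      (m.vec (yy τ) (cc (τ, 0))) := rfl
    rw [h5]
    refine (congrArg (fun v ↦ s • v) h4.symm).trans ?_
    simp only [vec, smul_add, Finset.smul_sum, map_smul, Finset.sum_add_distrib, smul_smul]
    rw [add_comm]
    simp only [mul_comm s]
    rfl
  have h00 : (0 : ℝ) ∈ Icc (0 : ℝ) 1 := by simp
  have hinit : deriv (fun u ↦ cc (0, u)) 0 = m.vec (yy 0) (cc (0, 0)) := by
    have h1 : (fun u ↦ cc (0, u)) =ᶠ[𝓝 0] fun u ↦ c (t + u) := by
      filter_upwards [isOpen_Ioo.mem_nhds hR0] with u hu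
      simp only [cc, zero_mul]
      rw [h0 _ (hVp _ (htu u hu))]
    have h2 : HasDerivAt (fun u ↦ c (t + u)) (m.vec (y t) (c t)) 0 := by
      have := hcy (t + 0) (htu 0 hR0)
      simpa using HasDerivAt.comp_const_add t 0 this
    rw [h1.deriv_eq, h2.deriv]
    simp only [yy, cc, zero_mul, add_zero]
    rw [h0 _ (hVp _ ht)]
  have h := linear_ode_unique hA hw' hu hinit hτ
  simpa [cc, yy] using h

omit [CompleteSpace E] in
/-- Variations of a path in coordinates along a vector field of the frame. -/
theorem exists_variation (i : Fin n) [FiniteDimensional ℝ E] {c : ℝ → E} {y : ℝ → Fin n → ℝ}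
    {U : Set ℝ} (hU : IsOpen U) {t₀ : ℝ} (ht₀ : t₀ ∈ U)
    (hc : ContDiffOn ℝ ∞ c U) (hy : ContDiffOn ℝ ∞ y U) (hcO : c t₀ ∈ m.O)
    (hcy : ∀ t ∈ U, HasDerivAt c (m.vec (y t) (c t)) t) :
    ∃ δ > 0, ∃ ε > 0, Metric.ball t₀ δ ⊆ U ∧ ∀ η : ℝ → ℝ, ContDiff ℝ ∞ η →
      (∀ t, η t ∈ Icc (0 : ℝ) 1) → ∃ (c' : ℝ × ℝ → E) (y' : ℝ × ℝ → Fin n → ℝ),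
        ContDiffOn ℝ ∞ c' (Metric.ball t₀ δ ×ˢ Ioo (-ε) ε) ∧
        ContDiffOn ℝ ∞ y' (Metric.ball t₀ δ ×ˢ Ioo (-ε) ε) ∧
        MapsTo c' (Metric.ball t₀ δ ×ˢ Ioo (-ε) ε) m.O ∧
        (∀ t ∈ Metric.ball t₀ δ, ∀ s ∈ Ioo (-ε) ε,
          HasDerivAt (fun τ ↦ c' (τ, s)) (m.vec (y' (t, s)) (c' (t, s))) t) ∧
        (∀ t ∈ Metric.ball t₀ δ, ∀ s, s * η t = 0 → s * deriv η t = 0 →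
          c' (t, s) = c t ∧ y' (t, s) = y t) ∧
        ∀ t ∈ Metric.ball t₀ δ, HasDerivAt (fun σ ↦ c' (t, σ)) (η t • m.X i (c t)) 0 := by
  obtain ⟨Fl, ε, hε, hFl, hO, h0, hd⟩ := exists_smooth_local_flow
    (m.isOpen.prod isOpen_univ) (m.contDiffOn_liftField i)
    (⟨hcO, mem_univ _⟩ : (c t₀, y t₀) ∈ m.O ×ˢ univ)
  have hz : ContinuousOn (fun t ↦ (c t, y t)) U := hc.continuousOn.prodMk hy.continuousOn
  obtain ⟨δ, hδ, hball⟩ := Metric.isOpen_iff.1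
    (hz.isOpen_inter_preimage hU (Metric.isOpen_ball (x := (c t₀, y t₀)) (ε := ε))) t₀
    ⟨ht₀, Metric.mem_ball_self hε⟩
  have hVU : Metric.ball t₀ δ ⊆ U := fun t ht ↦ (hball ht).1
  refine ⟨δ, hδ, ε, hε, hVU, fun η hη hη1 ↦ ?_⟩
  have hq : ∀ t ∈ Metric.ball t₀ δ, ∀ s ∈ Ioo (-ε) ε,
      ((η t * s, (c t, y t)) : ℝ × (E × (Fin n → ℝ))) ∈ Metric.ball (0, (c t₀, y t₀)) ε := by
    intro t ht s hs
    rw [Metric.mem_ball, Prod.dist_eq, max_lt_iff]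
    refine ⟨?_, (hball ht).2⟩
    rw [Real.dist_eq, sub_zero, abs_mul, abs_of_nonneg (hη1 t).1]
    exact (mul_le_of_le_one_left (abs_nonneg s) (hη1 t).2).trans_lt (abs_lt.2 hs)
  have hfst : MapsTo (fun q : ℝ × ℝ ↦ q.1) (Metric.ball t₀ δ ×ˢ Ioo (-ε) ε) U :=
    fun q hq ↦ hVU hq.1
  have hG : ContDiffOn ℝ ∞ (fun q : ℝ × ℝ ↦ Fl (η q.1 * q.2, (c q.1, y q.1)))
      (Metric.ball t₀ δ ×ˢ Ioo (-ε) ε) :=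
    hFl.comp (((hη.comp_contDiffOn contDiffOn_fst).mul contDiffOn_snd).prodMk
      ((hc.comp contDiffOn_fst hfst).prodMk (hy.comp contDiffOn_fst hfst)))
      fun q hq' ↦ hq _ hq'.1 _ hq'.2
  have hη' : ContDiff ℝ ∞ (deriv η) := (contDiff_infty_iff_deriv.1 hη).2
  -- When the flow time `η(t) s` depends on `t`, the base velocity gains `s η'(t) X i`. The extra
  -- multiple of the `i`-th basis vector in the components restores the anchor condition.
  refine ⟨fun q ↦ (Fl (η q.1 * q.2, (c q.1, y q.1))).1,
    fun q ↦ (Fl (η q.1 * q.2, (c q.1, y q.1))).2 + (q.2 * deriv η q.1) • Pi.single i (1 : ℝ),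
    hG.fst, hG.snd.add (((contDiffOn_snd.mul
      (hη'.comp_contDiffOn contDiffOn_fst))).smul contDiffOn_const),
    fun q hq' ↦ (hO _ (hq _ hq'.1 _ hq'.2)).1, ?_, ?_, ?_⟩
  · intro t ht s hs
    have hqt := hq t ht s hs
    have hFd := ((hFl.contDiffAt (Metric.isOpen_ball.mem_nhds hqt)).differentiableAt
      (by simp)).hasFDerivAt
    set Λ := fderiv ℝ Fl (η t * s, (c t, y t))
    have hyd : HasDerivAt y (deriv y t) t :=
      ((hy.contDiffAt (hU.mem_nhds (hVU ht))).differentiableAt (by simp)).hasDerivAt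
    have hηd : HasDerivAt η (deriv η t) t := (hη.differentiable (by simp) t).hasDerivAt
    have hzd := (hcy t (hVU ht)).prodMk hyd
    have h1 := hasFDerivAt_fst.comp_hasDerivAt t
      (hFd.comp_hasDerivAt t ((hηd.mul_const s).prodMk hzd))
    -- The derivative of the flow is split into its time direction, which gives the lifted field,
    -- and its space direction, computed in `deriv_flow_eq_vec`.
    have h2 : Λ (1, 0) = m.liftField i (Fl (η t * s, (c t, y t))) := by
      have h3 : HasDerivAt (fun σ : ℝ ↦ (σ, (c t, y t))) ((1 : ℝ), (0 : E × (Fin n → ℝ))) (η t * s) :=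
        (hasDerivAt_id _).prodMk (hasDerivAt_const _ _)
      exact (hFd.comp_hasDerivAt (η t * s) h3).unique (hd _ hqt)
    have h4 : (Λ (0, (m.vec (y t) (c t), deriv y t))).1
        = m.vec (Fl (η t * s, (c t, y t))).2 (Fl (η t * s, (c t, y t))).1 := by
      rw [← m.deriv_flow_eq_vec hFl (fun q hq ↦ (hO q hq).1) h0 hd Metric.isOpen_ball
        (hc.mono hVU) (hy.mono hVU) (fun t ht ↦ hcy t (hVU ht)) (fun t ht ↦ (hball ht).2) ht
        (abs_lt.2 hs) (hη1 t)]
      have hz0 : HasDerivAt (fun u ↦ (c (t + u), y (t + u))) (m.vec (y t) (c t), deriv y t) 0 :=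
        HasDerivAt.comp_const_add (f := fun t ↦ (c t, y t)) t 0 (by rwa [add_zero])
      have h5 : HasDerivAt (fun u : ℝ ↦ (η t * s, (c (t + u), y (t + u))))
          ((0 : ℝ), (m.vec (y t) (c t), deriv y t)) 0 := (hasDerivAt_const _ _).prodMk hz0
      have hFd' : HasFDerivAt Fl Λ (η t * s, (c (t + 0), y (t + 0))) := by rwa [add_zero]
      exact (hasFDerivAt_fst.comp_hasDerivAt (0 : ℝ)
        (hFd'.comp_hasDerivAt (0 : ℝ) h5)).deriv.symm
    refine h1.congr_deriv ?_
    have h6 : ((deriv η t * s, (m.vec (y t) (c t), deriv y t)) : ℝ × (E × (Fin n → ℝ)))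
        = (deriv η t * s) • ((1 : ℝ), (0 : E × (Fin n → ℝ)))
          + (0, (m.vec (y t) (c t), deriv y t)) := by
      ext <;> simp
    rw [h6, map_add, map_smul, ContinuousLinearMap.coe_fst', Prod.fst_add, h4, h2]
    simp only [vec, liftField, Prod.smul_fst, Pi.add_apply, Pi.smul_apply, add_smul,
      Finset.sum_add_distrib, smul_eq_mul]
    rw [add_comm]
    congr 1
    rw [Finset.sum_eq_single i]
    · simp [mul_comm]
    · intro k _ hk
      simp [hk]
    · simp
  · intro t ht s h1 h2
    have h3 : Fl (η t * s, (c t, y t)) = (c t, y t) := by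
      rw [mul_comm, h1]
      exact h0 _ (hball ht).2
    simp only [h3, h2]
    simp
  · intro t ht
    have h00 : (0 : ℝ) ∈ Ioo (-ε) ε := by simp [hε]
    have h1 := hd _ (hq t ht 0 h00)
    have h2 : HasDerivAt (fun σ : ℝ ↦ η t * σ) (η t) 0 := by
      simpa using (hasDerivAt_id (0 : ℝ)).const_mul (η t)
    have h3 := hasFDerivAt_fst.comp_hasDerivAt (0 : ℝ) (HasDerivAt.scomp (0 : ℝ) h1 h2)
    refine h3.congr_deriv ?_
    rw [mul_zero, h0 _ (hball ht).2]
    rfl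

end LocalModel

end CoordinateVariation

end DiracGeometry

end

noncomputable section

namespace DiracGeometry

/-! ### Maximality of isotropic subspaces of half dimension. -/

section Lagrangian

/-- The pairing on `E × E*` is nondegenerate, so the orthogonal of `W` has dimension `2 dim E - dim
E`. It contains `W`, which has the same dimension, and hence equals it. -/
theorem mem_of_isotropic {E : Type*} [NormedAddCommGroup E] [NormedSpace ℝ E]
    [FiniteDimensional ℝ E] (W : Submodule ℝ (E × (E →L[ℝ] ℝ)))
    (hW : Module.finrank ℝ W = Module.finrank ℝ E)
    (hiso : ∀ a ∈ W, ∀ b ∈ W, a.2 b.1 + b.2 a.1 = 0) {a : E × (E →L[ℝ] ℝ)}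
    (ha : ∀ b ∈ W, a.2 b.1 + b.2 a.1 = 0) : a ∈ W := by
  let B : LinearMap.BilinForm ℝ (E × (E →L[ℝ] ℝ)) := LinearMap.mk₂ ℝ
    (fun a b ↦ a.2 b.1 + b.2 a.1)
    (fun a a' b ↦ by simp; ring) (fun c a b ↦ by simp; ring)
    (fun a b b' ↦ by simp; ring) (fun c a b ↦ by simp; ring)
  have hB : ∀ a b, B a b = a.2 b.1 + b.2 a.1 := fun a b ↦ rfl
  have hrefl : B.IsRefl := fun a b h ↦ by rw [hB] at h ⊢; linarith
  have hnd : B.Nondegenerate := by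
    refine hrefl.nondegenerate_iff_separatingLeft.2 ?_
    intro a h
    have h2 : a.2 = 0 := by
      ext w
      simpa [hB] using h (w, 0)
    have h1 : a.1 = 0 := by
      by_contra hne
      obtain ⟨f, -, hf⟩ := exists_dual_vector ℝ a.1 (norm_ne_zero_iff.2 hne)
      have := h (0, f)
      rw [hB] at this
      simp [hf] at this
      exact hne this
    exact Prod.ext h1 h2
  have hle : W ≤ B.orthogonal W := fun a ha b hb ↦ hiso b hb a ha
  have hfr := LinearMap.BilinForm.finrank_orthogonal hnd W
  have hdual : Module.finrank ℝ (E →L[ℝ] ℝ) = Module.finrank ℝ E := by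
    rw [← (LinearMap.toContinuousLinearMap (𝕜 := ℝ) (E := E) (F' := ℝ)).finrank_eq]
    exact Subspace.dual_finrank_eq
  rw [Module.finrank_prod, hdual, hW] at hfr
  have heq := Submodule.eq_of_le_of_finrank_eq hle (by omega)
  rw [heq]
  intro b hb
  show B b a = 0
  rw [hB]
  linarith [ha b hb]

end Lagrangian

/-! ### From coordinates back to the bundle, and the canonical lift of a Hamiltonian curve. -/

section GenOfCoord

variable {E : Type*} [NormedAddCommGroup E] [NormedSpace ℝ E]
  {M : Type*} [TopologicalSpace M] [ChartedSpace E M] [IsManifold 𝓘(ℝ, E) ∞ M]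

/-- The element of `TM ⊕ T*M` with given coordinates in the preferred chart at `x₀`. -/
def genOfCoord (x₀ : M) (p : E) (w : E × (E →L[ℝ] ℝ)) : GenTangentBundle E M :=
  ⟨(extChartAt 𝓘(ℝ, E) x₀).symm p, (tsymm E x₀ _ w.1, w.2.comp (tcoord E x₀ _))⟩

theorem gcoord_genOfCoord {x₀ : M} {p : E} (hp : p ∈ (extChartAt 𝓘(ℝ, E) x₀).target)
    (w : E × (E →L[ℝ] ℝ)) :
    gcoord x₀ (genOfCoord x₀ p w).1 (genOfCoord x₀ p w).2 = w := by
  have hx := (extChartAt 𝓘(ℝ, E) x₀).map_target hp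
  refine Prod.ext (tcoord_tsymm hx _) ?_
  ext v
  exact congrArg w.2 (tcoord_tsymm hx v)

theorem gen_ext {x₀ : M} {z z' : GenTangentBundle E M} (h : z.1 = z'.1)
    (hz : z.1 ∈ (extChartAt 𝓘(ℝ, E) x₀).source)
    (hg : gcoord x₀ z.1 z.2 = gcoord x₀ z'.1 z'.2) : z = z' := by
  obtain ⟨x, v⟩ := z
  obtain ⟨x', v'⟩ := z'
  obtain rfl : x = x' := h
  exact congrArg _ (gcoord_injective hz hg)

theorem genOfCoord_gcoord {x₀ : M} {z : GenTangentBundle E M}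
    (hz : z.1 ∈ (extChartAt 𝓘(ℝ, E) x₀).source) :
    genOfCoord x₀ (extChartAt 𝓘(ℝ, E) x₀ z.1) (gcoord x₀ z.1 z.2) = z := by
  have h1 : (extChartAt 𝓘(ℝ, E) x₀).symm (extChartAt 𝓘(ℝ, E) x₀ z.1) = z.1 :=
    (extChartAt 𝓘(ℝ, E) x₀).left_inv hz
  exact (gen_ext h1.symm hz (gcoord_genOfCoord ((extChartAt 𝓘(ℝ, E) x₀).map_source hz) _).symm).symm

theorem IsChartModel.genOfCoord_mem {D : DiracStructure E M} {θ : D.DualSec} {x₀ : M} {n : ℕ}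
    {m : LocalModel E n} {L : E → (E × (E →L[ℝ] ℝ)) →L[ℝ] (Fin n → ℝ)}
    (hm : IsChartModel θ x₀ m L) {p : E} (hp : p ∈ m.O) (y : Fin n → ℝ) :
    (genOfCoord x₀ p (m.vec y p, m.covec y p)).2
      ∈ D.fiber (genOfCoord x₀ p (m.vec y p, m.covec y p)).1 := by
  obtain ⟨a, ha, hg⟩ := hm.exists_mem p hp y
  have h := gcoord_injective ((extChartAt 𝓘(ℝ, E) x₀).map_target (hm.subset_target hp))
    (hg.trans (gcoord_genOfCoord (hm.subset_target hp) _).symm)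
  exact h ▸ ha

theorem contMDiffWithinAt_genOfCoord {EN : Type*} [NormedAddCommGroup EN] [NormedSpace ℝ EN]
    {x₀ : M} {f : EN → E} {g : EN → E × (E →L[ℝ] ℝ)} {s : Set EN} {q : EN}
    (hf : ContDiffWithinAt ℝ ∞ f s q) (hg : ContDiffWithinAt ℝ ∞ g s q)
    (hq : f q ∈ (extChartAt 𝓘(ℝ, E) x₀).target) :
    ContMDiffWithinAt 𝓘(ℝ, EN) (genModel E) ∞ (fun p ↦ genOfCoord x₀ (f p) (g p)) s q := by
  rw [contMDiffWithinAt_gen_iff (x₀ := x₀) ((extChartAt 𝓘(ℝ, E) x₀).map_target hq)]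
  refine ⟨(contMDiffAt_extChart_symm hq).comp_contMDiffWithinAt q hf.contMDiffWithinAt, ?_⟩
  refine hg.congr_of_eventuallyEq ?_ (gcoord_genOfCoord hq _)
  filter_upwards [hf.continuousWithinAt.eventually ((isOpen_extChartAt_target x₀).mem_nhds hq)]
    with p hp using gcoord_genOfCoord hp _

/-- The backward direction uses uniqueness of derivatives within `[a, b]`, end points included,
which holds because the segment is nondegenerate. -/
theorem anchor_eq_velocity_iff {a b : ℝ} (hab : a < b) {ζ : ℝ → GenTangentBundle E M} {t : ℝ}
    (ht : t ∈ Icc a b) (hζ : ContMDiffWithinAt 𝓘(ℝ, ℝ) (genModel E) ∞ ζ (Icc a b) t) {x₀ : M}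
    (hx : (ζ t).1 ∈ (extChartAt 𝓘(ℝ, E) x₀).source) :
    (ζ t).2.1 = velocity a b (fun u ↦ (ζ u).1) t ↔
      HasDerivWithinAt (fun τ ↦ extChartAt 𝓘(ℝ, E) x₀ (ζ τ).1)
        (gcoord x₀ (ζ t).1 (ζ t).2).1 (Icc a b) t := by
  have h1 := hasDerivWithinAt_of_velocity (c := fun u ↦ (ζ u).1) hx
    (((contMDiffWithinAt_gen_iff hx).1 hζ).1.mdifferentiableWithinAt (by simp))
  constructor
  · intro h
    rw [← h] at h1
    exact h1
  · intro h
    have h2 := (uniqueDiffOn_Icc hab t ht).eq_deriv _ h h1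
    have h3 := congrArg (tsymm E x₀ (ζ t).1) h2
    exact (tsymm_tcoord hx (ζ t).2.1).symm.trans (h3.trans (tsymm_tcoord hx _))

theorem IsHamiltonianCurve.congr {D : DiracStructure E M} {a b : ℝ} {H : M → ℝ} {γ γ' : ℝ → M}
    (h : IsHamiltonianCurve D a b H γ) (hγ : ∀ t ∈ Icc a b, γ t = γ' t) :
    IsHamiltonianCurve D a b H γ' := by
  intro t ht
  -- All tangent spaces are the model space `E` as types, so velocities at propositionally equal
  -- base points can be compared without a cast.
  have key : ∀ (x x' : M) (v v' : E), x = x' → v = v' →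
      ((v, differential H x) : GenTangentSpace E x) ∈ D.fiber x →
      ((v', differential H x') : GenTangentSpace E x') ∈ D.fiber x' := by
    rintro x x' v v' rfl rfl h
    exact h
  refine key _ _ _ _ (hγ t ht) ?_ (h t ht)
  have h2 := mfderivWithin_congr (I := 𝓘(ℝ, ℝ)) (I' := 𝓘(ℝ, E)) hγ (hγ t ht)
  exact congrArg (fun L : ℝ →L[ℝ] E ↦ L 1) h2

/-- The coordinate expression of `dH - α`, for an element `(v, α)` of `TM ⊕ T*M`. -/
def defect (H : M → ℝ) (x₀ : M) (z : GenTangentBundle E M) : E →L[ℝ] ℝ :=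
  fderiv ℝ (fun p ↦ H ((extChartAt 𝓘(ℝ, E) x₀).symm p)) (extChartAt 𝓘(ℝ, E) x₀ z.1)
    - (gcoord x₀ z.1 z.2).2

variable {H : M → ℝ} (hH : ContMDiff 𝓘(ℝ, E) 𝓘(ℝ, ℝ) ∞ H)
include hH

theorem contDiffAt_comp_extChart_symm {x₀ : M} {p : E}
    (hp : p ∈ (extChartAt 𝓘(ℝ, E) x₀).target) :
    ContDiffAt ℝ ∞ (fun p ↦ H ((extChartAt 𝓘(ℝ, E) x₀).symm p)) p :=
  ((hH _).comp p (contMDiffAt_extChart_symm hp)).contDiffAt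

theorem differential_eq_fderiv {x₀ x : M} (hx : x ∈ (extChartAt 𝓘(ℝ, E) x₀).source)
    (v : TangentSpace 𝓘(ℝ, E) x) :
    differential H x v = fderiv ℝ (fun p ↦ H ((extChartAt 𝓘(ℝ, E) x₀).symm p))
      (extChartAt 𝓘(ℝ, E) x₀ x) (tcoord E x₀ x v) :=
  mvfderiv_eq_fderiv_tcoord hx ((contDiffAt_comp_extChart_symm hH
    ((extChartAt 𝓘(ℝ, E) x₀).map_source hx)).differentiableAt (by simp)) v

theorem defect_tcoord {x₀ : M} {z : GenTangentBundle E M}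
    (hz : z.1 ∈ (extChartAt 𝓘(ℝ, E) x₀).source) (v : TangentSpace 𝓘(ℝ, E) z.1) :
    defect H x₀ z (tcoord E x₀ z.1 v) = differential H z.1 v - z.2.2 v := by
  rw [differential_eq_fderiv hH hz, ← gcoord_snd_apply hz]
  rfl

theorem continuousWithinAt_defect {x₀ : M} {f : ℝ → GenTangentBundle E M} {s : Set ℝ} {t : ℝ}
    (hf : ContMDiffWithinAt 𝓘(ℝ, ℝ) (genModel E) ∞ f s t)
    (hx : (f t).1 ∈ (extChartAt 𝓘(ℝ, E) x₀).source) :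
    ContinuousWithinAt (fun τ ↦ defect H x₀ (f τ)) s t := by
  have h1 := ((contDiffAt_comp_extChart_symm hH
    ((extChartAt 𝓘(ℝ, E) x₀).map_source hx)).fderiv_right (m := ∞) (by simp)).continuousAt
  exact (ContinuousAt.comp_continuousWithinAt (f := fun τ ↦ extChartAt 𝓘(ℝ, E) x₀ (f τ).1) h1
    (contDiffWithinAt_extChart_base hf hx).continuousWithinAt).sub
    ((contMDiffWithinAt_gen_iff hx).1 hf).2.continuousWithinAt.snd

/-- A Hamiltonian curve has a canonical lift to a Dirac path. -/
theorem IsHamiltonianCurve.isDiracPathOver {D : DiracStructure E M} {a b : ℝ} (hab : a < b)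
    {γ : ℝ → M} (hγ : ContMDiffOn 𝓘(ℝ, ℝ) 𝓘(ℝ, E) ∞ γ (Icc a b))
    (h : IsHamiltonianCurve D a b H γ) :
    IsDiracPathOver D a b γ fun t ↦ ⟨γ t, (velocity a b γ t, differential H (γ t))⟩ := by
  refine ⟨⟨fun t ht ↦ ?_, fun t ht ↦ h t ht, fun t _ ↦ rfl⟩, fun t _ ↦ rfl⟩
  have hx := mem_extChartAt_source (I := 𝓘(ℝ, E)) (γ t)
  rw [contMDiffWithinAt_gen_iff (x₀ := γ t) hx]
  refine ⟨hγ t ht, ?_⟩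
  have hc : ContDiffWithinAt ℝ ∞ (fun τ ↦ extChartAt 𝓘(ℝ, E) (γ t) (γ τ)) (Icc a b) t :=
    ((contMDiffAt_extChart hx).comp_contMDiffWithinAt t (hγ t ht)).contDiffWithinAt
  have h1 : ContDiffWithinAt ℝ ∞ (fun τ ↦
      fderivWithin ℝ (fun τ ↦ extChartAt 𝓘(ℝ, E) (γ t) (γ τ)) (Icc a b) τ 1) (Icc a b) t :=
    (hc.fderivWithin_right (uniqueDiffOn_Icc hab) (m := ∞) (by simp) ht).clm_apply
      contDiffWithinAt_const
  have h2 : ContDiffWithinAt ℝ ∞ (fun τ ↦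
      fderiv ℝ (fun p ↦ H ((extChartAt 𝓘(ℝ, E) (γ t)).symm p))
        (extChartAt 𝓘(ℝ, E) (γ t) (γ τ))) (Icc a b) t :=
    ContDiffAt.comp_contDiffWithinAt (f := fun τ ↦ extChartAt 𝓘(ℝ, E) (γ t) (γ τ)) t
      ((contDiffAt_comp_extChart_symm hH
      ((extChartAt 𝓘(ℝ, E) (γ t)).map_source hx)).fderiv_right (m := ∞) (by simp)) hc
  refine (h1.prodMk h2).congr_of_eventuallyEq_of_mem ?_ ht
  filter_upwards [(hγ t ht).continuousWithinAt.eventually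
    ((isOpen_extChartAt_source (γ t)).mem_nhds hx), self_mem_nhdsWithin] with τ hτ hτ'
  refine Prod.ext ?_ ?_
  · have h3 := hasDerivWithinAt_of_velocity hτ
      ((hγ τ hτ').mdifferentiableWithinAt (by simp))
    have h4 := h3.hasFDerivWithinAt.fderivWithin (uniqueDiffOn_Icc hab τ hτ')
    show tcoord E (γ t) (γ τ) (velocity a b γ τ) = fderivWithin ℝ _ _ _ _
    rw [h4]
    simp
  · ext w
    refine (differential_eq_fderiv hH hτ _).trans ?_
    exact congrArg (fderiv ℝ (fun p ↦ H ((extChartAt 𝓘(ℝ, E) (γ t)).symm p))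
      (extChartAt 𝓘(ℝ, E) (γ t) (γ τ))) (tcoord_tsymm hτ w)

end GenOfCoord

end DiracGeometry

end

noncomputable section

namespace DiracGeometry

/-! ### Gluing a coordinate variation into a Dirac path. -/

section GlobalVariation

variable {E : Type*} [NormedAddCommGroup E] [NormedSpace ℝ E] [FiniteDimensional ℝ E]
  {M : Type*} [TopologicalSpace M] [ChartedSpace E M] [IsManifold 𝓘(ℝ, E) ∞ M]
  {D : DiracStructure E M} {a b : ℝ} {ζ : ℝ → GenTangentBundle E M} {θ : D.DualSec} {x₀ : M}
  {n : ℕ} {m : LocalModel E n} {L : E → (E × (E →L[ℝ] ℝ)) →L[ℝ] (Fin n → ℝ)}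

/-- Dirac paths have variations which are supported near a given time and tangent to a given
vector field of a frame. -/
theorem exists_isDiracVariation (hab : a < b) (hζ : IsDiracPath D a b ζ)
    (hm : IsChartModel θ x₀ m L) {t₀ : ℝ} (ht₀ : t₀ ∈ Ioo a b)
    (hx : (ζ t₀).1 ∈ (extChartAt 𝓘(ℝ, E) x₀).source)
    (hxO : extChartAt 𝓘(ℝ, E) x₀ (ζ t₀).1 ∈ m.O) (i : Fin n) :
    ∃ δ > 0, ∃ ε > 0, (∀ t ∈ Metric.ball t₀ δ, t ∈ Ioo a b ∧
        (ζ t).1 ∈ (extChartAt 𝓘(ℝ, E) x₀).source) ∧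
      ∀ η : ℝ → ℝ, ContDiff ℝ ∞ η → (∀ t, η t ∈ Icc (0 : ℝ) 1) → tsupport η ⊆ Metric.ball t₀ δ →
        ∃ Z, IsDiracVariation D a b ζ ε Z ∧
          (∀ t ∈ Metric.ball t₀ δ, tcoord E x₀ (Z t 0).1 (variationField Z t)
            = η t • m.X i (extChartAt 𝓘(ℝ, E) x₀ (Z t 0).1)) ∧
          ∀ t ∈ Icc a b, t ∉ Metric.ball t₀ δ → variationField Z t = 0 := by
  set φ := extChartAt 𝓘(ℝ, E) x₀ with hφ
  have hbase : ContinuousOn (fun t ↦ (ζ t).1) (Ioo a b) := fun t ht ↦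
    ((contMDiffWithinAt_gen_iff (mem_extChartAt_source (I := 𝓘(ℝ, E)) (ζ t).1)).1
      (hζ.smooth t (Ioo_subset_Icc_self ht))).1.continuousWithinAt.mono Ioo_subset_Icc_self
  have hU : IsOpen (Ioo a b ∩ (fun t ↦ (ζ t).1) ⁻¹' (φ.source ∩ φ ⁻¹' m.O)) :=
    hbase.isOpen_inter_preimage isOpen_Ioo ((continuousOn_extChartAt x₀).isOpen_inter_preimage
      (isOpen_extChartAt_source x₀) m.isOpen)
  set U := Ioo a b ∩ (fun t ↦ (ζ t).1) ⁻¹' (φ.source ∩ φ ⁻¹' m.O) with hUdef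
  have hUI : U ⊆ Icc a b := fun t ht ↦ Ioo_subset_Icc_self ht.1
  let c : ℝ → E := fun t ↦ φ (ζ t).1
  let y : ℝ → Fin n → ℝ := fun t ↦ L (c t) (gcoord x₀ (ζ t).1 (ζ t).2)
  have hc : ContDiffOn ℝ ∞ c U := fun t ht ↦
    (contDiffWithinAt_extChart_base (hζ.smooth t (hUI ht)) ht.2.1).mono hUI
  have hy : ContDiffOn ℝ ∞ y U := fun t ht ↦
    (hm.contDiffWithinAt_components (hζ.smooth t (hUI ht)) ht.2.1 ht.2.2).mono hUI
  have hg : ∀ t ∈ U, gcoord x₀ (ζ t).1 (ζ t).2 = (m.vec (y t) (c t), m.covec (y t) (c t)) :=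
    fun t ht ↦ hm.gcoord_eq_extChart ht.2.1 ht.2.2 (hζ.mem t (hUI ht))
  have hcy : ∀ t ∈ U, HasDerivAt c (m.vec (y t) (c t)) t := fun t ht ↦ by
    have h1 := (anchor_eq_velocity_iff hab (hUI ht) (hζ.smooth t (hUI ht)) ht.2.1).1
      (hζ.anchor_eq t (hUI ht))
    rw [hg t ht] at h1
    exact h1.hasDerivAt (Icc_mem_nhds ht.1.1 ht.1.2)
  obtain ⟨δ, hδ, ε, hε, hball, hvar⟩ := m.exists_variation i hU ⟨ht₀, hx, hxO⟩ hc hy hxO hcy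
  refine ⟨δ, hδ, ε, hε, fun t ht ↦ ⟨(hball ht).1, (hball ht).2.1⟩, fun η hη hη1 hsupp ↦ ?_⟩
  obtain ⟨c', y', hc', hy', hcO', hcy', heq, hd⟩ := hvar η hη hη1
  classical
  let w : ℝ × ℝ → E × (E →L[ℝ] ℝ) := fun q ↦ (m.vec (y' q) (c' q), m.covec (y' q) (c' q))
  have hw : ContDiffOn ℝ ∞ w (Metric.ball t₀ δ ×ˢ Ioo (-ε) ε) :=
    (ContDiffOn.sum fun k _ ↦ (contDiffOn_pi.1 hy' k).smul ((m.smooth_X k).comp hc' hcO')).prodMk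
      (ContDiffOn.sum fun k _ ↦ (contDiffOn_pi.1 hy' k).smul ((m.smooth_A k).comp hc' hcO'))
  -- Off the closed support of `η` both branches equal `ζ`. The ball and the complement of the
  -- support are open and cover the line, so every local property of `Z` can be checked on one of
  -- the two.
  let Z : ℝ → ℝ → GenTangentBundle E M := fun t s ↦
    if t ∈ Metric.ball t₀ δ then genOfCoord x₀ (c' (t, s)) (w (t, s)) else ζ t
  have hZV : ∀ t ∈ Metric.ball t₀ δ, ∀ s, Z t s = genOfCoord x₀ (c' (t, s)) (w (t, s)) :=
    fun t ht s ↦ if_pos ht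
  have hζV : ∀ t ∈ Metric.ball t₀ δ, ζ t = genOfCoord x₀ (c t) (m.vec (y t) (c t),
      m.covec (y t) (c t)) := fun t ht ↦ by
    rw [← hg t (hball ht)]
    exact (genOfCoord_gcoord (hball ht).2.1).symm
  have hZeq : ∀ t ∈ Metric.ball t₀ δ, ∀ s, s * η t = 0 → s * deriv η t = 0 → Z t s = ζ t := by
    intro t ht s h1 h2
    obtain ⟨h3, h4⟩ := heq t ht s h1 h2
    rw [hZV t ht, hζV t ht]
    simp only [w, h3, h4]
  have hZc : ∀ t, t ∉ tsupport η → ∀ s, Z t s = ζ t := by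
    intro t ht s
    by_cases htV : t ∈ Metric.ball t₀ δ
    · have h1 := notMem_tsupport_iff_eventuallyEq.1 ht
      refine hZeq t htV s ?_ ?_
      · rw [h1.eq_of_nhds]; simp
      · rw [h1.deriv_eq]; simp
    · exact if_neg htV
  have hcases : ∀ t, t ∈ Metric.ball t₀ δ ∨ t ∉ tsupport η := fun t ↦ by
    by_cases h : t ∈ tsupport η
    · exact Or.inl (hsupp h)
    · exact Or.inr h
  have hopen : IsOpen (tsupport η)ᶜ := (isClosed_tsupport η).isOpen_compl
  have hVε : IsOpen (Metric.ball t₀ δ ×ˢ Ioo (-ε) ε) := Metric.isOpen_ball.prod isOpen_Ioo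
  have hctar : ∀ t ∈ Metric.ball t₀ δ, ∀ s ∈ Ioo (-ε) ε, c' (t, s) ∈ φ.target :=
    fun t ht s hs ↦ hm.subset_target (hcO' ⟨ht, hs⟩)
  have hsmooth : ContMDiffOn 𝓘(ℝ, ℝ × ℝ) (genModel E) ∞ (fun p : ℝ × ℝ ↦ Z p.1 p.2)
      (Icc a b ×ˢ Ioo (-ε) ε) := by
    rintro ⟨t, s⟩ ⟨ht, hs⟩
    rcases hcases t with htV | htS
    · have h1 : ((t, s) : ℝ × ℝ) ∈ Metric.ball t₀ δ ×ˢ Ioo (-ε) ε := ⟨htV, hs⟩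
      have h2 := contMDiffWithinAt_genOfCoord (s := Icc a b ×ˢ Ioo (-ε) ε)
        (hc'.contDiffAt (hVε.mem_nhds h1)).contDiffWithinAt
        (hw.contDiffAt (hVε.mem_nhds h1)).contDiffWithinAt (hctar t htV s hs)
      refine h2.congr_of_eventuallyEq ?_ (hZV t htV s)
      filter_upwards [mem_nhdsWithin_of_mem_nhds (hVε.mem_nhds h1)] with q hq
      exact hZV q.1 hq.1 q.2
    · have h2 : ContMDiffOn 𝓘(ℝ, ℝ × ℝ) (genModel E) ∞ (fun q : ℝ × ℝ ↦ ζ q.1)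
          (Icc a b ×ˢ Ioo (-ε) ε) :=
        hζ.smooth.comp contDiff_fst.contMDiff.contMDiffOn fun q hq ↦ hq.1
      refine (h2 (t, s) ⟨ht, hs⟩).congr_of_eventuallyEq ?_ (hZc t htS s)
      filter_upwards [mem_nhdsWithin_of_mem_nhds
        ((hopen.preimage continuous_fst).mem_nhds (show (t, s).1 ∈ (tsupport η)ᶜ from htS))]
        with q hq
      exact hZc q.1 hq q.2
  have hpath : ∀ s ∈ Ioo (-ε) ε, IsDiracPath D a b (fun t ↦ Z t s) := by
    intro s hs
    have hsm : ContMDiffOn 𝓘(ℝ, ℝ) (genModel E) ∞ (fun t ↦ Z t s) (Icc a b) :=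
      hsmooth.comp (f := fun t : ℝ ↦ (t, s))
        (contDiff_id.prodMk contDiff_const).contMDiff.contMDiffOn fun t ht ↦ ⟨ht, hs⟩
    refine ⟨hsm, fun t ht ↦ ?_, fun t ht ↦ ?_⟩
    · show (Z t s).2 ∈ D.fiber (Z t s).1
      rcases hcases t with htV | htS
      · rw [hZV t htV]
        exact hm.genOfCoord_mem (hcO' ⟨htV, hs⟩) _
      · rw [hZc t htS]
        exact hζ.mem t ht
    · rcases hcases t with htV | htS
      · have hsrc : (Z t s).1 ∈ φ.source := by
          rw [hZV t htV]
          exact φ.map_target (hctar t htV s hs)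
        refine (anchor_eq_velocity_iff (ζ := fun t ↦ Z t s) hab ht (hsm t ht) hsrc).2 ?_
        have h1 : gcoord x₀ (Z t s).1 (Z t s).2 = w (t, s) := by
          rw [hZV t htV]
          exact gcoord_genOfCoord (hctar t htV s hs) _
        have h2 : (fun τ ↦ φ (Z τ s).1) =ᶠ[𝓝 t] fun τ ↦ c' (τ, s) := by
          filter_upwards [Metric.isOpen_ball.mem_nhds htV] with τ hτ
          rw [hZV τ hτ]
          exact φ.right_inv (hctar τ hτ s hs)
        show HasDerivWithinAt (fun τ ↦ φ (Z τ s).1) (gcoord x₀ (Z t s).1 (Z t s).2).1 (Icc a b) t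
        rw [h1]
        exact ((hcy' t htV s hs).congr_of_eventuallyEq h2).hasDerivWithinAt
      · have hsrc := mem_extChartAt_source (I := 𝓘(ℝ, E)) (ζ t).1
        refine (anchor_eq_velocity_iff (ζ := fun t ↦ Z t s) (x₀ := (ζ t).1) hab ht (hsm t ht)
          (by simp only [hZc t htS s]; exact hsrc)).2 ?_
        have h1 := (anchor_eq_velocity_iff hab ht (hζ.smooth t ht) hsrc).1 (hζ.anchor_eq t ht)
        show HasDerivWithinAt (fun τ ↦ extChartAt 𝓘(ℝ, E) (ζ t).1 (Z τ s).1)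
          (gcoord (ζ t).1 (Z t s).1 (Z t s).2).1 (Icc a b) t
        rw [hZc t htS s]
        refine (h1.congr_of_eventuallyEq ?_ (by rw [hZc t htS s]))
        filter_upwards [mem_nhdsWithin_of_mem_nhds (hopen.mem_nhds htS)] with τ hτ
        rw [hZc τ hτ]
  have hZζ : ∀ t, t ∉ Metric.ball t₀ δ → ∀ s, Z t s = ζ t := fun t ht s ↦ if_neg ht
  have hna : a ∉ Metric.ball t₀ δ := fun h ↦ lt_irrefl _ (hball h).1.1
  have hnb : b ∉ Metric.ball t₀ δ := fun h ↦ lt_irrefl _ (hball h).1.2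
  have hZ : IsDiracVariation D a b ζ ε Z :=
    { smooth := hsmooth
      initial := fun t _ ↦ by
        by_cases htV : t ∈ Metric.ball t₀ δ
        · exact hZeq t htV 0 (zero_mul _) (zero_mul _)
        · exact hZζ t htV 0
      diracPath := hpath
      left_end := fun s _ ↦ by rw [hZζ a hna]
      right_end := fun s _ ↦ by rw [hZζ b hnb] }
  have h0 : (0 : ℝ) ∈ Ioo (-ε) ε := by simpa using hε
  refine ⟨Z, hZ, fun t ht ↦ ?_, fun t htI ht ↦ ?_⟩
  · have hZ0 : Z t 0 = ζ t := hZ.initial t (hUI (hball ht))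
    have h1 := hasDerivAt_extChart_variationField (x₀ := x₀) (Z := Z) (t := t)
      (by rw [hZ0]; exact (hball ht).2.1) (hZ.mdifferentiableAt_base hε (hUI (hball ht)))
    have h2 : (fun σ ↦ φ (Z t σ).1) =ᶠ[𝓝 0] fun σ ↦ c' (t, σ) := by
      filter_upwards [isOpen_Ioo.mem_nhds h0] with σ hσ
      rw [hZV t ht]
      exact φ.right_inv (hctar t ht σ hσ)
    have h3 := h1.unique ((hd t ht).congr_of_eventuallyEq h2)
    rw [h3, hZ0]
  · refine variationField_eq_zero (x := (ζ t).1) (hZ.mdifferentiableAt_base hε htI) ?_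
    exact Filter.Eventually.of_forall fun σ ↦ by rw [hZζ t ht]

end GlobalVariation

/-! ### Critical Dirac paths and Hamiltonian curves. -/

section Critical

variable {E : Type*} [NormedAddCommGroup E] [NormedSpace ℝ E] [FiniteDimensional ℝ E]
  {M : Type*} [TopologicalSpace M] [ChartedSpace E M] [IsManifold 𝓘(ℝ, E) ∞ M] [T2Space M]
  {D : DiracStructure E M} {a b : ℝ} {ζ : ℝ → GenTangentBundle E M} {θ : D.DualSec} {x₀ : M}
  {n : ℕ} {m : LocalModel E n} {L : E → (E × (E →L[ℝ] ℝ)) →L[ℝ] (Fin n → ℝ)} {H : M → ℝ}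

/-- The fundamental lemma of the calculus of variations. For the variation with field `η X i` the
first variation is `∫ η g`, with `g = (dH - α)(X i)`. If `g t₀ ≠ 0`, a bump `η` supported where `g`
keeps its sign makes this integral nonzero. -/
theorem IsCritical.defect_eq_zero (hH : ContMDiff 𝓘(ℝ, E) 𝓘(ℝ, ℝ) ∞ H) (hθ : θ.IsHorizontal)
    (hprim : θ.IsPrimitive) (hab : a < b) (hζ : IsDiracPath D a b ζ)
    (hcrit : IsCritical a b θ H ζ) (hm : IsChartModel θ x₀ m L) {t₀ : ℝ} (ht₀ : t₀ ∈ Ioo a b)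
    (hx : (ζ t₀).1 ∈ (extChartAt 𝓘(ℝ, E) x₀).source)
    (hxO : extChartAt 𝓘(ℝ, E) x₀ (ζ t₀).1 ∈ m.O) (i : Fin n) :
    defect H x₀ (ζ t₀) (m.X i (extChartAt 𝓘(ℝ, E) x₀ (ζ t₀).1)) = 0 := by
  by_contra hne
  obtain ⟨δ, hδ, ε, hε, hball, hvar⟩ := exists_isDiracVariation hab hζ hm ht₀ hx hxO i
  let g : ℝ → ℝ := fun t ↦ defect H x₀ (ζ t) (m.X i (extChartAt 𝓘(ℝ, E) x₀ (ζ t).1))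
  have hI : Icc a b ∈ 𝓝 t₀ := Icc_mem_nhds ht₀.1 ht₀.2
  have hg : ContinuousAt g t₀ := by
    have h1 := hζ.smooth t₀ (Ioo_subset_Icc_self ht₀)
    have h2 := (continuousWithinAt_defect hH h1 hx).continuousAt hI
    have h3 := (contDiffWithinAt_extChart_base h1 hx).continuousWithinAt.continuousAt hI
    exact h2.clm_apply (ContinuousAt.comp (f := fun t ↦ extChartAt 𝓘(ℝ, E) x₀ (ζ t).1)
      (((m.smooth_X i).contDiffAt (m.isOpen.mem_nhds hxO)).continuousAt) h3)
  have hpos : ∀ᶠ t in 𝓝 t₀, 0 < g t₀ * g t :=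
    (continuousAt_const.mul hg).eventually (lt_mem_nhds (mul_self_pos.2 hne))
  obtain ⟨δ', hδ', hpos'⟩ := Metric.eventually_nhds_iff_ball.1 hpos
  let η : ContDiffBump t₀ := ⟨min δ δ' / 4, min δ δ' / 2, by positivity, by
    have : 0 < min δ δ' := lt_min hδ hδ'
    linarith⟩
  have hmin : min δ δ' / 2 < min δ δ' := half_lt_self (lt_min hδ hδ')
  have hsupp : tsupport η ⊆ Metric.ball t₀ δ := by
    rw [η.tsupport_eq]
    exact Metric.closedBall_subset_ball (hmin.trans_le (min_le_left _ _))
  obtain ⟨Z, hZ, hvf, hvf0⟩ := hvar η η.contDiff (fun t ↦ ⟨η.nonneg, η.le_one⟩) hsupp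
  have hint := (hZ.hasDerivAt_action hθ hprim hH hab hε).unique (hcrit ε Z hε hZ)
  set F : ℝ → ℝ := fun t ↦ differential H (Z t 0).1 (variationField Z t)
    - (Z t 0).2.2 (variationField Z t) with hF
  have hFV : ∀ t ∈ Metric.ball t₀ δ, F t = η t * g t := by
    intro t ht
    have hZ0 := hZ.initial t (Ioo_subset_Icc_self (hball t ht).1)
    have h1 := defect_tcoord hH (z := Z t 0) (x₀ := x₀) (by rw [hZ0]; exact (hball t ht).2)
      (variationField Z t)
    rw [hvf t ht, map_smul] at h1
    have h2 : defect H x₀ (Z t 0) (m.X i (extChartAt 𝓘(ℝ, E) x₀ (Z t 0).1)) = g t := by rw [hZ0]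
    rw [h2] at h1
    exact h1.symm
  have hF0 : ∀ t ∈ Icc a b, t ∉ Metric.ball t₀ δ → F t = 0 := by
    intro t htI ht
    simp only [hF, hvf0 t htI ht, map_zero, sub_zero]
  have hFc : ContinuousOn F (Icc a b) :=
    (hZ.continuousOn_differential_variationField hH hab hε).sub
      (hZ.continuousOn_covector_variationField hab hε)
  have h2 : 0 < ∫ t in a..b, g t₀ * F t := by
    refine intervalIntegral.integral_pos hab (continuousOn_const.mul hFc) (fun t ht ↦ ?_)
      ⟨t₀, Ioo_subset_Icc_self ht₀, ?_⟩
    · by_cases htV : t ∈ Metric.ball t₀ δ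
      · rw [hFV t htV]
        by_cases h3 : t ∈ Metric.ball t₀ δ'
        · have h4 := (hpos' t h3).le
          have h5 : g t₀ * (η t * g t) = η t * (g t₀ * g t) := by ring
          rw [h5]
          exact mul_nonneg η.nonneg h4
        · have h4 : η t = 0 := η.zero_of_le_dist (by
            rw [Metric.mem_ball, not_lt] at h3
            exact (hmin.le.trans (min_le_right _ _)).trans h3)
          simp [h4]
      · simp [hF0 t (Ioc_subset_Icc_self ht) htV]
    · rw [hFV t₀ (Metric.mem_ball_self hδ), η.one_of_mem_closedBall (Metric.mem_closedBall_self η.rIn_pos.le),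
        one_mul]
      exact mul_self_pos.2 hne
  rw [intervalIntegral.integral_const_mul, hint, mul_zero] at h2
  exact lt_irrefl _ h2

omit [FiniteDimensional ℝ E] [T2Space M] in
theorem DiracStructure.finrank_fiber (D : DiracStructure E M) (x : M) :
    Module.finrank ℝ (D.fiber x) = Module.finrank ℝ E := by
  obtain ⟨U, -, hx, e, -, he⟩ := D.subbundle x
  rw [← (he x hx).2, finrank_span_eq_card (he x hx).1, Fintype.card_fin]

/-- The base path of a critical Dirac path is a Hamiltonian curve. -/
theorem IsCritical.isHamiltonianCurve (hH : ContMDiff 𝓘(ℝ, E) 𝓘(ℝ, ℝ) ∞ H)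
    (hθ : θ.IsHorizontal) (hprim : θ.IsPrimitive) (hab : a < b) (hζ : IsDiracPath D a b ζ)
    (hcrit : IsCritical a b θ H ζ) : IsHamiltonianCurve D a b H fun t ↦ (ζ t).1 := by
  intro t ht
  obtain ⟨m, L, hxO, hm⟩ := exists_isChartModel hprim (ζ t).1
  have hx := mem_extChartAt_source (I := 𝓘(ℝ, E)) (ζ t).1
  have hsm := hζ.smooth t ht
  have hc := (contDiffWithinAt_extChart_base hsm hx).continuousWithinAt
  have hX : ∀ i, defect H (ζ t).1 (ζ t) (m.X i (extChartAt 𝓘(ℝ, E) (ζ t).1 (ζ t).1)) = 0 := by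
    intro i
    -- The variations are supported at interior times, so the end points are reached by continuity
    -- from the open interval.
    have h1 : ContinuousWithinAt (fun τ ↦ defect H (ζ t).1 (ζ τ)
        (m.X i (extChartAt 𝓘(ℝ, E) (ζ t).1 (ζ τ).1))) (Ioo a b) t :=
      ((continuousWithinAt_defect hH hsm hx).clm_apply
        (ContinuousAt.comp_continuousWithinAt (f := fun τ ↦ extChartAt 𝓘(ℝ, E) (ζ t).1 (ζ τ).1)
          (((m.smooth_X i).contDiffAt (m.isOpen.mem_nhds hxO)).continuousAt) hc)).mono
        Ioo_subset_Icc_self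
    have h2 : ∀ᶠ τ in 𝓝[Ioo a b] t, defect H (ζ t).1 (ζ τ)
        (m.X i (extChartAt 𝓘(ℝ, E) (ζ t).1 (ζ τ).1)) = 0 := by
      have h3 := (((contMDiffWithinAt_gen_iff hx).1 hsm).1.continuousWithinAt.mono
        Ioo_subset_Icc_self).eventually ((isOpen_extChartAt_source (I := 𝓘(ℝ, E)) _).mem_nhds hx)
      have h4 := (hc.mono Ioo_subset_Icc_self).eventually (m.isOpen.mem_nhds hxO)
      filter_upwards [h3, h4, self_mem_nhdsWithin] with τ hτ1 hτ2 hτ3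
      exact hcrit.defect_eq_zero hH hθ hprim hab hζ hm hτ3 hτ1 hτ2 i
    have : (𝓝[Ioo a b] t).NeBot := mem_closure_iff_nhdsWithin_neBot.1 (by
      rwa [closure_Ioo hab.ne])
    exact tendsto_nhds_unique h1 (tendsto_const_nhds.congr' (h2.mono fun τ h ↦ h.symm))
  -- The pairing of `(ċ, dH)` with `e` is its pairing with `ζ`, zero by isotropy, plus `(dH - α)(ρ
  -- e)`, zero because the frame fields span `ρ(D)`.
  have key : ∀ e ∈ D.fiber (ζ t).1, pairing ((velocity a b (fun u ↦ (ζ u).1) t,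
      differential H (ζ t).1) : GenTangentSpace E (ζ t).1) e = 0 := by
    intro e he
    have h1 := D.isotropic _ _ (hζ.mem t ht) e he
    have h2 : differential H (ζ t).1 e.1 - (ζ t).2.2 e.1 = 0 := by
      have h3 : tcoord E (ζ t).1 (ζ t).1 e.1 = m.vec _ _ :=
        congrArg Prod.fst (hm.gcoord_eq_extChart hx hxO he)
      rw [← defect_tcoord hH hx, h3]
      simp only [LocalModel.vec, map_sum, map_smul, hX, smul_zero, Finset.sum_const_zero]
    unfold pairing at h1 ⊢
    rw [hζ.anchor_eq t ht] at h1
    have h4 : ∀ u v w : ℝ, u - v = 0 → v + w = 0 → u + w = 0 := by intros; linarith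
    exact h4 _ _ _ h2 h1
  exact mem_of_isotropic (E := E) (D.fiber (ζ t).1) (D.finrank_fiber _) (D.isotropic _) key

/-- Dirac paths over Hamiltonian curves are critical. -/
theorem IsHamiltonianCurve.isCritical (hH : ContMDiff 𝓘(ℝ, E) 𝓘(ℝ, ℝ) ∞ H)
    (hθ : θ.IsHorizontal) (hprim : θ.IsPrimitive) (hab : a < b)
    (h : IsHamiltonianCurve D a b H fun t ↦ (ζ t).1) : IsCritical a b θ H ζ := by
  intro ε Z hε hZ
  refine (hZ.hasDerivAt_action hθ hprim hH hab hε).congr_deriv ?_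
  have hham := h.congr (γ' := fun t ↦ (Z t 0).1) fun t ht ↦ by rw [hZ.initial t ht]
  have h0 : (0 : ℝ) ∈ Ioo (-ε) ε := by simpa using hε
  have hpath := hZ.diracPath 0 h0
  -- A lift `e` of the variation field is orthogonal both to `(ċ, dH)` and to `(ċ, α)`. Subtracting
  -- the two relations cancels the term `e.2(ċ)`.
  have hzero : ∀ t ∈ Icc a b, differential H (Z t 0).1 (variationField Z t)
      - (Z t 0).2.2 (variationField Z t) = 0 := by
    intro t ht
    obtain ⟨e, he, -⟩ := hZ.exists_lift hprim hab hε ht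
    have h1 := D.isotropic _ _ (hham t ht) e.1 e.2
    have h2 := D.isotropic _ _ (hpath.mem t ht) e.1 e.2
    unfold pairing at h1 h2
    rw [hpath.anchor_eq t ht] at h2
    rw [← he]
    have h4 : ∀ u v w : ℝ, u + w = 0 → v + w = 0 → u - v = 0 := by intros; linarith
    exact h4 _ _ _ h1 h2
  rw [intervalIntegral.integral_congr (g := fun _ ↦ (0 : ℝ))
    fun t ht ↦ hzero t (uIcc_of_le hab.le ▸ ht)]
  simp

end Critical

end DiracGeometry

end

theorem theorem1 {E : Type*} [NormedAddCommGroup E] [NormedSpace ℝ E] [FiniteDimensional ℝ E]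
    {M : Type*} [TopologicalSpace M] [T2Space M] [SecondCountableTopology M]
    [ChartedSpace E M] [IsManifold 𝓘(ℝ, E) ∞ M]
    (D : DiracGeometry.DiracStructure E M)
    (H : M → ℝ) (hH : ContMDiff 𝓘(ℝ, E) 𝓘(ℝ, ℝ) ∞ H)
    (a b : ℝ) (hab : a < b)
    (γ : ℝ → M) (hγ : ContMDiffOn 𝓘(ℝ, ℝ) 𝓘(ℝ, E) ∞ γ (Icc a b))
    (θ : D.DualSec) (hθ : θ.IsHorizontal) (hprim : θ.IsPrimitive) :
    List.TFAE [
      DiracGeometry.IsHamiltonianCurve D a b H γ,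
      (∃ ζ, DiracGeometry.IsDiracPathOver D a b γ ζ) ∧
        ∀ ζ, DiracGeometry.IsDiracPathOver D a b γ ζ → DiracGeometry.IsCritical a b θ H ζ,
      ∃ ζ, DiracGeometry.IsDiracPathOver D a b γ ζ ∧ DiracGeometry.IsCritical a b θ H ζ] := by
  tfae_have 1 → 2 := fun h ↦ ⟨⟨_, h.isDiracPathOver hH hab hγ⟩, fun ζ hζ ↦
    (h.congr fun t ht ↦ (hζ.2 t ht).symm).isCritical hH hθ hprim hab⟩
  -- The existence clause matters: over a path whose velocity leaves `ρ(D)` there is no Dirac path,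
  -- and the universal clause alone would hold vacuously.
  tfae_have 2 → 3 := fun ⟨⟨ζ, hζ⟩, h⟩ ↦ ⟨ζ, hζ, h ζ hζ⟩
  tfae_have 3 → 1 := fun ⟨ζ, hζ, h⟩ ↦
    (h.isHamiltonianCurve hH hθ hprim hab hζ.1).congr hζ.2
  tfae_finish
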